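/- All varieties are projective and defined over $\mathbb C$ (integral closed subschemes of some $\mathbb P^n_{\mathbb C}$). Let $\pi:X\to Z$ be a finite surjective morphism over $\mathbb C$ of smooth projective varieties, let $M\neq 0$ be a torsion-free coherent sheaf on $X$, let $V$ be a locally free sheaf of finite rank on $Z$, and let $\sigma\in H^0(X,\pi^*V)$. There is a unique morphism $\Phi:\pi_*M\to\pi_*M\otimes V$ that corresponds, under the projection formula $\pi_*M\otimes V\cong\pi_*(M\otimes\pi^*V)$, to the pushforward by $\pi$ of $\underline\sigma:M\to M\otimes\pi^*V$, $m\mapsto m\otimes\sigma$; it is a Higgs field, i.e. $\Phi\wedge\Phi=0$. Let $p_V:\mathrm{Tot}(V)\to Z$ be the total space of $V$ (the relative spectrum of $\mathrm{Sym}(V^\vee)$) with its tautological section $\eta$ of $p_V^*V$, and let the spectral cover $C_\Phi\subset\mathrm{Tot}(V)$ be the closed subscheme where $\det(\Phi-\eta\otimes\mathrm{id})\in H^0(\mathrm{Tot}(V),p_V^*\mathrm{Sym}^r V)$ vanishes, $r$ being the rank of $\pi_*M$. (The determinant is computed at the generic point of $Z$, where $\pi_*M$ is free; its coefficients are regular.)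 Let $\pi_\Phi:C_\Phi\to Z$ be the restriction of $p_V$. Then there are a normal projective variety $Y$ and finite morphisms $p:X\to Y$ and $q:Y\to Z$ with $\pi=q\circ p$, such that 1. there is $\tau\in H^0(Y,q^*V)$ with $p^*\tau=\sigma$ in $H^0(X,\pi^*V)$, and, under $\pi_*M= q_*(p_*M)$, $\Phi$ is the pushforward by $q$ (again through the projection formula) of $\underline\tau:p_*M\to p_*M\otimes q^*V$, $m\mapsto m\otimes\tau$; 2. $C_\Phi$ is irreducible and $Y$ is its normalization, over $Z$: there is a morphism $\nu:Y\to C_\Phi$ that is the normalization of $C_\Phi$ in the residue field of its generic point (that is, the normalization of the reduced scheme $(C_\Phi)_{\mathrm{red}}$), and $\pi_\Phi\circ\nu=q$. -/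

import Mathlib

open CategoryTheory AlgebraicGeometry TopologicalSpace Limits

namespace HiggsCover

noncomputable section

universe u

section Tensor
variable {X : Scheme.{u}}

/-- The sheaf of `𝒪_X`-modules associated with a presheaf of `𝒪_X`-modules, as the left adjoint of
the inclusion of sheaves into presheaves. -/
def sheafify (X : Scheme.{u}) : X.PresheafOfModules ⥤ X.Modules :=
  (Scheme.Modules.toPresheafOfModules X).leftAdjoint

/-- The universal property of sheafification. -/
def sheafifyAdj (X : Scheme.{u}) : sheafify X ⊣ Scheme.Modules.toPresheafOfModules X :=
  Adjunction.ofIsRightAdjoint _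

/-- The presheaf `U ↦ M(U) ⊗_{𝒪(U)} N(U)`. -/
def presheafTensor (M N : X.Modules) : X.PresheafOfModules :=
  PresheafOfModules.Monoidal.tensorObj (R := X.presheaf) M.val N.val

/-- The map of presheaves `m ⊗ n ↦ f(m) ⊗ n`. -/
def presheafTensorMap {M M' : X.Modules} (f : M ⟶ M') (N : X.Modules) :
    presheafTensor M N ⟶ presheafTensor M' N :=
  PresheafOfModules.Monoidal.tensorHom (R := X.presheaf) f.val (𝟙 N.val)

/-- The tensor product `M ⊗ N` of sheaves of `𝒪_X`-modules: the sheaf associated with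
`U ↦ M(U) ⊗_{𝒪(U)} N(U)`. -/
def tensor (M N : X.Modules) : X.Modules := (sheafify X).obj (presheafTensor M N)

/-- The map `f ⊗ id_N : M ⊗ N ⟶ M' ⊗ N`. -/
def tensorMap {M M' : X.Modules} (f : M ⟶ M') (N : X.Modules) : tensor M N ⟶ tensor M' N :=
  (sheafify X).map (presheafTensorMap f N)

/-- The map from the presheaf tensor product to its sheafification. -/
def tensorUnit (M N : X.Modules) :
    presheafTensor M N ⟶ (Scheme.Modules.toPresheafOfModules X).obj (tensor M N) :=
  (sheafifyAdj X).unit.app (presheafTensor M N)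

/-- The canonical map `M(U) ⊗ N(U) → (M ⊗ N)(U)`. -/
def tensorSections (M N : X.Modules) (U : X.Opens) :
    TensorProduct Γ(X, U) Γ(M, U) Γ(N, U) →ₗ[Γ(X, U)] Γ(tensor M N, U) :=
  ((tensorUnit M N).app (.op U)).hom

/-- The section `m ⊗ n` of `M ⊗ N` over `U`. -/
def tmul {M N : X.Modules} {U : X.Opens} (m : Γ(M, U)) (n : Γ(N, U)) : Γ(tensor M N, U) :=
  tensorSections M N U (TensorProduct.tmul _ m n)

lemma tmul_add {M N : X.Modules} {U : X.Opens} (m : Γ(M, U)) (n n' : Γ(N, U)) :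
    tmul m (n + n') = tmul m n + tmul m n' := by
  simp [tmul, TensorProduct.tmul_add]

lemma add_tmul {M N : X.Modules} {U : X.Opens} (m m' : Γ(M, U)) (n : Γ(N, U)) :
    tmul (m + m') n = tmul m n + tmul m' n := by
  simp [tmul, TensorProduct.add_tmul]

lemma smul_tmul {M N : X.Modules} {U : X.Opens} (r : Γ(X, U)) (m : Γ(M, U)) (n : Γ(N, U)) :
    tmul (r • m) n = r • tmul m n := by
  rw [tmul, ← TensorProduct.smul_tmul', map_smul, tmul]

lemma tmul_smul {M N : X.Modules} {U : X.Opens} (r : Γ(X, U)) (m : Γ(M, U)) (n : Γ(N, U)) :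
    tmul m (r • n) = r • tmul m n := by
  rw [tmul, TensorProduct.tmul_smul, map_smul, tmul]

lemma map_tmul {M N : X.Modules} {U V : X.Opens} (i : V ⟶ U) (m : Γ(M, U)) (n : Γ(N, U)) :
    (tensor M N).presheaf.map i.op (tmul m n) =
      tmul (M.presheaf.map i.op m) (N.presheaf.map i.op n) :=
  (PresheafOfModules.naturality_apply (tensorUnit M N) i.op _).symm

/-- The map `M ⊗ N ⟶ P` induced by bilinear maps `M(U) × N(U) → P(U)` compatible with restriction. -/
def tensorDesc {M N P : X.Modules}
    (β : ∀ U : X.Opens, Γ(M, U) →ₗ[Γ(X, U)] Γ(N, U) →ₗ[Γ(X, U)] Γ(P, U))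
    (hβ : ∀ ⦃U V : X.Opens⦄ (i : V ⟶ U) (m : Γ(M, U)) (n : Γ(N, U)),
      P.presheaf.map i.op (β U m n) = β V (M.presheaf.map i.op m) (N.presheaf.map i.op n)) :
    tensor M N ⟶ P :=
  ((sheafifyAdj X).homEquiv (presheafTensor M N) P).symm
    { app := fun U =>
        (ModuleCat.ofHom (TensorProduct.lift (β U.unop)) :
          ModuleCat.of Γ(X, U.unop) (TensorProduct Γ(X, U.unop) Γ(M, U.unop) Γ(N, U.unop)) ⟶
            ModuleCat.of Γ(X, U.unop) Γ(P, U.unop))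
      naturality := fun {U _} i =>
        ModuleCat.MonoidalCategory.tensor_ext (R := X.presheaf.obj U) fun m n =>
        (hβ i.unop m n).symm }

lemma tensorDesc_tmul {M N P : X.Modules}
    (β : ∀ U : X.Opens, Γ(M, U) →ₗ[Γ(X, U)] Γ(N, U) →ₗ[Γ(X, U)] Γ(P, U))
    (hβ : ∀ ⦃U V : X.Opens⦄ (i : V ⟶ U) (m : Γ(M, U)) (n : Γ(N, U)),
      P.presheaf.map i.op (β U m n) = β V (M.presheaf.map i.op m) (N.presheaf.map i.op n))
    (U : X.Opens) (m : Γ(M, U)) (n : Γ(N, U)) :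
    (tensorDesc β hβ).app U (tmul m n) = β U m n := by
  have h := ((sheafifyAdj X).homEquiv (presheafTensor M N) P).apply_symm_apply
    { app := fun U =>
        (ModuleCat.ofHom (TensorProduct.lift (β U.unop)) :
          ModuleCat.of Γ(X, U.unop) (TensorProduct Γ(X, U.unop) Γ(M, U.unop) Γ(N, U.unop)) ⟶
            ModuleCat.of Γ(X, U.unop) Γ(P, U.unop))
      naturality := fun {U _} i =>
        ModuleCat.MonoidalCategory.tensor_ext (R := X.presheaf.obj U) fun m n =>
        (hβ i.unop m n).symm }
  rw [Adjunction.homEquiv_unit] at h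
  exact congr($(h).app (.op U) (TensorProduct.tmul _ m n))

variable {Y : Scheme.{u}}

/-- The pullback `f^* v`, a section of `f^* V` over `f⁻¹(U)`, of a section `v` of `V` over `U`. -/
def pullSection (f : X ⟶ Y) (V : Y.Modules) {U : Y.Opens} (v : Γ(V, U)) :
    Γ((Scheme.Modules.pullback f).obj V, f ⁻¹ᵁ U) :=
  ((Scheme.Modules.pullbackPushforwardAdjunction f).unit.app V).app U v

/-- The canonical map `f_* M ⊗ V ⟶ f_* (M ⊗ f^* V)`, `m ⊗ v ↦ m ⊗ f^* v`, of the projection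
formula. -/
def projectionMap (f : X ⟶ Y) (M : X.Modules) (V : Y.Modules) :
    tensor ((Scheme.Modules.pushforward f).obj M) V ⟶
      (Scheme.Modules.pushforward f).obj (tensor M ((Scheme.Modules.pullback f).obj V)) :=
  tensorDesc
    (fun U => LinearMap.mk₂ Γ(Y, U)
      (fun (m : Γ(M, f ⁻¹ᵁ U)) (v : Γ(V, U)) => (tmul m (pullSection f V v) : Γ(tensor M _, f ⁻¹ᵁ U)))
      (fun m m' v => add_tmul _ _ _)
      (fun r m v => smul_tmul (f.app U r) m _)
      (fun m v v' => by rw [pullSection, map_add]; exact tmul_add _ _ _)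
      (fun r m v => by
        rw [pullSection, Scheme.Modules.Hom.app_smul]
        exact tmul_smul (f.app U r) m _))
    (fun _ _ i m v => by
      refine (map_tmul (((Opens.map f.base).map i)) m _).trans ?_
      have := NatTrans.naturality_apply ((Scheme.Modules.pullbackPushforwardAdjunction f).unit.app V).mapPresheaf i.op v
      exact congr(tmul _ $(this.symm)))

/-- The map `M ⟶ M ⊗ W`, `m ↦ m ⊗ s`, for a global section `s` of `W`. -/
def mulSection (M : X.Modules) {W : X.Modules} (s : Γ(W, ⊤)) : M ⟶ tensor M W :=
  ⟨{ app := fun U =>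
        (ModuleCat.ofHom
          { toFun := fun m => tmul m (W.presheaf.map (homOfLE le_top).op s)
            map_add' := fun m m' => add_tmul _ _ _
            map_smul' := fun r m => smul_tmul _ _ _ } :
          ModuleCat.of Γ(X, U.unop) Γ(M, U.unop) ⟶
            ModuleCat.of Γ(X, U.unop) Γ(tensor M W, U.unop))
     naturality := fun {U V} i => by
      ext m
      refine Eq.trans ?_ (map_tmul i.unop m _).symm
      have h : W.presheaf.map (homOfLE (le_top (a := V.unop))).op s =
          W.presheaf.map i.unop.op (W.presheaf.map (homOfLE (le_top (a := U.unop))).op s) := by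
        rw [← ConcreteCategory.comp_apply, ← Functor.map_comp]; rfl
      exact congr(tmul _ $h) }⟩
end Tensor

section Tot
variable {Z : Scheme.{u}}

/-- The sections `e 1, …, e n` of `V` over `U` form a frame of `V` over `U`: on every open `W ⊆ U` they
restrict to a basis of `V(W)` over `𝒪(W)`. -/
def IsFrame (V : Z.Modules) {U : Z.Opens} {n : ℕ} (e : Fin n → Γ(V, U)) : Prop :=
  ∀ (W : Z.Opens) (h : W ≤ U), Function.Bijective
    (fun a : Fin n → Γ(Z, W) => ∑ i, a i • V.presheaf.map (homOfLE h).op (e i))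

/-- `V` is locally free of finite rank. -/
def IsVectorBundle (V : Z.Modules) : Prop :=
  ∀ z : Z, ∃ U : Z.Opens, z ∈ U ∧ ∃ (n : ℕ) (e : Fin n → Γ(V, U)), IsFrame V e

variable {V : Z.Modules}

/-- The basis of `V(W)` given by a frame. -/
def IsFrame.basis {U : Z.Opens} {n : ℕ} {e : Fin n → Γ(V, U)} (he : IsFrame V e)
    (W : Z.Opens) (h : W ≤ U) : Module.Basis (Fin n) Γ(Z, W) Γ(V, W) :=
  .ofEquivFun (LinearEquiv.ofBijective
    (Fintype.linearCombination Γ(Z, W) fun i => V.presheaf.map (homOfLE h).op (e i)) (he W h)).symm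

lemma IsFrame.basis_apply {U : Z.Opens} {n : ℕ} {e : Fin n → Γ(V, U)} (he : IsFrame V e)
    (W : Z.Opens) (h : W ≤ U) (i : Fin n) :
    he.basis W h i = V.presheaf.map (homOfLE h).op (e i) := by
  classical
  rw [IsFrame.basis, Module.Basis.coe_ofEquivFun, LinearEquiv.symm_symm]
  change Fintype.linearCombination Γ(Z, W)
    (fun i => V.presheaf.map (homOfLE h).op (e i)) (Pi.single i 1) = _
  rw [Fintype.linearCombination_apply_single, one_smul]

lemma IsFrame.restrict {U : Z.Opens} {n : ℕ} {e : Fin n → Γ(V, U)} (he : IsFrame V e)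
    {W : Z.Opens} (h : W ≤ U) : IsFrame V fun i => V.presheaf.map (homOfLE h).op (e i) := by
  intro W' h'
  convert he W' (h'.trans h) using 5 with a i
  rw [← ConcreteCategory.comp_apply, ← Functor.map_comp]
  rfl

lemma IsFrame.map_basis {U : Z.Opens} {n : ℕ} {e : Fin n → Γ(V, U)} (he : IsFrame V e)
    {W W' : Z.Opens} (h : W ≤ U) (h' : W' ≤ W) (i : Fin n) :
    V.presheaf.map (homOfLE h').op (he.basis W h i) = he.basis W' (h'.trans h) i := by
  rw [basis_apply, basis_apply, ← ConcreteCategory.comp_apply, ← Functor.map_comp]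
  rfl

lemma IsFrame.existsUnique_dual {U : Z.Opens} {n : ℕ} {e : Fin n → Γ(V, U)} (he : IsFrame V e)
    {W : Z.Opens} (h : W ≤ U) (φ : Module.Dual Γ(Z, U) Γ(V, U)) :
    ∃! ψ : Module.Dual Γ(Z, W) Γ(V, W), ∀ v : Γ(V, U),
      ψ (V.presheaf.map (homOfLE h).op v) = Z.presheaf.map (homOfLE h).op (φ v) := by
  refine ⟨(he.basis W h).constr Γ(Z, W) fun i => Z.presheaf.map (homOfLE h).op
    (φ (he.basis U le_rfl i)), fun v => ?_, fun ψ hψ => ?_⟩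
  · conv_lhs => rw [← (he.basis U le_rfl).sum_repr v]
    conv_rhs => rw [← (he.basis U le_rfl).sum_repr v]
    simp only [map_sum, Scheme.Modules.map_smul, map_smul, he.map_basis, Module.Basis.constr_basis,
      smul_eq_mul, map_mul]
  · refine (he.basis W h).ext fun i => ?_
    rw [Module.Basis.constr_basis, ← hψ, he.map_basis]

variable (V) in
/-- An affine open of `Z` over which `V` has a frame. -/
structure FramedOpens where
  carrier : Z.Opens
  isAffineOpen : IsAffineOpen carrier
  exists_frame : ∃ (n : ℕ) (e : Fin n → Γ(V, carrier)), IsFrame V e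

instance : Preorder (FramedOpens V) := Preorder.lift FramedOpens.carrier

lemma FramedOpens.carrier_le {W U : FramedOpens V} (h : W ≤ U) : W.carrier ≤ U.carrier := h

lemma exists_framedOpens (hV : IsVectorBundle V) {z : Z} {U : Z.Opens} (hz : z ∈ U) :
    ∃ W : FramedOpens V, z ∈ W.carrier ∧ W.carrier ≤ U := by
  obtain ⟨U', hz', n, e, he⟩ := hV z
  obtain ⟨_, ⟨W, hW, rfl⟩, hzW, hWU⟩ :=
    Z.isBasis_affineOpens.exists_subset_of_mem_open (show z ∈ U ⊓ U' from ⟨hz, hz'⟩) (U ⊓ U').2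
  have h2 : W ≤ U ⊓ U' := hWU
  exact ⟨⟨W, hW, n, _, he.restrict (h2.trans inf_le_right)⟩, hzW, h2.trans inf_le_left⟩

/-- The ring `Sym(V(U)^∨)` of functions on the total space of `V` over an affine open `U`: functions on
`U` with polynomial dependence on the vector. -/
abbrev FunctionRing (V : Z.Modules) (U : Z.Opens) : Type u :=
  SymmetricAlgebra Γ(Z, U) (Module.Dual Γ(Z, U) Γ(V, U))

/-- Restriction of linear forms on `V` to a smaller open: the unique linear form compatible with
restriction of sections. -/
def dualRes {W U : FramedOpens V} (h : W ≤ U)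
    (φ : Module.Dual Γ(Z, U.carrier) Γ(V, U.carrier)) :
    Module.Dual Γ(Z, W.carrier) Γ(V, W.carrier) :=
  (U.exists_frame.choose_spec.choose_spec.existsUnique_dual (FramedOpens.carrier_le h) φ).choose

lemma dualRes_apply {W U : FramedOpens V} (h : W ≤ U)
    (φ : Module.Dual Γ(Z, U.carrier) Γ(V, U.carrier)) (v : Γ(V, U.carrier)) :
    dualRes h φ (V.presheaf.map (homOfLE (FramedOpens.carrier_le h)).op v) =
      Z.presheaf.map (homOfLE (FramedOpens.carrier_le h)).op (φ v) :=
  (U.exists_frame.choose_spec.choose_spec.existsUnique_dual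
    (FramedOpens.carrier_le h) φ).choose_spec.1 v

lemma dualRes_unique {W U : FramedOpens V} (h : W ≤ U)
    (φ : Module.Dual Γ(Z, U.carrier) Γ(V, U.carrier))
    (ψ : Module.Dual Γ(Z, W.carrier) Γ(V, W.carrier)) (hψ : ∀ v : Γ(V, U.carrier),
      ψ (V.presheaf.map (homOfLE (FramedOpens.carrier_le h)).op v) =
        Z.presheaf.map (homOfLE (FramedOpens.carrier_le h)).op (φ v)) :
    dualRes h φ = ψ :=
  ((U.exists_frame.choose_spec.choose_spec.existsUnique_dual
    (FramedOpens.carrier_le h) φ).choose_spec.2 ψ hψ).symm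

/-- Restriction of functions on the total space of `V` to the part over a smaller open. -/
def functionRes {W U : FramedOpens V} (h : W ≤ U) :
    FunctionRing V U.carrier →+* FunctionRing V W.carrier :=
  letI : Algebra Γ(Z, U.carrier) (FunctionRing V W.carrier) :=
    ((algebraMap Γ(Z, W.carrier) _).comp (Z.presheaf.map (homOfLE (FramedOpens.carrier_le h)).op).hom).toAlgebra
  (SymmetricAlgebra.lift
    { toFun := fun φ => SymmetricAlgebra.ι _ _ (dualRes h φ)
      map_add' := fun φ φ' => by
        rw [← map_add]
        congr 1
        exact dualRes_unique _ _ _ fun v => by simp [dualRes_apply]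
      map_smul' := fun r φ => by
        rw [RingHom.id_apply, Algebra.smul_def, RingHom.algebraMap_toAlgebra, RingHom.comp_apply,
          ← Algebra.smul_def, ← map_smul]
        congr 1
        exact dualRes_unique _ _ _ fun v => by simp [dualRes_apply] } :
    FunctionRing V U.carrier →ₐ[Γ(Z, U.carrier)] FunctionRing V W.carrier).toRingHom

lemma functionRes_algebraMap {W U : FramedOpens V} (h : W ≤ U) (r : Γ(Z, U.carrier)) :
    functionRes h (algebraMap _ (FunctionRing V U.carrier) r) =
      algebraMap _ (FunctionRing V W.carrier) (Z.presheaf.map (homOfLE (FramedOpens.carrier_le h)).op r) := by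
  let : Algebra Γ(Z, U.carrier) (FunctionRing V W.carrier) :=
    ((algebraMap Γ(Z, W.carrier) _).comp (Z.presheaf.map (homOfLE (FramedOpens.carrier_le h)).op).hom).toAlgebra
  exact AlgHom.commutes (R := Γ(Z, U.carrier)) _ r

lemma functionRes_ι {W U : FramedOpens V} (h : W ≤ U) (φ : Module.Dual Γ(Z, U.carrier) Γ(V, U.carrier)) :
    functionRes h (SymmetricAlgebra.ι _ _ φ) = SymmetricAlgebra.ι _ _ (dualRes h φ) := by
  let : Algebra Γ(Z, U.carrier) (FunctionRing V W.carrier) :=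
    ((algebraMap Γ(Z, W.carrier) _).comp (Z.presheaf.map (homOfLE (FramedOpens.carrier_le h)).op).hom).toAlgebra
  exact SymmetricAlgebra.lift_ι_apply _ _

lemma functionRing_hom_ext {U : Z.Opens} {S : Type*} [CommRing S] {f g : FunctionRing V U →+* S}
    (h₁ : ∀ r, f (algebraMap Γ(Z, U) _ r) = g (algebraMap Γ(Z, U) _ r))
    (h₂ : ∀ φ, f (SymmetricAlgebra.ι Γ(Z, U) _ φ) = g (SymmetricAlgebra.ι Γ(Z, U) _ φ)) : f = g := by
  let : Algebra Γ(Z, U) S := (f.comp (algebraMap Γ(Z, U) _)).toAlgebra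
  let f' : FunctionRing V U →ₐ[Γ(Z, U)] S := ⟨f, fun r => rfl⟩
  let g' : FunctionRing V U →ₐ[Γ(Z, U)] S := ⟨g, fun r => (h₁ r).symm⟩
  have : f' = g' := SymmetricAlgebra.algHom_ext (LinearMap.ext h₂)
  exact RingHom.ext fun x => congr($this x)


variable (V) in
/-- The open cover of `Z` by the affine opens over which `V` has a frame. -/
def framedCover (hV : IsVectorBundle V) : Z.OpenCover where
  I₀ := FramedOpens V
  X U := Spec Γ(Z, U.carrier)
  f U := U.isAffineOpen.fromSpec
  mem₀ := by
    rw [Scheme.presieve₀_mem_precoverage_iff]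
    refine ⟨fun x => ?_, inferInstance⟩
    obtain ⟨W, hW, -⟩ := exists_framedOpens hV (z := x) (U := ⊤) trivial
    refine ⟨W, ?_⟩
    rw [IsAffineOpen.range_fromSpec]
    exact hW

instance (hV : IsVectorBundle V) : Preorder (framedCover V hV).I₀ :=
  inferInstanceAs (Preorder (FramedOpens V))

/-- The open immersion `W ↪ U` of affine opens. -/
def specRes {W U : FramedOpens V} (h : W ≤ U) : Spec Γ(Z, W.carrier) ⟶ Spec Γ(Z, U.carrier) :=
  Spec.map (Z.presheaf.map (homOfLE (FramedOpens.carrier_le h)).op)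

lemma specRes_fromSpec {W U : FramedOpens V} (h : W ≤ U) :
    specRes h ≫ U.isAffineOpen.fromSpec = W.isAffineOpen.fromSpec :=
  U.isAffineOpen.map_fromSpec W.isAffineOpen _

lemma specRes_refl (U : FramedOpens V) : specRes (le_refl U) = 𝟙 _ := by
  rw [← cancel_mono U.isAffineOpen.fromSpec, specRes_fromSpec, Category.id_comp]

lemma specRes_trans {T W U : FramedOpens V} (h : T ≤ W) (h' : W ≤ U) :
    specRes (h.trans h') = specRes h ≫ specRes h' := by
  rw [← cancel_mono U.isAffineOpen.fromSpec, specRes_fromSpec, Category.assoc, specRes_fromSpec,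
    specRes_fromSpec]

lemma isOpenImmersion_specRes {W U : FramedOpens V} (h : W ≤ U) : IsOpenImmersion (specRes h) := by
  have : IsOpenImmersion (specRes h ≫ U.isAffineOpen.fromSpec) := by
    rw [specRes_fromSpec]; infer_instance
  exact IsOpenImmersion.of_comp _ U.isAffineOpen.fromSpec

lemma framed_directed (hV : IsVectorBundle V) (U W : FramedOpens V)
    (x : ↥(pullback U.isAffineOpen.fromSpec W.isAffineOpen.fromSpec)) :
    ∃ (T : FramedOpens V) (hU : T ≤ U) (hW : T ≤ W) (y : ↥(Spec Γ(Z, T.carrier))),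
      pullback.lift (specRes hU) (specRes hW)
        (by rw [specRes_fromSpec, specRes_fromSpec]) y = x := by
  have hxU : (pullback.fst U.isAffineOpen.fromSpec W.isAffineOpen.fromSpec ≫
      U.isAffineOpen.fromSpec) x ∈ U.carrier := by
    rw [← SetLike.mem_coe, ← U.isAffineOpen.range_fromSpec]
    exact ⟨_, rfl⟩
  have hxW : (pullback.fst U.isAffineOpen.fromSpec W.isAffineOpen.fromSpec ≫
      U.isAffineOpen.fromSpec) x ∈ W.carrier := by
    rw [pullback.condition, ← SetLike.mem_coe, ← W.isAffineOpen.range_fromSpec]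
    exact ⟨_, rfl⟩
  obtain ⟨T, hxT, hT⟩ := exists_framedOpens hV (U := U.carrier ⊓ W.carrier) ⟨hxU, hxW⟩
  obtain ⟨y, hy⟩ : _ ∈ Set.range T.isAffineOpen.fromSpec := by
    rw [IsAffineOpen.range_fromSpec]; exact hxT
  refine ⟨T, show T.carrier ≤ U.carrier from hT.trans inf_le_left,
    show T.carrier ≤ W.carrier from hT.trans inf_le_right, y, ?_⟩
  apply (pullback.fst U.isAffineOpen.fromSpec W.isAffineOpen.fromSpec ≫
    U.isAffineOpen.fromSpec).isOpenEmbedding.injective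
  rw [← Scheme.Hom.comp_apply, pullback.lift_fst_assoc, specRes_fromSpec, hy]

instance (hV : IsVectorBundle V) : (framedCover V hV).LocallyDirected where
  trans {U W} h := specRes (V := V) (leOfHom h)
  trans_id U := specRes_refl (V := V) U
  trans_comp {U W T} h h' := specRes_trans (V := V) (leOfHom h) (leOfHom h')
  w {U W} h := specRes_fromSpec (V := V) (leOfHom h)
  directed {U W} x := by
    obtain ⟨T, hU, hW, y, hy⟩ := framed_directed hV U W x
    exact ⟨T, homOfLE hU, homOfLE hW, y, hy⟩
  property_trans {U W} h := isOpenImmersion_specRes (V := V) (leOfHom h)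

lemma dualRes_refl (U : FramedOpens V) (φ : Module.Dual Γ(Z, U.carrier) Γ(V, U.carrier)) :
    dualRes (le_refl U) φ = φ :=
  dualRes_unique _ _ _ fun v =>
    congr(φ ($(V.presheaf.map_id _) v)).trans congr($(Z.presheaf.map_id _) (φ v)).symm

lemma dualRes_trans {T W U : FramedOpens V} (h : T ≤ W) (h' : W ≤ U)
    (φ : Module.Dual Γ(Z, U.carrier) Γ(V, U.carrier)) :
    dualRes (h.trans h') φ = dualRes h (dualRes h' φ) := by
  refine dualRes_unique _ _ _ fun v => ?_
  have : V.presheaf.map (homOfLE (FramedOpens.carrier_le (h.trans h'))).op v =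
      V.presheaf.map (homOfLE (FramedOpens.carrier_le h)).op
        (V.presheaf.map (homOfLE (FramedOpens.carrier_le h')).op v) := by
    rw [← ConcreteCategory.comp_apply, ← Functor.map_comp]; rfl
  rw [this, dualRes_apply, dualRes_apply, ← ConcreteCategory.comp_apply, ← Functor.map_comp]
  rfl

lemma functionRes_refl (U : FramedOpens V) :
    functionRes (le_refl U) = RingHom.id (FunctionRing V U.carrier) := by
  refine functionRing_hom_ext (fun r => ?_) fun φ => ?_
  · rw [functionRes_algebraMap]
    exact congr(algebraMap _ (FunctionRing V U.carrier) ($(Z.presheaf.map_id _) r))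
  · rw [functionRes_ι, dualRes_refl, RingHom.id_apply]

lemma functionRes_trans {T W U : FramedOpens V} (h : T ≤ W) (h' : W ≤ U) :
    functionRes (h.trans h') = (functionRes h).comp (functionRes h') := by
  refine functionRing_hom_ext (fun r => ?_) fun φ => ?_
  · rw [RingHom.comp_apply, functionRes_algebraMap, functionRes_algebraMap, functionRes_algebraMap,
      ← ConcreteCategory.comp_apply, ← Functor.map_comp]
    rfl
  · rw [RingHom.comp_apply, functionRes_ι, functionRes_ι, functionRes_ι, dualRes_trans]

lemma existsUnique_functionRing_hom {W U : FramedOpens V} (h : W ≤ U) {S : Type u} [CommRing S]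
    (a : Γ(Z, W.carrier) →+* S) (b : FunctionRing V U.carrier →+* S)
    (hab : ∀ r, a (Z.presheaf.map (homOfLE (FramedOpens.carrier_le h)).op r) =
      b (algebraMap _ _ r)) :
    ∃! c : FunctionRing V W.carrier →+* S,
      (∀ r, c (algebraMap _ _ r) = a r) ∧ ∀ x, c (functionRes h x) = b x := by
  obtain ⟨n, e, he⟩ := U.exists_frame
  set bU := he.basis U.carrier le_rfl
  set bW := he.basis W.carrier (FramedOpens.carrier_le h)
  have hres (i : Fin n) : dualRes h (bU.coord i) = bW.coord i := by
    refine dualRes_unique _ _ _ fun v => ?_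
    obtain ⟨c, rfl⟩ := bU.equivFun.symm.surjective v
    rw [Module.Basis.equivFun_symm_apply]
    simp only [map_sum, Scheme.Modules.map_smul, map_smul, he.map_basis, bU, bW,
      Module.Basis.coord_apply, Module.Basis.repr_self, smul_eq_mul, map_mul]
    refine Finset.sum_congr rfl fun j _ => ?_
    by_cases hij : j = i
    · subst hij; simp
    · simp [hij]
  let _ : Algebra Γ(Z, W.carrier) S := a.toAlgebra
  have key (f g : FunctionRing V U.carrier →+* S)
      (h₁ : ∀ r, f (algebraMap Γ(Z, U.carrier) _ r) = g (algebraMap Γ(Z, U.carrier) _ r))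
      (h₂ : ∀ i, f (SymmetricAlgebra.ι _ _ (bU.coord i)) =
        g (SymmetricAlgebra.ι _ _ (bU.coord i))) : f = g := by
    refine functionRing_hom_ext h₁ fun φ => ?_
    obtain ⟨c, rfl⟩ := bU.dualBasis.equivFun.symm.surjective φ
    rw [Module.Basis.equivFun_symm_apply]
    simp only [map_sum, map_smul, Algebra.smul_def, map_mul, h₁, Module.Basis.coe_dualBasis, h₂]
  let c₀ : FunctionRing V W.carrier →ₐ[Γ(Z, W.carrier)] S :=
    SymmetricAlgebra.lift (bW.dualBasis.constr Γ(Z, W.carrier) fun i =>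
      b (SymmetricAlgebra.ι _ _ (bU.coord i)))
  have hc₀ : c₀.toRingHom.comp (functionRes h) = b := by
    refine key _ _ (fun r => ?_) (fun i => ?_)
    · rw [RingHom.comp_apply, functionRes_algebraMap, ← hab]
      exact AlgHom.commutes (R := Γ(Z, W.carrier)) c₀ _
    · rw [RingHom.comp_apply, functionRes_ι, hres]
      refine (SymmetricAlgebra.lift_ι_apply _ _).trans ?_
      have := bW.dualBasis.constr_basis Γ(Z, W.carrier) (fun i =>
        b (SymmetricAlgebra.ι _ _ (bU.coord i))) i
      rwa [congrFun bW.coe_dualBasis i] at this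
  refine ⟨c₀.toRingHom, ⟨fun r => AlgHom.commutes (R := Γ(Z, W.carrier)) c₀ r, fun x => ?_⟩,
    fun c hc => ?_⟩
  · exact congr($hc₀ x)
  · refine functionRing_hom_ext (fun r => ?_) fun φ => ?_
    · rw [hc.1]
      exact (AlgHom.commutes (R := Γ(Z, W.carrier)) _ r).symm
    · refine Eq.trans ?_ (SymmetricAlgebra.lift_ι_apply _ _).symm
      obtain ⟨d, rfl⟩ := bW.dualBasis.equivFun.symm.surjective φ
      rw [Module.Basis.equivFun_symm_apply]
      simp only [map_sum, map_smul, Algebra.smul_def, map_mul, hc.1, Module.Basis.constr_basis]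
      refine Finset.sum_congr rfl fun i _ => ?_
      rw [← hc.2, functionRes_ι, hres, Module.Basis.coe_dualBasis]
      rfl

lemma isPushout_functionRes {W U : FramedOpens V} (h : W ≤ U) :
    IsPushout (Z.presheaf.map (homOfLE (FramedOpens.carrier_le h)).op)
      (CommRingCat.ofHom (algebraMap Γ(Z, U.carrier) (FunctionRing V U.carrier)))
      (CommRingCat.ofHom (algebraMap Γ(Z, W.carrier) (FunctionRing V W.carrier)))
      (CommRingCat.ofHom (functionRes h)) := by
  have H (s : PushoutCocone (Z.presheaf.map (homOfLE (FramedOpens.carrier_le h)).op)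
      (CommRingCat.ofHom (algebraMap Γ(Z, U.carrier) (FunctionRing V U.carrier)))) :=
    existsUnique_functionRing_hom h s.inl.hom s.inr.hom fun r => congr($(s.condition) r)
  refine ⟨⟨?_⟩, ⟨PushoutCocone.IsColimit.mk _ (fun s => CommRingCat.ofHom (H s).choose) ?_ ?_ ?_⟩⟩
  · ext r
    exact (functionRes_algebraMap h r).symm
  · intro s
    ext r
    exact (H s).choose_spec.1.1 r
  · intro s
    ext r
    exact (H s).choose_spec.1.2 r
  · intro s m h₁ h₂
    ext1
    exact (H s).choose_spec.2 m.hom ⟨fun r => congr($h₁ r), fun r => congr($h₂ r)⟩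

variable (V) in
/-- The data that glue the schemes `Spec Sym(V(U)^∨)` along the inclusions between the opens `U`. -/
def totalSpaceGluing (hV : IsVectorBundle V) : (framedCover V hV).RelativeGluingData where
  functor :=
    { obj := fun U : FramedOpens V => Spec (.of (FunctionRing V U.carrier))
      map := fun {U W} h => Spec.map (CommRingCat.ofHom (functionRes (V := V) (leOfHom h)))
      map_id := fun U =>
        congr(Spec.map (CommRingCat.ofHom $(functionRes_refl (V := V) U))).trans (Spec.map_id _)
      map_comp := fun {U W T} h h' => by
        rw [← Spec.map_comp, ← CommRingCat.ofHom_comp]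
        exact congr(Spec.map (CommRingCat.ofHom $(functionRes_trans (V := V) (leOfHom h) (leOfHom h')))) }
  natTrans :=
    { app := fun U : FramedOpens V =>
        Spec.map (CommRingCat.ofHom (algebraMap Γ(Z, U.carrier) (FunctionRing V U.carrier)))
      naturality := fun {U W} h =>
        ((isPushout_functionRes (V := V) (leOfHom h)).op.map Scheme.Spec).w }
  equifibered := fun {U W} h =>
    ((isPushout_functionRes (V := V) (leOfHom h)).op.map Scheme.Spec)

instance (hV : IsVectorBundle V) : Small.{u} (framedCover V hV).I₀ :=
  inferInstanceAs (Small.{u} (FramedOpens V))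

instance (hV : IsVectorBundle V) : Quiver.IsThin (framedCover V hV).I₀ :=
  inferInstanceAs (Quiver.IsThin (FramedOpens V))

variable (V) in
/-- The total space `Tot(V)`, the relative spectrum of `Sym(V^∨)` over `Z`. -/
def totalSpace (hV : IsVectorBundle V) : Scheme.{u} := (totalSpaceGluing V hV).glued

variable (V) in
/-- The bundle projection `Tot(V) ⟶ Z`. -/
def totalSpaceProj (hV : IsVectorBundle V) : totalSpace V hV ⟶ Z := (totalSpaceGluing V hV).toBase

variable (V) in
/-- The open immersion of `Spec Sym(V(U)^∨)`, the part of `Tot(V)` over `U`, into `Tot(V)`. -/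
def totalSpaceChart (hV : IsVectorBundle V) (U : FramedOpens V) :
    Spec (.of (FunctionRing V U.carrier)) ⟶ totalSpace V hV :=
  (totalSpaceGluing V hV).cover.f U

end Tot

section Higgs

variable {X Y Z : Scheme.{u}}

/-- `Φ : f_* N ⟶ f_* N ⊗ V` is the pushforward by `f` of the multiplication map `N ⟶ N ⊗ f^* V`,
`m ↦ m ⊗ s`: the two agree under the projection formula `f_* N ⊗ V ≅ f_* (N ⊗ f^* V)`. -/
def IsPushforwardHiggs (f : X ⟶ Z) (N : X.Modules) (V : Z.Modules)
    (s : Γ((Scheme.Modules.pullback f).obj V, ⊤))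
    (Φ : (Scheme.Modules.pushforward f).obj N ⟶
      tensor ((Scheme.Modules.pushforward f).obj N) V) : Prop :=
  Φ ≫ projectionMap f N V = (Scheme.Modules.pushforward f).map (mulSection N s)

/-- The pullback by `p` of a global section of `q^* V`, as a section of `π^* V = p^* q^* V`, where
`π = q ∘ p`. -/
def pullSectionComp {p : X ⟶ Y} {q : Y ⟶ Z} {π : X ⟶ Z} (h : p ≫ q = π) (V : Z.Modules)
    (t : Γ((Scheme.Modules.pullback q).obj V, ⊤)) : Γ((Scheme.Modules.pullback π).obj V, ⊤) :=
  (((Scheme.Modules.pullbackComp p q) ≪≫ Scheme.Modules.pullbackCongr h).hom.app V).app ⊤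
    (pullSection p ((Scheme.Modules.pullback q).obj V) t)

/-- The canonical isomorphism `q_* p_* M ≅ π_* M`, where `π = q ∘ p`. -/
def pushforwardFactor {p : X ⟶ Y} {q : Y ⟶ Z} {π : X ⟶ Z} (h : p ≫ q = π) (M : X.Modules) :
    (Scheme.Modules.pushforward q).obj ((Scheme.Modules.pushforward p).obj M) ≅
      (Scheme.Modules.pushforward π).obj M :=
  (Scheme.Modules.pushforwardComp p q ≪≫ Scheme.Modules.pushforwardCongr h).app M

/-- The map `E ⟶ E ⊗ V` transported along an isomorphism `E ≅ E'`. -/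
def conjHiggs {E E' : Z.Modules} (i : E ≅ E') (V : Z.Modules) (Φ : E ⟶ tensor E V) :
    E' ⟶ tensor E' V :=
  i.inv ≫ Φ ≫ tensorMap i.hom V

/-- In the frame `e` of `V` over `U`, the map `Φ : E ⟶ E ⊗ V` is `∑ i, A i ⊗ e i`. -/
def IsCoordinates {E V : Z.Modules} (Φ : E ⟶ tensor E V) {U : Z.Opens} {n : ℕ}
    (e : Fin n → Γ(V, U)) (A : Fin n → Module.End Γ(Z, U) Γ(E, U)) : Prop :=
  ∀ m : Γ(E, U), Φ.app U m = ∑ i, tmul (A i m) (e i)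

/-- The map `Φ : E ⟶ E ⊗ V` is a Higgs field, `Φ ∧ Φ = 0`: writing `Φ = ∑ i, A i ⊗ e i` in a frame `e`
of `V`, the coefficients `A i ∘ A j - A j ∘ A i` of `Φ ∧ Φ` at `e i ∧ e j` vanish. -/
def IsHiggsField {E V : Z.Modules} (Φ : E ⟶ tensor E V) : Prop :=
  ∀ (U : FramedOpens V) (n : ℕ) (e : Fin n → Γ(V, U.carrier))
    (A : Fin n → Module.End Γ(Z, U.carrier) Γ(E, U.carrier)),
    IsFrame V e → IsCoordinates Φ e A → ∀ i j, A i * A j = A j * A i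

/-- The ring `K[y 1, …, y n][x 1, …, x n]`, with `K` the fraction ring of `R`. The inner variables
`y i` stand for the coordinates of a point of the fibre of `V` in a frame, the outer variables `x i`
for the members of the frame as elements of `Sym(V)`. -/
abbrev CharRing (R : Type u) [CommRing R] (n : ℕ) : Type u :=
  MvPolynomial (Fin n) (MvPolynomial (Fin n) (FractionRing R))

/-- The determinant `det (∑ i, x i (A i - y i))` over an `R`-algebra `P`. -/
def pencilDet {R : Type u} [CommRing R] {E : Type u} [AddCommGroup E] [Module R E] {n : ℕ}
    (A : Fin n → Module.End R E) (P : Type u) [CommRing P] [Algebra R P] (x y : Fin n → P) : P :=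
  LinearMap.det (∑ i, x i • ((A i).baseChange P - y i • LinearMap.id))

/-- The determinant `det (Φ - η ⊗ id)` for `Φ = ∑ i, A i ⊗ x i` and the tautological section
`η = ∑ i, y i x i`. It is taken over the fraction ring of `R`, over which the module becomes free
when `R` is a domain. -/
def charForm {R : Type u} [CommRing R] {E : Type u} [AddCommGroup E] [Module R E] {n : ℕ}
    (A : Fin n → Module.End R E) : CharRing R n :=
  pencilDet A (CharRing R n) MvPolynomial.X fun i => MvPolynomial.C (MvPolynomial.X i)

/-- The ideal of functions on the part of `Tot(V)` over `U` generated by the coefficients of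
`det (Φ - η ⊗ id)` in the frame `e`, where `Φ = ∑ i, A i ⊗ e i` over `U`. The coordinates of the
tautological section `η` are the linear forms dual to the frame. -/
def spectralIdeal {E V : Z.Modules} {U : Z.Opens} {n : ℕ} {e : Fin n → Γ(V, U)} (he : IsFrame V e)
    (A : Fin n → Module.End Γ(Z, U) Γ(E, U)) : Ideal (FunctionRing V U) :=
  Ideal.span {g | ∃ (c : MvPolynomial (Fin n) Γ(Z, U)) (d : Fin n →₀ ℕ),
    MvPolynomial.map (algebraMap Γ(Z, U) (FractionRing Γ(Z, U))) c = (charForm A).coeff d ∧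
    g = MvPolynomial.aeval (fun i => SymmetricAlgebra.ι Γ(Z, U) (Module.Dual Γ(Z, U) Γ(V, U))
      ((he.basis U le_rfl).coord i)) c}

/-- The ideal sheaf on `Tot(V)` generated by the coefficients of `det (Φ - η ⊗ id)`. -/
def spectralIdealSheaf {E V : Z.Modules} (hV : IsVectorBundle V) (Φ : E ⟶ tensor E V) :
    (totalSpace V hV).IdealSheafData :=
  sInf {J | ∀ (U : FramedOpens V) (n : ℕ) (e : Fin n → Γ(V, U.carrier)) (he : IsFrame V e)
    (A : Fin n → Module.End Γ(Z, U.carrier) Γ(E, U.carrier)), IsCoordinates Φ e A →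
    Scheme.IdealSheafData.ofIdealTop ((spectralIdeal he A).map
      (Scheme.ΓSpecIso (.of (FunctionRing V U.carrier))).inv.hom) ≤ J.comap (totalSpaceChart V hV U)}

/-- The spectral cover `C_Φ`, the closed subscheme of `Tot(V)` where `det (Φ - η ⊗ id)` vanishes. -/
def spectralCover {E V : Z.Modules} (hV : IsVectorBundle V) (Φ : E ⟶ tensor E V) : Scheme.{u} :=
  (spectralIdealSheaf hV Φ).subscheme

/-- The projection `C_Φ ⟶ Z`. -/
def spectralCoverProj {E V : Z.Modules} (hV : IsVectorBundle V) (Φ : E ⟶ tensor E V) :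
    spectralCover hV Φ ⟶ Z :=
  (spectralIdealSheaf hV Φ).subschemeι ≫ totalSpaceProj V hV

end Higgs

section Varieties

variable {X Y : Scheme.{u}}

/-- `ν : Y ⟶ C` is the normalization of the irreducible scheme `C`: the relative normalization of `C`
in the spectrum of the residue field of its generic point. -/
def IsNormalization (ν : Y ⟶ X) : Prop :=
  ∃ ξ : X, IsGenericPoint ξ Set.univ ∧
    ∃ i : Y ≅ (X.fromSpecResidueField ξ).normalization,
      i.hom ≫ (X.fromSpecResidueField ξ).fromNormalization = ν

/-- All local rings of `X` are integrally closed domains. -/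
def IsNormalScheme (X : Scheme.{u}) : Prop :=
  ∀ x : X, IsDomain (X.presheaf.stalk x) ∧ IsIntegrallyClosed (X.presheaf.stalk x)

/-- Coherent sheaves on a locally noetherian scheme. -/
def IsCoherentSheaf (M : X.Modules) : Prop :=
  SheafOfModules.IsQuasicoherent M ∧
    ∀ U : X.Opens, IsAffineOpen U → Module.Finite Γ(X, U) Γ(M, U)

/-- Torsion-free sheaves on an integral scheme. -/
def IsTorsionFreeSheaf (M : X.Modules) : Prop :=
  ∀ (U : X.Opens) (r : Γ(X, U)) (m : Γ(M, U)), r • m = 0 → r = 0 ∨ m = 0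

instance (n : ℕ) : GradedRing (MvPolynomial.homogeneousSubmodule (Fin (n + 1)) ℂ) :=
  MvPolynomial.gradedAlgebra

/-- The projective space `ℙⁿ` over the complex numbers. -/
def complexProjectiveSpace (n : ℕ) : Scheme.{0} :=
  Proj (MvPolynomial.homogeneousSubmodule (Fin (n + 1)) ℂ)

/-- The structure morphism of `ℙⁿ`. -/
def complexProjectiveSpaceStr (n : ℕ) : complexProjectiveSpace n ⟶ Spec (.of ℂ) :=
  Proj.toSpecZero (MvPolynomial.homogeneousSubmodule (Fin (n + 1)) ℂ) ≫
    Spec.map (CommRingCat.ofHom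
      (algebraMap ℂ (MvPolynomial.homogeneousSubmodule (Fin (n + 1)) ℂ 0)))

/-- A projective variety over `ℂ`: an integral closed subscheme of some `ℙⁿ`. -/
def IsProjectiveVariety {X : Scheme.{0}} (s : X ⟶ Spec (.of ℂ)) : Prop :=
  IsIntegral X ∧ ∃ (n : ℕ) (i : X ⟶ complexProjectiveSpace n),
    IsClosedImmersion i ∧ i ≫ complexProjectiveSpaceStr n = s

end Varieties

end

end HiggsCover

namespace HiggsCover

noncomputable section

universe u

/-! ### Local criteria for morphisms of sheaves of modules -/

section Sheaves

variable {X Y Z : Scheme.{u}}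

/-! The section σ amounts to a morphism X → Tot(V) over Z (`sectionMap`). It is finite, because π is
finite and Tot(V) is affine over Z. The theorem comes from showing that the reduced spectral cover
is the image of this morphism, and from normalizing that image.

Over an affine open U with a frame of V put R = Γ(Z, U), B = Γ(X, π⁻¹U), E = Γ(M, π⁻¹U), and let s i
∈ B be the coordinates of σ. Frames pull back to frames, so the projection map is an isomorphism
(`isIso_projectionMap`). Hence Φ exists and is unique, and its coordinates are the multiplications
by the s i, which commute: Φ ∧ Φ = 0. Over K = Frac R the determinant of ∑ x i (s i - y i) on K ⊗ E
is the norm of this element from Frac B to K, raised to the rank of M. Over an algebraic closure it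
is therefore a power of the product of the forms ∑ x i (τ (s i) - y i), τ running over the
embeddings of Frac B (`map_charForm`). As R is normal, its coefficients as a polynomial in x lie in
R[y]. They vanish at y = s (`charIdeal_le_ker`). Conversely, let P be a prime of R[y] that contains
them, and let S be the integral closure of R in an algebraic closure of K. Lying over gives a prime
Q of S[y] above P; modulo Q the product of linear forms is zero, so one factor is zero, and y i = τ
(s i) modulo Q for some τ. Thus P contains every relation among the s i
(`ker_le_radical_charIdeal`).

Consequently the ideal of C_Φ lies between the kernel of the section map and a power of it. So X →
C_Φ is finite and dominant, and C_Φ is irreducible, its generic point being the image of that of X.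
Let Y be the normalization of C_Φ in the residue field of this point. Since X is smooth, it is
normal, so it is the normalization of C_Φ in the function field of X; functoriality gives p : X → Y
(`exists_fac_normalization`). Functions on Y inject into functions on X, which makes Y finite over
the noetherian scheme Z. The coordinates of σ are pulled back from linear functions on Tot(V), hence
from Y, so σ and Φ descend to Y (`exists_descent`).

Finally Y is finite over Z ⊆ ℙⁿ, so affine over ℙⁿ and proper over ℂ. Explicit homogeneous
coordinates in the function field of Y then give a closed embedding in a projective space
(`exists_isClosedImmersion_of_isAffineHom`). -/

lemma tensor_hom_ext {M N P : X.Modules} {f g : tensor M N ⟶ P}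
    (h : ∀ (U : X.Opens) (m : Γ(M, U)) (n : Γ(N, U)), f.app U (tmul m n) = g.app U (tmul m n)) :
    f = g := by
  apply ((sheafifyAdj X).homEquiv (presheafTensor M N) P).injective
  refine ((sheafifyAdj X).homEquiv_unit ..).trans (Eq.trans ?_ ((sheafifyAdj X).homEquiv_unit ..).symm)
  apply PresheafOfModules.hom_ext
  intro U
  refine ModuleCat.MonoidalCategory.tensor_ext (R := X.presheaf.obj U) fun m n => ?_
  exact h U.unop m n

/-- Restriction to `V` of a section over a bigger open. -/
abbrev res (M : X.Modules) {V U : X.Opens} (h : V ≤ U) (m : Γ(M, U)) : Γ(M, V) :=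
  M.presheaf.map (homOfLE h).op m

lemma res_res (M : X.Modules) {W V U : X.Opens} (h : V ≤ U) (h' : W ≤ V) (m : Γ(M, U)) :
    res M h' (res M h m) = res M (h'.trans h) m := by
  rw [res, res, ← ConcreteCategory.comp_apply, ← Functor.map_comp]; rfl

lemma res_self (M : X.Modules) {U : X.Opens} (m : Γ(M, U)) : res M le_rfl m = m :=
  congr($(M.presheaf.map_id _) m)

lemma app_res {M N : X.Modules} (φ : M ⟶ N) {V U : X.Opens} (h : V ≤ U) (m : Γ(M, U)) :
    φ.app V (res M h m) = res N h (φ.app U m) :=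
  NatTrans.naturality_apply φ.mapPresheaf (homOfLE h).op m

lemma eq_of_locally_eq {M : X.Modules} {U : X.Opens} (m m' : Γ(M, U))
    (h : ∀ x ∈ U, ∃ (V : X.Opens) (hV : V ≤ U), x ∈ V ∧ res M hV m = res M hV m') : m = m' := by
  apply TopCat.Presheaf.IsSheaf.section_ext M.isSheaf
  intro x hx
  obtain ⟨V, hV, hxV, e⟩ := h x hx
  exact ⟨V, hV, hxV, e⟩

lemma injective_of_locally_injective {M N : X.Modules} (φ : M ⟶ N)
    (h : ∀ x : X, ∃ U : X.Opens, x ∈ U ∧ ∀ W ≤ U, Function.Injective (φ.app W)) (W : X.Opens) :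
    Function.Injective (φ.app W) := by
  intro m m' e
  refine eq_of_locally_eq m m' fun x hx => ?_
  obtain ⟨U, hxU, hU⟩ := h x
  refine ⟨U ⊓ W, inf_le_right, ⟨hxU, hx⟩, hU _ inf_le_left ?_⟩
  rw [app_res, app_res, e]

/-- Injectivity makes the local preimages agree on overlaps, so that they glue. -/
lemma mem_range_of_locally_mem_range {M N : X.Modules} (φ : M ⟶ N)
    (hφ : ∀ W, Function.Injective (φ.app W)) {W : X.Opens} (n : Γ(N, W))
    (h : ∀ x ∈ W, ∃ (U : X.Opens) (hU : U ≤ W), x ∈ U ∧ ∃ m, φ.app U m = res N hU n) :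
    ∃ m, φ.app W m = n := by
  choose U hU hxU m hm using fun x : W => h x.1 x.2
  obtain ⟨s, hs, -⟩ := TopCat.Sheaf.existsUnique_gluing' ⟨M.presheaf, M.isSheaf⟩ U W
    (fun x => homOfLE (hU x)) (fun x hx => Opens.mem_iSup.mpr ⟨⟨x, hx⟩, hxU _⟩) m (by
      intro x y
      apply hφ
      refine (app_res φ _ _).trans (Eq.trans ?_ (app_res φ _ _).symm)
      rw [hm, hm, res_res, res_res])
  refine ⟨s, eq_of_locally_eq _ _ fun x hx => ⟨U ⟨x, hx⟩, hU _, hxU _, ?_⟩⟩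
  rw [← hm ⟨x, hx⟩, ← hs ⟨x, hx⟩]
  exact (app_res φ _ _).symm

lemma isIso_of_locally_bijective {M N : X.Modules} (φ : M ⟶ N)
    (h : ∀ x : X, ∃ U : X.Opens, x ∈ U ∧ ∀ W ≤ U, Function.Bijective (φ.app W)) : IsIso φ := by
  have hinj := injective_of_locally_injective φ fun x => by
    obtain ⟨U, hx, hU⟩ := h x
    exact ⟨U, hx, fun W hW => (hU W hW).1⟩
  rw [Scheme.Modules.Hom.isIso_iff_isIso_app]
  intro W
  rw [ConcreteCategory.isIso_iff_bijective]
  refine ⟨hinj W, fun n => mem_range_of_locally_mem_range φ hinj n fun x hx => ?_⟩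
  obtain ⟨U, hxU, hU⟩ := h x
  exact ⟨U ⊓ W, inf_le_right, ⟨hxU, hx⟩, (hU _ inf_le_left).2 _⟩

end Sheaves

/-! ### Sections of a tensor product in a frame of one factor -/

section Frames

variable {X Y Z : Scheme.{u}}

/-- Restriction to `V` of a function over a bigger open. -/
abbrev resO (X : Scheme.{u}) {V U : X.Opens} (h : V ≤ U) (r : Γ(X, U)) : Γ(X, V) :=
  X.presheaf.map (homOfLE h).op r

lemma resO_resO {W V U : X.Opens} (h : V ≤ U) (h' : W ≤ V) (r : Γ(X, U)) :
    resO X h' (resO X h r) = resO X (h'.trans h) r := by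
  rw [resO, resO, ← ConcreteCategory.comp_apply, ← Functor.map_comp]; rfl

lemma res_smul (M : X.Modules) {V U : X.Opens} (h : V ≤ U) (r : Γ(X, U)) (m : Γ(M, U)) :
    res M h (r • m) = resO X h r • res M h m :=
  M.map_smul _ _ _

lemma res_tmul {M N : X.Modules} {V U : X.Opens} (h : V ≤ U) (m : Γ(M, U)) (n : Γ(N, U)) :
    res (tensor M N) h (tmul m n) = tmul (res M h m) (res N h n) :=
  map_tmul _ _ _

lemma res_sum (M : X.Modules) {V U : X.Opens} (h : V ≤ U) {ι : Type*} (s : Finset ι)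
    (m : ι → Γ(M, U)) : res M h (∑ i ∈ s, m i) = ∑ i ∈ s, res M h (m i) :=
  map_sum _ _ _

lemma IsFrame.basis_res {N : X.Modules} {U : X.Opens} {n : ℕ} {e : Fin n → Γ(N, U)}
    (he : IsFrame N e) {W W' : X.Opens} (h : W ≤ U) (h' : W' ≤ W) (v : Γ(N, W)) (i : Fin n) :
    (he.basis W' (h'.trans h)).repr (res N h' v) i = resO X h' ((he.basis W h).repr v i) := by
  conv_lhs => rw [← (he.basis W h).sum_repr v]
  rw [res_sum]
  simp only [res_smul, res, he.map_basis, map_sum, map_smul, Module.Basis.repr_self]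
  simp [Finsupp.single_apply]

lemma IsFrame.basis_repr_smul {N : X.Modules} {U : X.Opens} {n : ℕ} {e : Fin n → Γ(N, U)}
    (he : IsFrame N e) {W : X.Opens} (h : W ≤ U) (v : Γ(N, W)) :
    ∑ i, (he.basis W h).repr v i • res N h (e i) = v := by
  conv_rhs => rw [← (he.basis W h).sum_repr v]
  simp only [he.basis_apply]

/-- The sheaf `W ↦ M(U ∩ W)`. -/
def onOpen (U : X.Opens) (M : X.Modules) : X.Modules :=
  (Scheme.Modules.pushforward U.ι).obj (M.restrict U.ι)

/-- The open `U ∩ W`, in the form in which it enters the definition of `onOpen`. -/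
abbrev cut (U W : X.Opens) : X.Opens := U.ι ''ᵁ U.ι ⁻¹ᵁ W

lemma cut_le (U W : X.Opens) : cut U W ≤ W := U.ι.image_preimage_le W

lemma cut_le_left (U W : X.Opens) : cut U W ≤ U := by
  simp [cut, Scheme.Hom.image_preimage_eq_opensRange_inf]

lemma le_cut {U W : X.Opens} (h : W ≤ U) : W ≤ cut U W := by
  simp [cut, Scheme.Hom.image_preimage_eq_opensRange_inf, h]

lemma cut_mono (U : X.Opens) {W W' : X.Opens} (h : W ≤ W') : cut U W ≤ cut U W' :=
  U.ι.image_mono (U.ι.preimage_mono h)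

/-- A section of `M` over `U ∩ W`, as a section of `onOpen U M` over `W`. -/
def onOpenMk {U : X.Opens} {M : X.Modules} {W : X.Opens} (m : Γ(M, cut U W)) : Γ(onOpen U M, W) := m

lemma onOpenMk_injective {U : X.Opens} {M : X.Modules} {W : X.Opens} :
    Function.Injective (onOpenMk : Γ(M, cut U W) → Γ(onOpen U M, W)) := fun _ _ h => h

lemma onOpenMk_surjective {U : X.Opens} {M : X.Modules} {W : X.Opens} :
    Function.Surjective (onOpenMk : Γ(M, cut U W) → Γ(onOpen U M, W)) := fun m => ⟨m, rfl⟩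

lemma onOpenMk_add {U : X.Opens} {M : X.Modules} {W : X.Opens} (m m' : Γ(M, cut U W)) :
    (onOpenMk (m + m') : Γ(onOpen U M, W)) = onOpenMk m + onOpenMk m' := rfl

lemma onOpenMk_sum {U : X.Opens} {M : X.Modules} {W : X.Opens} {ι : Type*} (s : Finset ι)
    (m : ι → Γ(M, cut U W)) :
    (onOpenMk (∑ i ∈ s, m i) : Γ(onOpen U M, W)) = ∑ i ∈ s, onOpenMk (m i) := rfl

lemma onOpenMk_smul {U : X.Opens} {M : X.Modules} {W : X.Opens} (r : Γ(X, W))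
    (m : Γ(M, cut U W)) :
    (onOpenMk (resO X (cut_le U W) r • m) : Γ(onOpen U M, W)) = r • onOpenMk m := by
  have : U.ι.app W ≫ (U.ι.appIso _).inv = X.presheaf.map (homOfLE (cut_le U W)).op :=
    U.ι.app_appIso_inv W
  exact congr(($this r) • m).symm

lemma onOpenMk_map {U : X.Opens} {M : X.Modules} {W W' : X.Opens} (i : W' ⟶ W)
    (m : Γ(M, cut U W)) :
    (onOpen U M).presheaf.map i.op (onOpenMk m) = onOpenMk (res M (cut_mono U (leOfHom i)) m) := rfl

/-- The restriction map `M(W) → M(U ∩ W)`. -/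
def toOnOpen (U : X.Opens) (M : X.Modules) : M ⟶ onOpen U M :=
  (Scheme.Modules.restrictAdjunction U.ι).unit.app M

lemma toOnOpen_app {U : X.Opens} {M : X.Modules} {W : X.Opens} (m : Γ(M, W)) :
    (toOnOpen U M).app W m = onOpenMk (res M (cut_le U W) m) := rfl

/-- The product of `m` with the `i`-th coordinate of `v` in a frame over `U`. -/
def coordSmul (M : X.Modules) {N : X.Modules} {U : X.Opens} {n : ℕ} {e : Fin n → Γ(N, U)}
    (he : IsFrame N e) (i : Fin n) (W : X.Opens) (m : Γ(M, W)) (v : Γ(N, W)) : Γ(M, cut U W) :=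
  (he.basis _ (cut_le_left U W)).repr (res N (cut_le U W) v) i • res M (cut_le U W) m

section coordSmul
variable {M N : X.Modules} {U : X.Opens} {n : ℕ} {e : Fin n → Γ(N, U)}
  (he : IsFrame N e) (i : Fin n) {W : X.Opens}

lemma coordSmul_add_left (m m' : Γ(M, W)) (v : Γ(N, W)) :
    coordSmul M he i W (m + m') v = coordSmul M he i W m v + coordSmul M he i W m' v := by
  simp only [coordSmul, res, map_add, smul_add]

lemma coordSmul_add_right (m : Γ(M, W)) (v v' : Γ(N, W)) :
    coordSmul M he i W m (v + v') = coordSmul M he i W m v + coordSmul M he i W m v' := by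
  simp only [coordSmul, res, map_add, Finsupp.add_apply, add_smul]

lemma coordSmul_smul_left (r : Γ(X, W)) (m : Γ(M, W)) (v : Γ(N, W)) :
    coordSmul M he i W (r • m) v = resO X (cut_le U W) r • coordSmul M he i W m v := by
  rw [coordSmul, res_smul, smul_comm, coordSmul]

lemma coordSmul_smul_right (r : Γ(X, W)) (m : Γ(M, W)) (v : Γ(N, W)) :
    coordSmul M he i W m (r • v) = resO X (cut_le U W) r • coordSmul M he i W m v := by
  rw [coordSmul, res_smul, map_smul, Finsupp.smul_apply, smul_eq_mul, mul_smul, coordSmul]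

lemma res_coordSmul {W' : X.Opens} (h : W' ≤ W) (m : Γ(M, W)) (v : Γ(N, W)) :
    res M (cut_mono U h) (coordSmul M he i W m v) = coordSmul M he i W' (res M h m) (res N h v) := by
  rw [coordSmul, res_smul, ← he.basis_res, coordSmul, res_res, res_res, res_res, res_res]

end coordSmul

/-- The bilinear map of which `tensorCoord` is made. -/
def coordBilin (M : X.Modules) {N : X.Modules} {U : X.Opens} {n : ℕ} {e : Fin n → Γ(N, U)}
    (he : IsFrame N e) (i : Fin n) (W : X.Opens) :
    Γ(M, W) →ₗ[Γ(X, W)] Γ(N, W) →ₗ[Γ(X, W)] Γ(onOpen U M, W) :=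
  LinearMap.mk₂ Γ(X, W) (fun m v => onOpenMk (coordSmul M he i W m v))
    (fun m m' v => by rw [coordSmul_add_left, onOpenMk_add])
    (fun r m v => by rw [coordSmul_smul_left, onOpenMk_smul])
    (fun m v v' => by rw [coordSmul_add_right, onOpenMk_add])
    (fun r m v => by rw [coordSmul_smul_right, onOpenMk_smul])

/-- The `i`-th coordinate `M ⊗ N ⟶ M|_U` given by a frame of `N` over `U`. -/
def tensorCoord (M : X.Modules) {N : X.Modules} {U : X.Opens} {n : ℕ} {e : Fin n → Γ(N, U)}
    (he : IsFrame N e) (i : Fin n) : tensor M N ⟶ onOpen U M :=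
  tensorDesc (coordBilin M he i) (fun W W' j m v => by
    refine (onOpenMk_map j (coordSmul M he i W m v)).trans ?_
    rw [res_coordSmul]
    rfl)

lemma tensorCoord_tmul {M N : X.Modules} {U : X.Opens} {n : ℕ} {e : Fin n → Γ(N, U)}
    (he : IsFrame N e) (i : Fin n) {W : X.Opens} (m : Γ(M, W)) (v : Γ(N, W)) :
    (tensorCoord M he i).app W (tmul m v) = onOpenMk (coordSmul M he i W m v) :=
  tensorDesc_tmul _ _ _ _ _

/-- The linear map `M(U ∩ W) → (M ⊗ N)(U ∩ W)`, `m ↦ m ⊗ s`. -/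
def mulSectionOnLin (M : X.Modules) {N : X.Modules} {U : X.Opens} (s : Γ(N, U)) (W : X.Opens) :
    Γ(onOpen U M, W) →ₗ[Γ(X, W)] Γ(onOpen U (tensor M N), W) where
  toFun m := onOpenMk (tmul (show Γ(M, cut U W) from m) (res N (cut_le_left U W) s))
  map_add' m m' := by
    rw [← onOpenMk_add, ← add_tmul]
    rfl
  map_smul' r m := by
    obtain ⟨m, rfl⟩ := onOpenMk_surjective m
    rw [RingHom.id_apply, ← onOpenMk_smul, ← onOpenMk_smul, ← smul_tmul]
    rfl

/-- The map `M|_U ⟶ (M ⊗ N)|_U`, `m ↦ m ⊗ s`, for a section `s` of `N` over `U`. -/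
def mulSectionOn (M : X.Modules) {N : X.Modules} {U : X.Opens} (s : Γ(N, U)) :
    onOpen U M ⟶ onOpen U (tensor M N) :=
  ⟨{ app := fun W =>
        (ModuleCat.ofHom (mulSectionOnLin M s W.unop) :
          ModuleCat.of Γ(X, W.unop) Γ(onOpen U M, W.unop) ⟶
            ModuleCat.of Γ(X, W.unop) Γ(onOpen U (tensor M N), W.unop))
     naturality := fun {W W'} i => by
      ext m
      refine Eq.trans ?_ (res_tmul (M := M) (N := N) (cut_mono U (leOfHom i.unop)) m _).symm
      rw [res_res]
      rfl }⟩

lemma mulSectionOn_app {M N : X.Modules} {U : X.Opens} (s : Γ(N, U)) {W : X.Opens}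
    (m : Γ(M, cut U W)) :
    (mulSectionOn M s).app W (onOpenMk m) = onOpenMk (tmul m (res N (cut_le_left U W) s)) := rfl

lemma sum_app {M N : X.Modules} {ι : Type*} (s : Finset ι) (f : ι → (M ⟶ N)) {W : X.Opens}
    (m : Γ(M, W)) : (∑ i ∈ s, f i).app W m = ∑ i ∈ s, (f i).app W m := by
  classical
  induction s using Finset.induction_on with
  | empty => simp
  | insert a s ha ih => rw [Finset.sum_insert ha, Finset.sum_insert ha, ← ih]; rfl

lemma tmul_sum {M N : X.Modules} {W : X.Opens} {ι : Type*} (s : Finset ι) (m : Γ(M, W))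
    (v : ι → Γ(N, W)) : tmul m (∑ i ∈ s, v i) = ∑ i ∈ s, tmul m (v i) := by
  simp only [tmul, TensorProduct.tmul_sum, map_sum]

/-- Sections of a sheafified tensor product are accessible only through maps out of it, and those
are determined by pure tensors. Working with `onOpen` lets the coordinates be morphisms on all of X,
so the expansion v = ∑ v i e i can be tensored with m and checked there. -/
lemma sum_tensorCoord {M N : X.Modules} {U : X.Opens} {n : ℕ} {e : Fin n → Γ(N, U)}
    (he : IsFrame N e) :
    ∑ i, tensorCoord M he i ≫ mulSectionOn M (e i) = toOnOpen U (tensor M N) := by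
  refine tensor_hom_ext fun W m v => ?_
  rw [sum_app, toOnOpen_app, res_tmul]
  conv_rhs => rw [← he.basis_repr_smul (cut_le_left U W) (res N (cut_le U W) v)]
  rw [tmul_sum, onOpenMk_sum]
  refine Finset.sum_congr rfl fun i _ => ?_
  rw [Scheme.Modules.Hom.comp_app, ConcreteCategory.comp_apply, tensorCoord_tmul, mulSectionOn_app,
    coordSmul, smul_tmul, tmul_smul]

/-- If `N` has the frame `e` over `U`, then over opens `W ⊆ U` every section of `M ⊗ N` is a unique
combination `∑ i, a i ⊗ e i`. -/
lemma IsFrame.tensor_bijective (M : X.Modules) {N : X.Modules} {U : X.Opens} {n : ℕ}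
    {e : Fin n → Γ(N, U)} (he : IsFrame N e) {W : X.Opens} (h : W ≤ U) :
    Function.Bijective fun a : Fin n → Γ(M, W) => ∑ i, tmul (a i) (res N h (e i)) := by
  classical
  have hres (F : X.Modules) : Function.Injective (res F (cut_le U W)) := by
    intro a b hab
    have := congr(res F (le_cut h) $hab)
    rwa [res_res, res_res, res_self, res_self] at this
  constructor
  -- Injectivity: the i-th coordinate map recovers a i from the combination.
  · have key (a : Fin n → Γ(M, W)) (i : Fin n) : (tensorCoord M he i).app W
        (∑ j, tmul (a j) (res N h (e j))) = onOpenMk (res M (cut_le U W) (a i)) := by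
      have h1 (j : Fin n) : coordSmul M he i W (a j) (res N h (e j)) =
          if i = j then res M (cut_le U W) (a i) else 0 := by
        have hb : res N h (e j) = he.basis W h j := (he.basis_apply W h j).symm
        rw [coordSmul, hb, he.basis_res h, Module.Basis.repr_self, Finsupp.single_apply]
        by_cases hij : i = j
        · subst hij; simp
        · simp [hij, Ne.symm hij]
      simp only [map_sum, tensorCoord_tmul, ← onOpenMk_sum, h1]
      simp
    intro a b hab
    funext i
    exact hres _ (onOpenMk_injective ((key a i).symm.trans
      (congr((tensorCoord M he i).app W $hab).trans (key b i))))
  -- Surjectivity: `sum_tensorCoord` applied to t expands t with its own coordinates as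
  -- coefficients.
  · intro t
    have h1 := congr(($(sum_tensorCoord (M := M) he)).app W t)
    rw [sum_app, toOnOpen_app] at h1
    choose a ha using fun i => onOpenMk_surjective ((tensorCoord M he i).app W t)
    refine ⟨fun i => res M (le_cut h) (a i), hres _ (onOpenMk_injective ?_)⟩
    rw [← h1, res_sum, onOpenMk_sum]
    refine Finset.sum_congr rfl fun i _ => ?_
    rw [Scheme.Modules.Hom.comp_app, ConcreteCategory.comp_apply, ← ha, mulSectionOn_app,
      res_tmul, res_res, res_res, res_self]

end Frames

/-! ### Frames of the pullback of a vector bundle -/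

section PullbackFrames

variable {X Y Z : Scheme.{u}}

/-- A morphism of sheaves of modules from compatible linear maps on sections. -/
def homMk {M N : X.Modules} (β : ∀ W : X.Opens, Γ(M, W) →ₗ[Γ(X, W)] Γ(N, W))
    (hβ : ∀ ⦃W W' : X.Opens⦄ (h : W' ≤ W) (m : Γ(M, W)), β W' (res M h m) = res N h (β W m)) :
    M ⟶ N :=
  ⟨{ app := fun W =>
        (ModuleCat.ofHom (β W.unop) :
          ModuleCat.of Γ(X, W.unop) Γ(M, W.unop) ⟶ ModuleCat.of Γ(X, W.unop) Γ(N, W.unop))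
     naturality := fun {W W'} i => by
      ext m
      exact hβ (leOfHom i.unop) m }⟩

/-- The structure sheaf as a sheaf of modules. -/
def structureModule (X : Scheme.{u}) : X.Modules := SheafOfModules.unit X.ringCatSheaf

/-- A function, as a section of the structure sheaf. -/
def unitMk {W : X.Opens} (a : Γ(X, W)) : Γ(structureModule X, W) := a

/-- A section of the structure sheaf, as a function. -/
def unitVal {W : X.Opens} (a : Γ(structureModule X, W)) : Γ(X, W) := a

lemma unitMk_add {W : X.Opens} (a b : Γ(X, W)) : unitMk (a + b) = unitMk a + unitMk b := rfl
lemma unitMk_mul {W : X.Opens} (a b : Γ(X, W)) : unitMk (a * b) = a • unitMk b := rfl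

lemma cut_preimage_le (f : X ⟶ Y) (U W : Y.Opens) : cut (f ⁻¹ᵁ U) (f ⁻¹ᵁ W) ≤ f ⁻¹ᵁ (cut U W) := by
  simp only [cut, Scheme.Hom.image_preimage_eq_opensRange_inf, Scheme.Opens.opensRange_ι]
  exact le_rfl

/-- A section of `N` over `f⁻¹(W)`, as a section of `f_* N` over `W`. -/
def pushMk (f : X ⟶ Y) {N : X.Modules} {W : Y.Opens} (m : Γ(N, f ⁻¹ᵁ W)) :
    Γ((Scheme.Modules.pushforward f).obj N, W) := m

lemma pushMk_add (f : X ⟶ Y) {N : X.Modules} {W : Y.Opens} (m m' : Γ(N, f ⁻¹ᵁ W)) :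
    pushMk f (m + m') = pushMk f m + pushMk f m' := rfl

lemma pushMk_smul (f : X ⟶ Y) {N : X.Modules} {W : Y.Opens} (r : Γ(Y, W)) (m : Γ(N, f ⁻¹ᵁ W)) :
    pushMk f (f.app W r • m) = r • pushMk f m := rfl

lemma pushMk_res (f : X ⟶ Y) {N : X.Modules} {W W' : Y.Opens} (h : W' ≤ W) (m : Γ(N, f ⁻¹ᵁ W)) :
    res _ h (pushMk f m) = pushMk f (res N (f.preimage_mono h) m) := rfl

lemma pushMk_surjective (f : X ⟶ Y) {N : X.Modules} {W : Y.Opens} :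
    Function.Surjective (pushMk f : Γ(N, f ⁻¹ᵁ W) → _) := fun m => ⟨m, rfl⟩

lemma pushMk_injective (f : X ⟶ Y) {N : X.Modules} {W : Y.Opens} :
    Function.Injective (pushMk f : Γ(N, f ⁻¹ᵁ W) → _) := fun _ _ h => h

section
variable (f : X ⟶ Y) {V : Y.Modules} {U : Y.Opens} {n : ℕ} {e : Fin n → Γ(V, U)}
  (he : IsFrame V e) (i : Fin n)

/-- The function on `f⁻¹(U ∩ W)` given by the `i`-th coordinate of `v`. -/
def coordFun (W : Y.Opens) (v : Γ(V, W)) : Γ(X, cut (f ⁻¹ᵁ U) (f ⁻¹ᵁ W)) :=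
  f.appLE (cut U W) _ (cut_preimage_le f U W)
    ((he.basis _ (cut_le_left U W)).repr (res V (cut_le U W) v) i)

lemma coordFun_add {W : Y.Opens} (v v' : Γ(V, W)) :
    coordFun f he i W (v + v') = coordFun f he i W v + coordFun f he i W v' := by
  simp only [coordFun, res, map_add, Finsupp.add_apply]

lemma coordFun_smul {W : Y.Opens} (r : Γ(Y, W)) (v : Γ(V, W)) :
    coordFun f he i W (r • v) = resO X (cut_le _ _) (f.app W r) * coordFun f he i W v := by
  rw [coordFun, res_smul, map_smul, Finsupp.smul_apply, smul_eq_mul, map_mul, coordFun]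
  congr 1
  rw [resO, resO, ← ConcreteCategory.comp_apply, ← ConcreteCategory.comp_apply,
    Scheme.Hom.map_appLE, Scheme.Hom.app_eq_appLE, Scheme.Hom.appLE_map]

lemma resO_coordFun {W W' : Y.Opens} (h : W' ≤ W) (v : Γ(V, W)) :
    resO X (cut_mono _ (f.preimage_mono h)) (coordFun f he i W v) =
      coordFun f he i W' (res V h v) := by
  have h1 := he.basis_res (cut_le_left U W) (cut_mono U h) (res V (cut_le U W) v) i
  rw [res_res] at h1
  rw [coordFun, coordFun, res_res, h1, resO, resO, ← ConcreteCategory.comp_apply,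
    ← ConcreteCategory.comp_apply, Scheme.Hom.map_appLE, Scheme.Hom.appLE_map]

/-- The `i`-th coordinate `V ⟶ f_* (𝒪_X|_{f⁻¹(U)})`. -/
def pushCoord : V ⟶ (Scheme.Modules.pushforward f).obj (onOpen (f ⁻¹ᵁ U) (structureModule X)) :=
  homMk
    (fun W =>
      { toFun := fun v => pushMk f (onOpenMk (unitMk (coordFun f he i W v)))
        map_add' := fun v v' => by
          rw [coordFun_add, unitMk_add, onOpenMk_add, pushMk_add]
        map_smul' := fun r v => by
          rw [coordFun_smul, unitMk_mul, onOpenMk_smul, pushMk_smul, RingHom.id_apply] })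
    (fun W W' h v => by
      refine congr(pushMk f (onOpenMk (unitMk $((resO_coordFun f he i h v).symm)))))

/-- The `i`-th coordinate `f^* V ⟶ 𝒪_X|_{f⁻¹(U)}`. -/
def pullCoord : (Scheme.Modules.pullback f).obj V ⟶ onOpen (f ⁻¹ᵁ U) (structureModule X) :=
  ((Scheme.Modules.pullbackPushforwardAdjunction f).homEquiv V _).symm (pushCoord f he i)

lemma homEquiv_symm_pullSection {N : X.Modules} (φ : V ⟶ (Scheme.Modules.pushforward f).obj N)
    {W : Y.Opens} (v : Γ(V, W)) :
    (((Scheme.Modules.pullbackPushforwardAdjunction f).homEquiv V N).symm φ).app (f ⁻¹ᵁ W)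
      (pullSection f V v) = φ.app W v := by
  conv_rhs => rw [← ((Scheme.Modules.pullbackPushforwardAdjunction f).homEquiv V N).apply_symm_apply φ]
  rw [Adjunction.homEquiv_unit]
  rfl

/-- This is the adjunction between pullback and pushforward read on sections. It replaces any
explicit description of the sections of the pullback. -/
lemma pullback_hom_ext {N : X.Modules} {φ ψ : (Scheme.Modules.pullback f).obj V ⟶ N}
    (h : ∀ (W : Y.Opens) (v : Γ(V, W)), φ.app _ (pullSection f V v) = ψ.app _ (pullSection f V v)) :
    φ = ψ := by
  apply ((Scheme.Modules.pullbackPushforwardAdjunction f).homEquiv V N).injective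
  rw [Adjunction.homEquiv_unit, Adjunction.homEquiv_unit]
  ext W v
  exact h W v

lemma pullSection_sum {W : Y.Opens} {ι : Type*} (s : Finset ι) (v : ι → Γ(V, W)) :
    pullSection f V (∑ j ∈ s, v j) = ∑ j ∈ s, pullSection f V (v j) :=
  map_sum _ _ _

lemma pullSection_smul {W : Y.Opens} (r : Γ(Y, W)) (v : Γ(V, W)) :
    pullSection f V (r • v) = f.app W r • pullSection f V v :=
  Scheme.Modules.Hom.app_smul _ _ _

lemma pullSection_res {W W' : Y.Opens} (h : W' ≤ W) (v : Γ(V, W)) :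
    pullSection f V (res V h v) = res _ (f.preimage_mono h) (pullSection f V v) :=
  app_res _ h v

/-- Multiplication `𝒪|_U ⟶ M|_U` by a section `s` of `M` over `U`. -/
def smulSectionOn {M : X.Modules} {U : X.Opens} (s : Γ(M, U)) :
    onOpen U (structureModule X) ⟶ onOpen U M :=
  homMk
    (fun W =>
      { toFun := fun a => onOpenMk ((unitVal (show Γ(structureModule X, cut U W) from a)) •
          res M (cut_le_left U W) s)
        map_add' := fun a b => by
          rw [← onOpenMk_add, ← add_smul]
          rfl
        map_smul' := fun r a => by
          obtain ⟨a, rfl⟩ := onOpenMk_surjective a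
          rw [RingHom.id_apply, ← onOpenMk_smul, ← onOpenMk_smul, smul_smul]
          rfl })
    (fun W W' h a => by
      refine Eq.trans ?_ (congr(onOpenMk $(res_smul M (cut_mono U h) _ _)).symm)
      rw [res_res]
      rfl)

lemma smulSectionOn_app {M : X.Modules} {U : X.Opens} (s : Γ(M, U)) {W : X.Opens}
    (a : Γ(X, cut U W)) : (smulSectionOn s).app W (onOpenMk (unitMk a)) =
      onOpenMk (a • res M (cut_le_left U W) s) := rfl

lemma pullCoord_pullSection {W : Y.Opens} (v : Γ(V, W)) :
    (pullCoord f he i).app (f ⁻¹ᵁ W) (pullSection f V v) =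
      onOpenMk (unitMk (coordFun f he i W v)) :=
  homEquiv_symm_pullSection f _ v

/-- The counterpart of `sum_tensorCoord`. By `pullback_hom_ext` only pulled-back sections have to be
tested, and on those it is the pullback of an expansion in the frame. -/
lemma sum_pullCoord :
    ∑ i, pullCoord f he i ≫ smulSectionOn (pullSection f V (e i)) =
      toOnOpen (f ⁻¹ᵁ U) ((Scheme.Modules.pullback f).obj V) := by
  refine pullback_hom_ext f fun W v => ?_
  rw [sum_app, toOnOpen_app]
  have hle : cut (f ⁻¹ᵁ U) (f ⁻¹ᵁ W) ≤ f ⁻¹ᵁ cut U W := cut_preimage_le f U W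
  have h1 : res ((Scheme.Modules.pullback f).obj V) (cut_le (f ⁻¹ᵁ U) (f ⁻¹ᵁ W)) (pullSection f V v) =
      res ((Scheme.Modules.pullback f).obj V) hle (pullSection f V (res V (cut_le U W) v)) := by
    rw [pullSection_res, res_res]
  rw [h1, ← he.basis_repr_smul (cut_le_left U W) (res V (cut_le U W) v), pullSection_sum, res_sum,
    onOpenMk_sum]
  refine Finset.sum_congr rfl fun i _ => ?_
  rw [Scheme.Modules.Hom.comp_app, ConcreteCategory.comp_apply, pullCoord_pullSection,
    smulSectionOn_app, pullSection_smul, res_smul, pullSection_res, res_res, coordFun, resO,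
    ← ConcreteCategory.comp_apply, Scheme.Hom.app_eq_appLE, Scheme.Hom.appLE_map]

/-- The pullback of a frame is a frame. -/
lemma IsFrame.pullback (f : X ⟶ Y) {V : Y.Modules} {U : Y.Opens} {n : ℕ} {e : Fin n → Γ(V, U)}
    (he : IsFrame V e) : IsFrame ((Scheme.Modules.pullback f).obj V)
    fun i => pullSection f V (e i) := by
  classical
  intro W h
  set F := (Scheme.Modules.pullback f).obj V
  have hres (G : X.Modules) : Function.Injective (res G (cut_le (f ⁻¹ᵁ U) W)) := by
    intro a b hab
    have := congr(res G (le_cut h) $hab)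
    rwa [res_res, res_res, res_self, res_self] at this
  constructor
  · have h0 (i j : Fin n) : coordFun f he i U (e j) = if i = j then 1 else 0 := by
      have hb : res V (cut_le U U) (e j) = he.basis _ (cut_le_left U U) j :=
        (he.basis_apply _ (cut_le_left U U) j).symm
      rw [coordFun, hb, Module.Basis.repr_self, Finsupp.single_apply]
      by_cases hij : i = j
      · subst hij; simp
      · simp [hij, Ne.symm hij]
    have key (a : Fin n → Γ(X, W)) (i : Fin n) : (pullCoord f he i).app W
        (∑ j, a j • res F h (pullSection f V (e j))) =
          onOpenMk (unitMk (resO X (cut_le (f ⁻¹ᵁ U) W) (a i))) := by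
      have h1 (j : Fin n) : (pullCoord f he i).app W (a j • res F h (pullSection f V (e j))) =
          if i = j then onOpenMk (unitMk (resO X (cut_le (f ⁻¹ᵁ U) W) (a i))) else 0 := by
        rw [Scheme.Modules.Hom.app_smul, app_res, pullCoord_pullSection, h0]
        have h2 (b) : res (onOpen (f ⁻¹ᵁ U) (structureModule X)) h (onOpenMk (unitMk b)) =
          onOpenMk (unitMk (resO X (cut_mono _ h) b)) := rfl
        rw [h2, ← onOpenMk_smul, ← unitMk_mul]
        by_cases hij : i = j
        · subst hij; simp [resO]
        · simp only [hij, if_false, resO, map_zero, mul_zero]; rfl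
      rw [map_sum, Finset.sum_congr rfl fun j _ => h1 j]
      simp
    intro a b hab
    funext i
    have := (key a i).symm.trans (congr((pullCoord f he i).app W $hab).trans (key b i))
    exact hres (structureModule X) this
  · intro t
    have h1 := congr(($(sum_pullCoord f he)).app W t)
    rw [sum_app, toOnOpen_app] at h1
    choose a ha using fun i => onOpenMk_surjective ((pullCoord f he i).app W t)
    refine ⟨fun i => resO X (le_cut h) (unitVal (a i)), hres _ (onOpenMk_injective ?_)⟩
    rw [← h1]
    simp only
    rw [res_sum, onOpenMk_sum]
    refine Finset.sum_congr rfl fun i _ => ?_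
    rw [Scheme.Modules.Hom.comp_app, ConcreteCategory.comp_apply, ← ha]
    refine Eq.trans ?_ (smulSectionOn_app _ (unitVal (a i))).symm
    rw [res_smul, res_res, resO_resO]
    congr 2
    exact congr($(X.presheaf.map_id _) (unitVal (a i)))
end
end PullbackFrames

/-! ### Projection formula, coordinates of the Higgs field, and descent along a factorization -/

section PushforwardHiggs

variable {X Y Z : Scheme.{u}}

lemma projectionMap_tmul (f : X ⟶ Z) (M : X.Modules) (V : Z.Modules) {W : Z.Opens}
    (m : Γ(M, f ⁻¹ᵁ W)) (v : Γ(V, W)) :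
    (projectionMap f M V).app W (tmul (pushMk f m) v) = pushMk f (tmul m (pullSection f V v)) :=
  tensorDesc_tmul _ _ _ _ _

lemma pushMk_sum (f : X ⟶ Y) {N : X.Modules} {W : Y.Opens} {ι : Type*} (s : Finset ι)
    (m : ι → Γ(N, f ⁻¹ᵁ W)) : pushMk f (∑ i ∈ s, m i) = ∑ i ∈ s, pushMk f (m i) := rfl

lemma projectionMap_sum (f : X ⟶ Z) (M : X.Modules) {V : Z.Modules} {U W : Z.Opens} (h : W ≤ U)
    {n : ℕ} (e : Fin n → Γ(V, U)) (a : Fin n → Γ(M, f ⁻¹ᵁ W)) :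
    (projectionMap f M V).app W (∑ i, tmul (pushMk f (a i)) (res V h (e i))) =
      pushMk f (∑ i, tmul (a i) (res _ (f.preimage_mono h) (pullSection f V (e i)))) := by
  simp only [map_sum, projectionMap_tmul, pushMk_sum, pullSection_res]

/-- Both sides are identified with n-tuples of sections of M over f⁻¹(W), by the frame on the left
and by its pullback on the right. In these coordinates the projection map is the identity. -/
lemma IsFrame.projectionMap_bijective (f : X ⟶ Z) (M : X.Modules) {V : Z.Modules} {U : Z.Opens}
    {n : ℕ} {e : Fin n → Γ(V, U)} (he : IsFrame V e) {W : Z.Opens} (h : W ≤ U) :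
    Function.Bijective ((projectionMap f M V).app W) := by
  have h1 := he.tensor_bijective ((Scheme.Modules.pushforward f).obj M) h
  have h2 := (he.pullback f).tensor_bijective M (f.preimage_mono h)
  refine (Function.Bijective.of_comp_iff _ h1).mp ?_
  have h3 : Function.Bijective (pushMk f : Γ(tensor M ((Scheme.Modules.pullback f).obj V), f ⁻¹ᵁ W) → _) :=
    ⟨pushMk_injective f, pushMk_surjective f⟩
  have h4 : (projectionMap f M V).app W ∘ (fun a : Fin n → Γ(M, f ⁻¹ᵁ W) =>
      ∑ i, tmul (pushMk f (a i)) (res V h (e i))) = pushMk f ∘ _ :=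
    funext fun a => projectionMap_sum f M h e a
  exact h4 ▸ h3.comp h2

lemma isIso_projectionMap (f : X ⟶ Z) (M : X.Modules) {V : Z.Modules} (hV : IsVectorBundle V) :
    IsIso (projectionMap f M V) :=
  isIso_of_locally_bijective _ fun z => by
    obtain ⟨U, hz, n, e, he⟩ := hV z
    exact ⟨U, hz, fun W hW => he.projectionMap_bijective f M hW⟩

/-- The projection formula turns the pushforward of a multiplication map into a unique map
`f_* N ⟶ f_* N ⊗ V`. -/
lemma existsUnique_isPushforwardHiggs (f : X ⟶ Z) (N : X.Modules) {V : Z.Modules}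
    (hV : IsVectorBundle V) (s : Γ((Scheme.Modules.pullback f).obj V, ⊤)) :
    ∃! Φ, IsPushforwardHiggs f N V s Φ := by
  have := isIso_projectionMap f N hV
  refine ⟨(Scheme.Modules.pushforward f).map (mulSection N s) ≫ inv (projectionMap f N V),
    by simp [IsPushforwardHiggs], fun Φ hΦ => ?_⟩
  exact (IsIso.eq_comp_inv _).mpr hΦ

lemma hom_ext_of_locally {M N : X.Modules} {φ ψ : M ⟶ N}
    (h : ∀ x : X, ∃ U : X.Opens, x ∈ U ∧ ∀ W ≤ U, ∀ m : Γ(M, W), φ.app W m = ψ.app W m) :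
    φ = ψ := by
  ext W m
  refine eq_of_locally_eq _ _ fun x hx => ?_
  obtain ⟨U, hxU, hU⟩ := h x
  refine ⟨U ⊓ W, inf_le_right, ⟨hxU, hx⟩, ?_⟩
  rw [← app_res, ← app_res, hU _ inf_le_left]

/-- The coordinates over `f⁻¹(U)` of a section of `f^* V` in a frame of `V` over `U`. -/
def sectionCoord (f : X ⟶ Z) {V : Z.Modules} (s : Γ((Scheme.Modules.pullback f).obj V, ⊤))
    {U : Z.Opens} {n : ℕ} {e : Fin n → Γ(V, U)} (he : IsFrame V e) (i : Fin n) : Γ(X, f ⁻¹ᵁ U) :=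
  ((he.pullback f).basis _ le_rfl).repr (res _ le_top s) i

lemma sum_sectionCoord (f : X ⟶ Z) {V : Z.Modules}
    (s : Γ((Scheme.Modules.pullback f).obj V, ⊤))
    {U : Z.Opens} {n : ℕ} {e : Fin n → Γ(V, U)} (he : IsFrame V e) :
    ∑ i, sectionCoord f s he i • pullSection f V (e i) = res _ le_top s := by
  refine Eq.trans ?_ ((he.pullback f).basis_repr_smul le_rfl (res _ le_top s))
  simp only [res_self]
  rfl

lemma eq_sectionCoord (f : X ⟶ Z) {V : Z.Modules} (s : Γ((Scheme.Modules.pullback f).obj V, ⊤))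
    {U : Z.Opens} {n : ℕ} {e : Fin n → Γ(V, U)} (he : IsFrame V e) {a : Fin n → Γ(X, f ⁻¹ᵁ U)}
    (h : ∑ i, a i • pullSection f V (e i) = res _ le_top s) : a = sectionCoord f s he := by
  apply (he.pullback f (f ⁻¹ᵁ U) le_rfl).1
  have hself (i) : ((Scheme.Modules.pullback f).obj V).presheaf.map (homOfLE le_rfl).op
      (pullSection f V (e i)) = pullSection f V (e i) := res_self _ _
  simp only [hself]
  rw [h, sum_sectionCoord]

/-- Multiplication by a function `r` on `f⁻¹(U)`, on sections of `f_* N` over `U`. -/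
def mulEnd (f : X ⟶ Z) (N : X.Modules) {U : Z.Opens} (r : Γ(X, f ⁻¹ᵁ U)) :
    Module.End Γ(Z, U) Γ((Scheme.Modules.pushforward f).obj N, U) where
  toFun m := pushMk f (r • (show Γ(N, f ⁻¹ᵁ U) from m))
  map_add' m m' := by
    rw [← pushMk_add, ← smul_add]
    rfl
  map_smul' a m := by
    obtain ⟨m, rfl⟩ := pushMk_surjective f m
    rw [RingHom.id_apply, ← pushMk_smul, ← pushMk_smul]
    exact congr(pushMk f $(smul_comm r (f.app U a) m))

lemma mulEnd_pushMk (f : X ⟶ Z) (N : X.Modules) {U : Z.Opens} (r : Γ(X, f ⁻¹ᵁ U))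
    (m : Γ(N, f ⁻¹ᵁ U)) : mulEnd f N r (pushMk f m) = pushMk f (r • m) := rfl

lemma pushforward_map_app (f : X ⟶ Z) {N N' : X.Modules} (φ : N ⟶ N') {W : Z.Opens}
    (m : Γ(N, f ⁻¹ᵁ W)) : ((Scheme.Modules.pushforward f).map φ).app W (pushMk f m) =
      pushMk f (φ.app _ m) := rfl

lemma mulSection_app (M : X.Modules) {N : X.Modules} (s : Γ(N, ⊤)) {W : X.Opens} (m : Γ(M, W)) :
    (mulSection M s).app W m = tmul m (res N le_top s) := rfl

/-- The projection map is injective over W, so the formula may be tested after applying it. There it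
is the expansion of s in the pulled-back frame. -/
lemma IsPushforwardHiggs.app_pushMk {f : X ⟶ Z} {N : X.Modules} {V : Z.Modules}
    {s : Γ((Scheme.Modules.pullback f).obj V, ⊤)}
    {Φ : (Scheme.Modules.pushforward f).obj N ⟶ tensor ((Scheme.Modules.pushforward f).obj N) V}
    (hΦ : IsPushforwardHiggs f N V s Φ) {U : Z.Opens} {n : ℕ} {e : Fin n → Γ(V, U)}
    (he : IsFrame V e) {W : Z.Opens} (h : W ≤ U) (m : Γ(N, f ⁻¹ᵁ W)) :
    Φ.app W (pushMk f m) =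
      ∑ i, tmul (pushMk f (resO X (f.preimage_mono h) (sectionCoord f s he i) • m))
        (res V h (e i)) := by
  apply (he.projectionMap_bijective f N h).1
  rw [projectionMap_sum]
  refine (congr(($hΦ).app W (pushMk f m))).trans ?_
  rw [pushforward_map_app, mulSection_app]
  congr 1
  have h1 : res ((Scheme.Modules.pullback f).obj V) (le_top : f ⁻¹ᵁ W ≤ ⊤) s =
      res _ (f.preimage_mono h) (res _ le_top s) := by rw [res_res]
  rw [h1, ← sum_sectionCoord f s he, res_sum, tmul_sum]
  refine Finset.sum_congr rfl fun i _ => ?_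
  rw [res_smul, tmul_smul, smul_tmul]

lemma IsPushforwardHiggs.isCoordinates {f : X ⟶ Z} {N : X.Modules} {V : Z.Modules}
    {s : Γ((Scheme.Modules.pullback f).obj V, ⊤)}
    {Φ : (Scheme.Modules.pushforward f).obj N ⟶ tensor ((Scheme.Modules.pushforward f).obj N) V}
    (hΦ : IsPushforwardHiggs f N V s Φ) {U : Z.Opens} {n : ℕ} {e : Fin n → Γ(V, U)}
    (he : IsFrame V e) : IsCoordinates Φ e fun i => mulEnd f N (sectionCoord f s he i) := by
  intro m
  obtain ⟨m, rfl⟩ := pushMk_surjective f m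
  refine (hΦ.app_pushMk he le_rfl m).trans (Finset.sum_congr rfl fun i _ => ?_)
  rw [res_self, mulEnd_pushMk]
  congr 3
  exact congr($(X.presheaf.map_id _) (sectionCoord f s he i))

lemma IsFrame.isCoordinates_unique {E V : Z.Modules} {Φ : E ⟶ tensor E V} {U : Z.Opens} {n : ℕ}
    {e : Fin n → Γ(V, U)} (he : IsFrame V e) {A B : Fin n → Module.End Γ(Z, U) Γ(E, U)}
    (hA : IsCoordinates Φ e A) (hB : IsCoordinates Φ e B) : A = B := by
  have key (m : Γ(E, U)) : (fun i => A i m) = fun i => B i m := by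
    apply (he.tensor_bijective E le_rfl).1
    simp only [res_self]
    exact (hA m).symm.trans (hB m)
  funext i
  ext m
  exact congrFun (key m) i

/-- The definitions of Higgs field and of spectral ideal quantify over all coordinate families. This
pins the family down to multiplications by functions on X. -/
lemma IsPushforwardHiggs.coordinates_eq {f : X ⟶ Z} {N : X.Modules} {V : Z.Modules}
    {s : Γ((Scheme.Modules.pullback f).obj V, ⊤)}
    {Φ : (Scheme.Modules.pushforward f).obj N ⟶ tensor ((Scheme.Modules.pushforward f).obj N) V}
    (hΦ : IsPushforwardHiggs f N V s Φ) {U : Z.Opens} {n : ℕ} {e : Fin n → Γ(V, U)}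
    (he : IsFrame V e) {A : Fin n → Module.End Γ(Z, U) Γ((Scheme.Modules.pushforward f).obj N, U)}
    (hA : IsCoordinates Φ e A) : A = fun i => mulEnd f N (sectionCoord f s he i) :=
  he.isCoordinates_unique hA (hΦ.isCoordinates he)

/-- The pushforward of a multiplication map is a Higgs field. -/
lemma IsPushforwardHiggs.isHiggsField {f : X ⟶ Z} {N : X.Modules} {V : Z.Modules}
    {s : Γ((Scheme.Modules.pullback f).obj V, ⊤)}
    {Φ : (Scheme.Modules.pushforward f).obj N ⟶ tensor ((Scheme.Modules.pushforward f).obj N) V}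
    (hΦ : IsPushforwardHiggs f N V s Φ) : IsHiggsField Φ := by
  intro U n e A he hA i j
  rw [hΦ.coordinates_eq he hA]
  ext m
  obtain ⟨m, rfl⟩ := pushMk_surjective f m
  simp only [Module.End.mul_apply, mulEnd_pushMk]
  rw [smul_comm]

lemma tensorMap_tmul {M M' : X.Modules} (φ : M ⟶ M') (N : X.Modules) {W : X.Opens} (m : Γ(M, W))
    (v : Γ(N, W)) : (tensorMap φ N).app W (tmul m v) = tmul (φ.app W m) v := by
  have h := (sheafifyAdj X).unit.naturality (presheafTensorMap φ N)
  exact congr(($h).app (.op W) (TensorProduct.tmul _ m v)).symm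

/-- The isomorphism `p^* q^* V ≅ π^* V`, where `π = q ∘ p`. -/
def pullbackFactor {p : X ⟶ Y} {q : Y ⟶ Z} {π : X ⟶ Z} (h : p ≫ q = π) (V : Z.Modules) :
    (Scheme.Modules.pullback p).obj ((Scheme.Modules.pullback q).obj V) ≅
      (Scheme.Modules.pullback π).obj V :=
  (Scheme.Modules.pullbackComp p q ≪≫ Scheme.Modules.pullbackCongr h).app V

/-- The inverse comparison is conjugate to the comparison of pushforwards, so the units of the two
adjunctions determine it on pulled-back sections. The statement for the comparison itself follows by
inverting. -/
lemma pullbackComp_pullSection (p : X ⟶ Y) (q : Y ⟶ Z) (V : Z.Modules) {U : Z.Opens}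
    (v : Γ(V, U)) : ((Scheme.Modules.pullbackComp p q).hom.app V).app ((p ≫ q) ⁻¹ᵁ U)
      (pullSection p ((Scheme.Modules.pullback q).obj V) (pullSection q V v)) =
        pullSection (p ≫ q) V v := by
  have h1 := unit_conjugateEquiv ((Scheme.Modules.pullbackPushforwardAdjunction q).comp
    (Scheme.Modules.pullbackPushforwardAdjunction p))
    (Scheme.Modules.pullbackPushforwardAdjunction (p ≫ q)) (Scheme.Modules.pullbackComp p q).inv V
  rw [Scheme.Modules.conjugateEquiv_pullbackComp_inv] at h1
  have h2 := congr($(h1).app U v)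
  have h3 : ((Scheme.Modules.pullbackComp p q).inv.app V).app ((p ≫ q) ⁻¹ᵁ U)
      (pullSection (p ≫ q) V v) =
        pullSection p ((Scheme.Modules.pullback q).obj V) (pullSection q V v) := h2.symm
  rw [← h3, ← ConcreteCategory.comp_apply, ← Scheme.Modules.Hom.comp_app, Iso.inv_hom_id_app]
  rfl

/-- The map `q^* V ⟶ p_* π^* V`, where `π = q ∘ p`. -/
def pullComparison {p : X ⟶ Y} {q : Y ⟶ Z} {π : X ⟶ Z} (h : p ≫ q = π) (V : Z.Modules) :
    (Scheme.Modules.pullback q).obj V ⟶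
      (Scheme.Modules.pushforward p).obj ((Scheme.Modules.pullback π).obj V) :=
  (Scheme.Modules.pullbackPushforwardAdjunction p).homEquiv _ _ (pullbackFactor h V).hom

/-- The two opens are definitionally equal. Restriction along this inequality and the next one marks
the passage between the two forms without a cast. -/
lemma comp_preimage_le (p : X ⟶ Y) (q : Y ⟶ Z) (W : Z.Opens) :
    (p ≫ q) ⁻¹ᵁ W ≤ p ⁻¹ᵁ q ⁻¹ᵁ W := le_rfl

lemma le_comp_preimage (p : X ⟶ Y) (q : Y ⟶ Z) (W : Z.Opens) :
    p ⁻¹ᵁ q ⁻¹ᵁ W ≤ (p ≫ q) ⁻¹ᵁ W := le_rfl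

lemma pullComparison_top {p : X ⟶ Y} {q : Y ⟶ Z} {π : X ⟶ Z} (h : p ≫ q = π) (V : Z.Modules)
    (t : Γ((Scheme.Modules.pullback q).obj V, ⊤)) :
    (pullComparison h V).app ⊤ t = pushMk p (res _ le_top (pullSectionComp h V t)) := by
  have h1 : res ((Scheme.Modules.pullback π).obj V) le_top (pullSectionComp h V t) =
    pullSectionComp h V t := res_self _ _
  refine Eq.trans ?_ (congrArg (pushMk p (W := ⊤)) h1).symm
  rw [pullComparison, Adjunction.homEquiv_unit]
  rfl

lemma pullComparison_pullSection (p : X ⟶ Y) (q : Y ⟶ Z) (V : Z.Modules) {U : Z.Opens}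
    (v : Γ(V, U)) : (pullComparison (p := p) (q := q) rfl V).app (q ⁻¹ᵁ U) (pullSection q V v) =
      pushMk p (res _ (le_comp_preimage p q U) (pullSection (p ≫ q) V v)) := by
  have h1 : res _ (le_comp_preimage p q U) (pullSection (p ≫ q) V v) = pullSection (p ≫ q) V v :=
    res_self _ _
  refine Eq.trans ?_ (congrArg (pushMk p (W := q ⁻¹ᵁ U)) h1).symm
  rw [pullComparison, Adjunction.homEquiv_unit, ← pullbackComp_pullSection]
  have h : (pullbackFactor (p := p) (q := q) rfl V).hom =
      (Scheme.Modules.pullbackComp p q).hom.app V := by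
    refine Eq.trans (b := (Scheme.Modules.pullbackComp p q).hom.app V ≫ 𝟙 _) rfl
      (Category.comp_id _)
  rw [h]
  rfl

lemma pullComparison_sum (p : X ⟶ Y) (q : Y ⟶ Z) {V : Z.Modules} {U : Z.Opens}
    {n : ℕ} (e : Fin n → Γ(V, U)) {W : Y.Opens} (h : W ≤ q ⁻¹ᵁ U) (a : Fin n → Γ(Y, W)) :
    (pullComparison (p := p) (q := q) rfl V).app W
      (∑ i, a i • res _ h (pullSection q V (e i))) =
    pushMk p (∑ i, p.app W (a i) • res _ ((p.preimage_mono h).trans (le_comp_preimage p q U))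
      (pullSection (p ≫ q) V (e i))) := by
  rw [map_sum, pushMk_sum]
  refine Finset.sum_congr rfl fun i _ => ?_
  rw [Scheme.Modules.Hom.app_smul, app_res, pullComparison_pullSection, pushMk_smul, pushMk_res,
    res_res]

/-- A section of `π^* V` with locally defined coordinates on `Y` descends to a section of `q^* V`. -/
lemma exists_pullSectionComp_eq (p : X ⟶ Y) (q : Y ⟶ Z)
    {V : Z.Modules} (hV : IsVectorBundle V) (hp : ∀ W : Y.Opens, Function.Injective (p.app W))
    (s : Γ((Scheme.Modules.pullback (p ≫ q)).obj V, ⊤))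
    (hs : ∀ z : Z, ∃ (U : Z.Opens) (n : ℕ) (e : Fin n → Γ(V, U)) (he : IsFrame V e), z ∈ U ∧
      ∀ i, ∃ b : Γ(Y, q ⁻¹ᵁ U), p.app _ b = sectionCoord (p ≫ q) s he i) :
    ∃ t, pullSectionComp rfl V t = s := by
  -- In a frame the comparison map applies p to each coordinate, so it inherits the injectivity of p
  -- on functions. Local preimages of s are then unique and glue.
  have hinj := injective_of_locally_injective (pullComparison (p := p) (q := q) rfl V) fun y => by
    obtain ⟨U, hyU, n, e, he⟩ := hV (q y)
    refine ⟨q ⁻¹ᵁ U, hyU, fun W hW => ?_⟩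
    refine (Function.Injective.of_comp_iff' _ (he.pullback q W hW)).mp ?_
    have h1 := (he.pullback (p ≫ q) (p ⁻¹ᵁ W)
      ((p.preimage_mono hW).trans (le_comp_preimage p q U))).1
    have h2 : Function.Injective fun (a : Fin n → Γ(Y, W)) i => p.app W (a i) :=
      fun a b hab => funext fun i => hp W (congrFun hab i)
    have h3 : (pullComparison (p := p) (q := q) rfl V).app W ∘ (fun a : Fin n → Γ(Y, W) =>
        ∑ i, a i • res _ hW (pullSection q V (e i))) = pushMk p ∘ _ :=
      funext fun a => pullComparison_sum p q e hW a
    exact h3 ▸ (pushMk_injective p).comp (h1.comp h2)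
  obtain ⟨t, ht⟩ := mem_range_of_locally_mem_range (pullComparison (p := p) (q := q) rfl V) hinj
    (W := ⊤) (pushMk p (res _ le_top s)) fun y _ => by
      obtain ⟨U, n, e, he, hyU, hb⟩ := hs (q y)
      choose b hb using hb
      refine ⟨q ⁻¹ᵁ U, le_top, hyU, ∑ i, b i • res _ le_rfl (pullSection q V (e i)), ?_⟩
      rw [pullComparison_sum, pushMk_res, res_res]
      congr 1
      have h1 := congr(res _ (le_comp_preimage p q U) $(sum_sectionCoord (p ≫ q) s he))
      rw [res_res, res_sum] at h1
      rw [← h1]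
      refine Finset.sum_congr rfl fun i _ => ?_
      rw [hb i, res_smul]
      congr 1
      exact congr($(X.presheaf.map_id _) _).symm
  refine ⟨t, ?_⟩
  rw [pullComparison_top] at ht
  have := pushMk_injective p ht
  exact (res_self _ _).symm.trans (this.trans (res_self _ _))

lemma sectionCoord_pullSectionComp (p : X ⟶ Y) (q : Y ⟶ Z)
    {V : Z.Modules} (t : Γ((Scheme.Modules.pullback q).obj V, ⊤)) {U : Z.Opens} {n : ℕ}
    {e : Fin n → Γ(V, U)} (he : IsFrame V e) (i : Fin n) :
    sectionCoord (p ≫ q) (pullSectionComp rfl V t) he i = p.app _ (sectionCoord q t he i) := by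
  refine (congrFun (eq_sectionCoord (p ≫ q) (pullSectionComp rfl V t) he
    (a := fun i => p.app (q ⁻¹ᵁ U) (sectionCoord q t he i)) ?_) i).symm
  have h1 := pullComparison_sum p q e le_rfl (sectionCoord q t he)
  simp only [res_self] at h1
  rw [sum_sectionCoord, app_res, pullComparison_top, pushMk_res, res_res] at h1
  have h2 := pushMk_injective p h1
  refine Eq.trans ?_ h2.symm
  refine Finset.sum_congr rfl fun i _ => ?_
  congr 1
  exact (res_self _ _).symm

lemma pushforwardFactor_hom_app (p : X ⟶ Y) (q : Y ⟶ Z) (M : X.Modules) {W : Z.Opens}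
    (m : Γ(M, p ⁻¹ᵁ q ⁻¹ᵁ W)) : (pushforwardFactor (p := p) (q := q) rfl M).hom.app W
      (pushMk q (pushMk p m)) = pushMk (p ≫ q) (res M (comp_preimage_le p q W) m) := rfl

/-- In a frame both maps multiply by the coordinates of the section, and the coordinates over X are
the pullbacks by p of those over Y. -/
lemma conjHiggs_eq (p : X ⟶ Y) (q : Y ⟶ Z) {M : X.Modules}
    {V : Z.Modules} (hV : IsVectorBundle V) {t : Γ((Scheme.Modules.pullback q).obj V, ⊤)}
    {Φ : (Scheme.Modules.pushforward (p ≫ q)).obj M ⟶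
      tensor ((Scheme.Modules.pushforward (p ≫ q)).obj M) V}
    (hΦ : IsPushforwardHiggs (p ≫ q) M V (pullSectionComp rfl V t) Φ)
    {Ψ : (Scheme.Modules.pushforward q).obj ((Scheme.Modules.pushforward p).obj M) ⟶
      tensor ((Scheme.Modules.pushforward q).obj ((Scheme.Modules.pushforward p).obj M)) V}
    (hΨ : IsPushforwardHiggs q ((Scheme.Modules.pushforward p).obj M) V t Ψ) :
    conjHiggs (pushforwardFactor rfl M) V Ψ = Φ := by
  rw [conjHiggs, Iso.inv_comp_eq]
  refine hom_ext_of_locally fun z => ?_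
  obtain ⟨U, hzU, n, e, he⟩ := hV z
  refine ⟨U, hzU, fun W hW m => ?_⟩
  obtain ⟨m, rfl⟩ := pushMk_surjective q m
  obtain ⟨m, rfl⟩ := pushMk_surjective p m
  rw [Scheme.Modules.Hom.comp_app, ConcreteCategory.comp_apply, Scheme.Modules.Hom.comp_app,
    ConcreteCategory.comp_apply, hΨ.app_pushMk he hW, pushforwardFactor_hom_app, map_sum,
    hΦ.app_pushMk he hW]
  refine Finset.sum_congr rfl fun i _ => ?_
  rw [tensorMap_tmul, ← pushMk_smul, pushforwardFactor_hom_app, sectionCoord_pullSectionComp,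
    res_smul]
  congr 3
  refine Eq.trans (congr($(X.presheaf.map_id _) _)) ?_
  exact congr($(p.naturality (homOfLE (q.preimage_mono hW)).op) (sectionCoord q t he i))

end PushforwardHiggs

/-! ### The determinant of a commuting pencil and the ideal of its coefficients -/

section Pencil

open TensorProduct nonZeroDivisors

variable {R : Type u} [CommRing R] {E : Type u} [AddCommGroup E] [Module R E] {n : ℕ}

/-- Determinants commute with base change for finite free modules. Freeness over P is a real
assumption: without a finite basis `LinearMap.det` is 1 by convention. -/
lemma pencilDet_map (A : Fin n → Module.End R E) {P Q : Type u} [CommRing P] [CommRing Q]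
    [Algebra R P] [Algebra R Q] [Module.Free P (P ⊗[R] E)] [Module.Finite P (P ⊗[R] E)]
    (f : P →ₐ[R] Q) (x y : Fin n → P) :
    f (pencilDet A P x y) = pencilDet A Q (fun i => f (x i)) fun i => f (y i) := by
  let _ : Algebra P Q := f.toRingHom.toAlgebra
  have : IsScalarTower R P Q := .of_algebraMap_eq' f.comp_algebraMap.symm
  let c := AlgebraTensorModule.cancelBaseChange R P Q Q E
  have h1 : f (pencilDet A P x y) = algebraMap P Q (pencilDet A P x y) := rfl
  have h2 (p : P) (z : Q) : p • z = f p * z := rfl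
  rw [h1, pencilDet, ← LinearMap.det_baseChange, ← LinearMap.det_conj _ c, pencilDet]
  congr 1
  refine TensorProduct.AlgebraTensorModule.ext fun z m => ?_
  simp only [LinearMap.comp_apply, LinearEquiv.coe_coe, c,
    AlgebraTensorModule.cancelBaseChange_symm_tmul, LinearMap.baseChange_tmul, LinearMap.sum_apply,
    TensorProduct.tmul_sum, map_sum, LinearMap.smul_apply, LinearMap.sub_apply, LinearMap.id_apply,
    TensorProduct.tmul_sub, map_sub, smul_sub, TensorProduct.smul_tmul', smul_eq_mul, mul_one, map_mul, mul_assoc,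
    AlgebraTensorModule.cancelBaseChange_tmul, h2]

variable [IsDomain R]

/-- Over a field every module is free, and freeness survives base change to P. E need not be free
over R, which is why the characteristic form is taken over the fraction ring. -/
instance free_tensor_of_fractionRing (P : Type u) [CommRing P] [Algebra R P]
    [Algebra (FractionRing R) P] [IsScalarTower R (FractionRing R) P] :
    Module.Free P (P ⊗[R] E) :=
  .of_equiv (AlgebraTensorModule.cancelBaseChange R (FractionRing R) P P E)

variable {B : Type u} [CommRing B] [IsDomain B] [Algebra R B] [FaithfulSMul R B]
  [Module.Finite R B] [Module B E] [IsScalarTower R B E] [Module.Finite R E] [CharZero R]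

attribute [local instance] FractionRing.liftAlgebra

/-- Over the fraction field `K` of `R`, the determinant of the pencil of multiplications by elements
of `B` is a power of a norm. -/
lemma pencilDet_fractionRing (A : Fin n → Module.End R E) (s : Fin n → B)
    (hA : ∀ i m, A i m = s i • m) (x y : Fin n → FractionRing R) :
    pencilDet A (FractionRing R) x y = Algebra.norm (FractionRing R)
      (∑ i, algebraMap _ (FractionRing B) (x i) *
        (algebraMap B (FractionRing B) (s i) - algebraMap _ (FractionRing B) (y i))) ^
          Module.finrank (FractionRing B) (FractionRing B ⊗[B] E) := by
  -- Frac B is K ⊗ B because B is finite over R. So K ⊗ E over R is Frac B ⊗ E over B, where the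
  -- pencil acts as multiplication by the scalar θ. Its determinant over Frac B is a power of θ, and
  -- the determinant over K is the norm of that.
  have : Algebra.IsPushout R B (FractionRing R) (FractionRing B) :=
    Algebra.isPushout_of_isLocalization R⁰ _ _ _
  have : Algebra.IsPushout R (FractionRing R) B (FractionRing B) := .symm inferInstance
  have : Module.Finite (FractionRing R) (FractionRing B) := .of_isLocalization R B R⁰
  have : Module.Finite B E := .of_restrictScalars_finite R B E
  set θ := ∑ i, algebraMap _ (FractionRing B) (x i) *
        (algebraMap B (FractionRing B) (s i) - algebraMap _ (FractionRing B) (y i)) with hθ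
  let c := Algebra.IsPushout.cancelBaseChange R (FractionRing R) B (FractionRing B) E
  have h (s : B) (a : FractionRing B) (m : E) : a ⊗ₜ[B] (s • m) =
      (algebraMap B (FractionRing B) s * a) ⊗ₜ[B] m := by
    rw [← Algebra.smul_def, TensorProduct.smul_tmul]
  rw [pencilDet, ← LinearMap.det_conj _ c.symm, ← map_pow]
  have h1 : θ ^ Module.finrank (FractionRing B) (FractionRing B ⊗[B] E) =
      LinearMap.det (θ • (LinearMap.id : FractionRing B ⊗[B] E →ₗ[FractionRing B] _)) := by
    rw [LinearMap.det_smul, LinearMap.det_id, mul_one]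
  rw [h1, ← LinearMap.det_restrictScalars]
  congr 1
  have h2 : c.symm.toLinearMap ∘ₗ (∑ i, x i • ((A i).baseChange (FractionRing R) - y i • LinearMap.id)) =
      ((θ • (LinearMap.id : FractionRing B ⊗[B] E →ₗ[FractionRing B] _)).restrictScalars
        (FractionRing R)) ∘ₗ c.symm.toLinearMap := by
    refine TensorProduct.AlgebraTensorModule.ext fun z m => ?_
    simp only [LinearMap.comp_apply, LinearEquiv.coe_coe, LinearMap.sum_apply, map_sum,
      LinearMap.smul_apply, LinearMap.sub_apply, LinearMap.baseChange_tmul, LinearMap.id_apply,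
      map_sub, c, Algebra.IsPushout.cancelBaseChange_symm_tmul, LinearMap.restrictScalars_apply,
      hA, h, hθ, Finset.sum_smul, TensorProduct.smul_tmul', smul_sub, smul_eq_mul]
    refine Finset.sum_congr rfl fun i _ => ?_
    rw [← TensorProduct.sub_tmul]
    congr 1
    simp only [map_mul]
    ring
  refine LinearMap.ext fun w => ?_
  obtain ⟨w, rfl⟩ := c.symm.surjective w
  have := congr($h2 w)
  simpa using this

/-- The linear form `∑ i, x i (τ (s i) - y i)`. -/
def linearFactor {S : Type u} [CommRing S] (s : Fin n → S) :
    MvPolynomial (Fin n) (MvPolynomial (Fin n) S) :=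
  ∑ i, MvPolynomial.X i * MvPolynomial.C (MvPolynomial.C (s i) - MvPolynomial.X i)

lemma map_linearFactor {S T : Type u} [CommRing S] [CommRing T] (f : S →+* T) (s : Fin n → S) :
    (linearFactor s).map (MvPolynomial.map f) = linearFactor fun i => f (s i) := by
  simp [linearFactor]

/-- A polynomial over a domain is determined by its values at points with coordinates in an infinite
subfield. This reduces an identity over the algebraic closure to points over K, where the pencil is
a K-linear endomorphism. -/
lemma mvPolynomial_funext₂ {S : Type u} [CommRing S] [IsDomain S] {k : Type u} [Field k] [Infinite k]
    (f : k →+* S) {p q : MvPolynomial (Fin n) (MvPolynomial (Fin n) S)}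
    (h : ∀ x y : Fin n → k, (p.eval fun i => MvPolynomial.C (f (x i))).eval (fun i => f (y i)) =
      (q.eval fun i => MvPolynomial.C (f (x i))).eval (fun i => f (y i))) : p = q := by
  refine MvPolynomial.funext_set (fun _ => Set.range fun a => MvPolynomial.C (f a)) (fun _ =>
    Set.infinite_range_of_injective ((MvPolynomial.C_injective _ _).comp f.injective)) fun x hx => ?_
  choose a ha using fun i => hx i trivial
  refine MvPolynomial.funext_set (fun _ => Set.range f) (fun _ =>
    Set.infinite_range_of_injective f.injective) fun y hy => ?_
  choose b hb using fun i => hy i trivial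
  obtain rfl : (fun i => MvPolynomial.C (f (a i))) = x := funext ha
  obtain rfl : (fun i => f (b i)) = y := funext hb
  exact h a b

/-- The factorization of `det (∑ i, x i (A i - y i))` over an algebraic closure. -/
lemma map_charForm (A : Fin n → Module.End R E) (s : Fin n → B) (hA : ∀ i m, A i m = s i • m)
    (Ω : Type u) [Field Ω] [IsAlgClosed Ω] [Algebra (FractionRing R) Ω] :
    (charForm A).map (MvPolynomial.map (algebraMap (FractionRing R) Ω)) =
      ∏ τ : FractionRing B →ₐ[FractionRing R] Ω,
        linearFactor (fun i => τ (algebraMap B _ (s i))) ^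
          Module.finrank (FractionRing B) (FractionRing B ⊗[B] E) := by
  have : Module.Finite (FractionRing R) (FractionRing B) := .of_isLocalization R B R⁰
  -- Characteristic zero enters twice: K is infinite, so its points detect polynomials, and Frac B
  -- is separable over K, so the norm is the product over the embeddings.
  have : CharZero (FractionRing R) := charZero_of_injective_algebraMap (IsFractionRing.injective R _)
  refine mvPolynomial_funext₂ (algebraMap (FractionRing R) Ω) fun x y => ?_
  let ev : CharRing R n →ₐ[R] FractionRing R :=
    ((MvPolynomial.aeval y).comp ((MvPolynomial.aeval (fun i => MvPolynomial.C (x i)) :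
      CharRing R n →ₐ[MvPolynomial (Fin n) (FractionRing R)] _).restrictScalars
        (FractionRing R))).restrictScalars R
  have h0 : (((charForm A).map (MvPolynomial.map (algebraMap (FractionRing R) Ω))).eval
      fun i => MvPolynomial.C (algebraMap _ Ω (x i))).eval (fun i => algebraMap _ Ω (y i)) =
        algebraMap (FractionRing R) Ω (ev (charForm A)) := by
    have : (MvPolynomial.eval fun i => algebraMap _ Ω (y i)).comp
        ((MvPolynomial.eval fun i => MvPolynomial.C (algebraMap _ Ω (x i))).comp
          (MvPolynomial.map (MvPolynomial.map (algebraMap (FractionRing R) Ω)))) =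
        (algebraMap (FractionRing R) Ω).comp (ev : CharRing R n →+* FractionRing R) := by
      refine MvPolynomial.ringHom_ext (fun p => ?_) fun i => by simp [ev]
      induction p using MvPolynomial.induction_on <;> simp_all [ev]
    exact congr($this (charForm A))
  have h1 := pencilDet_map A (P := CharRing R n) (Q := FractionRing R) ev MvPolynomial.X fun i => MvPolynomial.C (MvPolynomial.X i)
  rw [h0, charForm, h1, pencilDet_fractionRing _ s hA, map_pow,
    Algebra.norm_eq_prod_embeddings]
  simp only [map_prod, map_pow, map_sum, map_mul, map_sub, AlgHom.commutes, ← Finset.prod_pow,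
    linearFactor, ev]
  simp

/-- A nonzero element of a torsion-free module survives at the generic point. With exponent zero the
factorization would be 1 and would say nothing about the s i. -/
lemma finrank_fractionRing_ne_zero [Nontrivial E] [Module.Finite B E]
    (hE : ∀ (b : B) (m : E), b • m = 0 → b = 0 ∨ m = 0) :
    Module.finrank (FractionRing B) (FractionRing B ⊗[B] E) ≠ 0 := by
  obtain ⟨m, hm⟩ := exists_ne (0 : E)
  have h1 : IsLocalizedModule B⁰ (TensorProduct.mk B (FractionRing B) E 1) :=
    (isLocalizedModule_iff_isBaseChange B⁰ (FractionRing B) _).mpr (TensorProduct.isBaseChange _ _ _)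
  have : Nontrivial (FractionRing B ⊗[B] E) := by
    refine ⟨1 ⊗ₜ m, 0, fun h => ?_⟩
    obtain ⟨c, hc⟩ := (IsLocalizedModule.eq_zero_iff B⁰ (TensorProduct.mk B (FractionRing B) E 1)).mp h
    rcases hE c m hc with h | h
    · exact nonZeroDivisors.coe_ne_zero c h
    · exact hm h
  exact Module.finrank_pos.ne'

variable (R) in
/-- The integral closure of `R` in an algebraic closure of its fraction field. -/
abbrev absoluteIntegralClosure : Type u :=
  integralClosure R (AlgebraicClosure (FractionRing R))

lemma algebraMap_absoluteIntegralClosure_injective :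
    Function.Injective (algebraMap R (absoluteIntegralClosure R)) := by
  have : Function.Injective (algebraMap R (AlgebraicClosure (FractionRing R))) := by
    rw [IsScalarTower.algebraMap_eq R (FractionRing R)]
    exact (algebraMap (FractionRing R) _).injective.comp (IsFractionRing.injective R _)
  rw [IsScalarTower.algebraMap_eq R (absoluteIntegralClosure R)] at this
  exact Function.Injective.of_comp (f := algebraMap _ _) this

/-- Each s i is integral over R and stays so under every embedding of Frac B. The factorization
therefore holds over the absolute integral closure, an integral extension of R to which lying over
applies. -/
lemma exists_map_charForm_eq_prod [Nontrivial E]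
    (hE : ∀ (b : B) (m : E), b • m = 0 → b = 0 ∨ m = 0) (A : Fin n → Module.End R E)
    (s : Fin n → B) (hA : ∀ i m, A i m = s i • m) :
    ∃ (T : Type u) (_ : Fintype T) (_ : Nonempty T) (t : T → B →ₐ[R] absoluteIntegralClosure R)
      (d : ℕ), d ≠ 0 ∧ (∀ τ, Function.Injective (t τ)) ∧
      (charForm A).map (MvPolynomial.map (algebraMap (FractionRing R) _)) =
        (∏ τ, linearFactor (fun i => t τ (s i)) ^ d).map (MvPolynomial.map
          (algebraMap (absoluteIntegralClosure R) (AlgebraicClosure (FractionRing R)))) := by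
  have : Module.Finite (FractionRing R) (FractionRing B) := .of_isLocalization R B R⁰
  have : Module.Finite B E := .of_restrictScalars_finite R B E
  let Ω := AlgebraicClosure (FractionRing R)
  refine ⟨FractionRing B →ₐ[FractionRing R] Ω, inferInstance, ⟨IsAlgClosed.lift⟩,
    fun τ => ((τ.restrictScalars R).comp (IsScalarTower.toAlgHom R B (FractionRing B))).codRestrict
      (integralClosure R Ω) fun b => (Algebra.IsIntegral.isIntegral b).map _, _,
    finrank_fractionRing_ne_zero hE, fun τ => ?_, ?_⟩
  · exact fun a b h => IsFractionRing.injective B (FractionRing B) (τ.injective congr(($h).1))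
  · rw [map_charForm A s hA]
    simp only [map_prod, map_pow, map_linearFactor]
    rfl

/-- The ideal generated by the coefficients of `det (∑ i, x i (A i - y i))`. -/
def charIdeal (A : Fin n → Module.End R E) : Ideal (MvPolynomial (Fin n) R) :=
  Ideal.span {c | ∃ d, c.map (algebraMap R (FractionRing R)) = (charForm A).coeff d}

/-- By the factorization the coefficients are integral over R, and they lie in its fraction field.
Hence every coefficient of the characteristic form contributes a generator to `charIdeal`, whose
definition takes only those that lift. -/
lemma exists_map_eq_coeff_charForm [IsIntegrallyClosed R] [Nontrivial E]
    (hE : ∀ (b : B) (m : E), b • m = 0 → b = 0 ∨ m = 0) (A : Fin n → Module.End R E)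
    (s : Fin n → B) (hA : ∀ i m, A i m = s i • m) (d : Fin n →₀ ℕ) :
    ∃ c : MvPolynomial (Fin n) R, c.map (algebraMap R (FractionRing R)) = (charForm A).coeff d := by
  obtain ⟨T, _, _, t, k, -, -, h⟩ := exists_map_charForm_eq_prod hE A s hA
  refine MvPolynomial.mem_range_map_iff_coeffs_subset.mpr fun a ha => ?_
  obtain ⟨m, -, rfl⟩ := MvPolynomial.mem_coeffs_iff.mp ha
  have h1 := congr((($h).coeff d).coeff m)
  simp only [MvPolynomial.coeff_map] at h1
  refine IsIntegrallyClosed.isIntegral_iff.mp ((isIntegral_algebraMap_iff (algebraMap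
    (FractionRing R) (AlgebraicClosure (FractionRing R))).injective).mp ?_)
  rw [h1]
  exact Subtype.property _

/-- Putting y i = τ (s i) for one embedding τ kills a factor, hence each coefficient c. The value
obtained is τ applied to c at s, and τ is injective on B. -/
lemma charIdeal_le_ker [Nontrivial E]
    (hE : ∀ (b : B) (m : E), b • m = 0 → b = 0 ∨ m = 0) (A : Fin n → Module.End R E)
    (s : Fin n → B) (hA : ∀ i m, A i m = s i • m) :
    charIdeal A ≤ RingHom.ker (MvPolynomial.aeval (R := R) s) := by
  obtain ⟨T, _, ⟨τ⟩, t, k, hk, ht, h⟩ := exists_map_charForm_eq_prod hE A s hA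
  rw [charIdeal, Ideal.span_le]
  rintro c ⟨d, hc⟩
  have h1 := congr(($h).coeff d)
  rw [MvPolynomial.coeff_map, MvPolynomial.coeff_map, ← hc, MvPolynomial.map_map,
    ← IsScalarTower.algebraMap_eq, IsScalarTower.algebraMap_eq R (absoluteIntegralClosure R),
    ← MvPolynomial.map_map] at h1
  have h2 := MvPolynomial.map_injective _ (FaithfulSMul.algebraMap_injective
    (absoluteIntegralClosure R) (AlgebraicClosure (FractionRing R))) h1
  refine ht τ ?_
  rw [map_zero]
  have h3 := congr(MvPolynomial.eval (fun i => t τ (s i)) $h2)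
  rw [MvPolynomial.eval_map] at h3
  have h4 : t τ (MvPolynomial.aeval s c) = MvPolynomial.eval₂ (algebraMap R _) (fun i => t τ (s i)) c := by
    rw [← MvPolynomial.aeval_def, ← MvPolynomial.comp_aeval_apply]
  have h5 : MvPolynomial.map (MvPolynomial.eval (fun i => t τ (s i)))
      (∏ τ, linearFactor (fun i => t τ (s i)) ^ k) = 0 := by
    rw [map_prod]
    refine Finset.prod_eq_zero (Finset.mem_univ τ) ?_
    rw [map_pow, linearFactor]
    simp [hk]
  refine h4.trans (h3.trans ?_)
  rw [← MvPolynomial.coeff_map, h5, MvPolynomial.coeff_zero]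

lemma isIntegral_mvPolynomial_map {R σ S : Type*} [CommRing R] [CommRing S] [Algebra R S]
    [Algebra.IsIntegral R S] : (MvPolynomial.map (σ := σ) (algebraMap R S)).IsIntegral := by
  intro p
  induction p using MvPolynomial.induction_on with
  | C a =>
    obtain ⟨f, hf, hfa⟩ := Algebra.IsIntegral.isIntegral (R := R) a
    refine ⟨f.map MvPolynomial.C, hf.map _, ?_⟩
    rw [Polynomial.eval₂_map]
    have : (MvPolynomial.map (σ := σ) (algebraMap R S)).comp MvPolynomial.C =
      MvPolynomial.C.comp (algebraMap R S) := by ext; simp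
    rw [this, ← Polynomial.hom_eval₂, hfa, map_zero]
  | add p q hp hq => exact hp.add _ hq
  | mul_X p i hp =>
    refine hp.mul _ ?_
    have := RingHom.isIntegralElem_map (MvPolynomial.map (σ := σ) (algebraMap R S)) (x := MvPolynomial.X i)
    rwa [MvPolynomial.map_X] at this

/-- The radical is the intersection of the primes P above the ideal. Lift P to a prime Q over the
absolute integral closure: in a polynomial ring over the domain of residues modulo Q, a vanishing
product of linear forms has a vanishing factor. That identifies y with τ (s) modulo Q, so a relation
g among the s i lies in Q, and thus in P. -/
lemma ker_le_radical_charIdeal [IsIntegrallyClosed R] [Nontrivial E]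
    (hE : ∀ (b : B) (m : E), b • m = 0 → b = 0 ∨ m = 0) (A : Fin n → Module.End R E)
    (s : Fin n → B) (hA : ∀ i m, A i m = s i • m) :
    RingHom.ker (MvPolynomial.aeval (R := R) s) ≤ (charIdeal A).radical := by
  intro g hg
  obtain ⟨T, _, _, t, k, hk, ht, h⟩ := exists_map_charForm_eq_prod hE A s hA
  rw [Ideal.radical_eq_sInf, Ideal.mem_sInf]
  rintro P ⟨hP, _⟩
  let S := absoluteIntegralClosure R
  let _ : Algebra (MvPolynomial (Fin n) R) (MvPolynomial (Fin n) S) :=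
    (MvPolynomial.map (algebraMap R S)).toAlgebra
  have : Algebra.IsIntegral (MvPolynomial (Fin n) R) (MvPolynomial (Fin n) S) :=
    ⟨isIntegral_mvPolynomial_map⟩
  obtain ⟨Q, -, _, rfl⟩ := Ideal.exists_ideal_over_prime_of_isIntegral (S := MvPolynomial (Fin n) S) P ⊥ (by
    intro p hp
    rw [Ideal.mem_comap, Ideal.mem_bot] at hp
    rw [MvPolynomial.map_injective _ algebraMap_absoluteIntegralClosure_injective
      (hp.trans (map_zero _).symm)]
    exact zero_mem _)
  have h1 : (∏ τ, linearFactor (fun i => t τ (s i)) ^ k).map (Ideal.Quotient.mk Q) = 0 := by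
    ext1 d
    obtain ⟨c, hc⟩ := exists_map_eq_coeff_charForm hE A s hA d
    have h1 := congr(($h).coeff d)
    rw [MvPolynomial.coeff_map, MvPolynomial.coeff_map, ← hc, MvPolynomial.map_map,
      ← IsScalarTower.algebraMap_eq, IsScalarTower.algebraMap_eq R (absoluteIntegralClosure R),
      ← MvPolynomial.map_map] at h1
    have h2 := MvPolynomial.map_injective _ (FaithfulSMul.algebraMap_injective
      (absoluteIntegralClosure R) (AlgebraicClosure (FractionRing R))) h1
    rw [MvPolynomial.coeff_map, ← h2, MvPolynomial.coeff_zero, Ideal.Quotient.eq_zero_iff_mem]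
    exact hP (Ideal.subset_span ⟨d, hc⟩)
  rw [map_prod, Finset.prod_eq_zero_iff] at h1
  obtain ⟨τ, -, h1⟩ := h1
  rw [map_pow] at h1
  replace h1 := pow_eq_zero_iff hk |>.mp h1
  have h2 (i : Fin n) : Ideal.Quotient.mk Q (MvPolynomial.X i) =
      Ideal.Quotient.mk Q (MvPolynomial.C (t τ (s i))) := by
    -- Evaluating x at the i-th unit vector isolates the coefficient τ (s i) - y i of the vanishing
    -- linear form.
    have := congr(MvPolynomial.eval (Pi.single i 1) $h1)
    simp only [linearFactor, map_sum, map_mul, MvPolynomial.map_X, MvPolynomial.map_C,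
      MvPolynomial.eval_X, MvPolynomial.eval_C, Pi.single_apply, ite_mul, one_mul, zero_mul,
      Finset.sum_ite_eq', Finset.mem_univ, if_true, map_zero, map_sub] at this
    exact (sub_eq_zero.mp this).symm
  rw [Ideal.mem_comap, ← Ideal.Quotient.eq_zero_iff_mem]
  have h3 : (Ideal.Quotient.mk Q).comp (MvPolynomial.map (algebraMap R S)) =
      (((Ideal.Quotient.mk Q).comp MvPolynomial.C).comp (t τ : B →+* S)).comp
        (MvPolynomial.aeval (R := R) s : _ →+* B) := by
    refine MvPolynomial.ringHom_ext (fun r => ?_) fun i => ?_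
    · simp [S]
    · simpa using h2 i
  refine congr($h3 g).trans ?_
  rw [RingHom.comp_apply]
  exact (congrArg _ hg).trans (map_zero _)

end Pencil

/-! ### The morphism to the total space given by a section -/

section SectionMap

variable {X Z : Scheme.{u}} (f : X ⟶ Z) {V : Z.Modules}

/-- The cover of `X` by the preimages of the affine opens over which `V` has a frame. -/
def preimageCover (hV : IsVectorBundle V) : X.OpenCover where
  I₀ := FramedOpens V
  X U := (f ⁻¹ᵁ U.carrier).toScheme
  f U := (f ⁻¹ᵁ U.carrier).ι
  mem₀ := by
    rw [Scheme.presieve₀_mem_precoverage_iff]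
    refine ⟨fun x => ?_, inferInstance⟩
    obtain ⟨W, hW, -⟩ := exists_framedOpens hV (z := f x) (U := ⊤) trivial
    refine ⟨W, ?_⟩
    rw [Scheme.Opens.range_ι]
    exact hW

instance (hV : IsVectorBundle V) : Preorder (preimageCover f hV).I₀ :=
  inferInstanceAs (Preorder (FramedOpens V))

/-- A point common to two members lies over a smaller framed affine open contained in both. So
morphisms glue once they are compatible with inclusions, and no intersections have to be computed.
-/
lemma preimageCover_directed (hV : IsVectorBundle V) (U W : FramedOpens V)
    (x : ↥(pullback (f ⁻¹ᵁ U.carrier).ι (f ⁻¹ᵁ W.carrier).ι)) :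
    ∃ (T : FramedOpens V) (hU : T ≤ U) (hW : T ≤ W) (y : (f ⁻¹ᵁ T.carrier).toScheme),
      pullback.lift (X.homOfLE (f.preimage_mono (FramedOpens.carrier_le hU)))
        (X.homOfLE (f.preimage_mono (FramedOpens.carrier_le hW))) (by simp) y = x := by
  have hab : (pullback.fst (f ⁻¹ᵁ U.carrier).ι (f ⁻¹ᵁ W.carrier).ι ≫ (f ⁻¹ᵁ U.carrier).ι) x =
      (pullback.snd (f ⁻¹ᵁ U.carrier).ι (f ⁻¹ᵁ W.carrier).ι ≫ (f ⁻¹ᵁ W.carrier).ι) x :=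
    congr($(pullback.condition (f := (f ⁻¹ᵁ U.carrier).ι) (g := (f ⁻¹ᵁ W.carrier).ι)) x)
  have hU : (pullback.fst (f ⁻¹ᵁ U.carrier).ι (f ⁻¹ᵁ W.carrier).ι ≫ (f ⁻¹ᵁ U.carrier).ι) x ∈
      f ⁻¹ᵁ U.carrier := (pullback.fst (f ⁻¹ᵁ U.carrier).ι (f ⁻¹ᵁ W.carrier).ι x).2
  have hW : (pullback.snd (f ⁻¹ᵁ U.carrier).ι (f ⁻¹ᵁ W.carrier).ι ≫ (f ⁻¹ᵁ W.carrier).ι) x ∈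
      f ⁻¹ᵁ W.carrier := (pullback.snd (f ⁻¹ᵁ U.carrier).ι (f ⁻¹ᵁ W.carrier).ι x).2
  rw [← hab] at hW
  generalize hy : (pullback.fst (f ⁻¹ᵁ U.carrier).ι (f ⁻¹ᵁ W.carrier).ι ≫
    (f ⁻¹ᵁ U.carrier).ι) x = y at hU hW
  obtain ⟨T, hT, hTle⟩ := exists_framedOpens hV (z := f y) (U := U.carrier ⊓ W.carrier) ⟨hU, hW⟩
  refine ⟨T, hTle.trans inf_le_left, hTle.trans inf_le_right, ⟨y, hT⟩, ?_⟩
  apply (pullback.fst (f ⁻¹ᵁ U.carrier).ι (f ⁻¹ᵁ W.carrier).ι ≫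
    (f ⁻¹ᵁ U.carrier).ι).isOpenEmbedding.injective
  refine Eq.trans ?_ hy.symm
  refine (Scheme.Hom.comp_apply _ _ _).symm.trans ?_
  rw [pullback.lift_fst_assoc, Scheme.homOfLE_ι]
  rfl

instance (hV : IsVectorBundle V) : (preimageCover f hV).LocallyDirected where
  trans {U W} h := X.homOfLE (f.preimage_mono (FramedOpens.carrier_le (leOfHom h)))
  trans_id U := X.homOfLE_rfl _
  trans_comp {U W T} h h' := (X.homOfLE_homOfLE _ _).symm
  w {U W} h := X.homOfLE_ι _
  directed {U W} x := by
    obtain ⟨T, hU, hW, y, hy⟩ := preimageCover_directed f hV U W x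
    exact ⟨T, homOfLE hU, homOfLE hW, y, hy⟩
  property_trans {U W} h := by
    change IsOpenImmersion (X.homOfLE _)
    infer_instance

variable (s : Γ((Scheme.Modules.pullback f).obj V, ⊤))

/-- The function `φ(s)` on `f⁻¹(U)`, for a linear form `φ` on `V` over `U`. -/
def pairing {U : Z.Opens} {n : ℕ} {e : Fin n → Γ(V, U)} (he : IsFrame V e) :
    Module.Dual Γ(Z, U) Γ(V, U) →+ Γ(X, f ⁻¹ᵁ U) where
  toFun φ := ∑ i, f.app U (φ (e i)) * sectionCoord f s he i
  map_zero' := by simp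
  map_add' φ ψ := by simp [add_mul, Finset.sum_add_distrib]

lemma pairing_apply {U : Z.Opens} {n : ℕ} {e : Fin n → Γ(V, U)} (he : IsFrame V e)
    (φ : Module.Dual Γ(Z, U) Γ(V, U)) :
    pairing f s he φ = ∑ i, f.app U (φ (e i)) * sectionCoord f s he i := rfl

/-- Expanding the v j in the frame turns any expression of s into the one by its coordinates. This
freedom gives both the independence of the frame and the compatibility with restriction. -/
lemma pairing_eq_sum {U : Z.Opens} {n : ℕ} {e : Fin n → Γ(V, U)} (he : IsFrame V e)
    {m : ℕ} (v : Fin m → Γ(V, U)) (c : Fin m → Γ(X, f ⁻¹ᵁ U))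
    (h : ∑ j, c j • pullSection f V (v j) = res _ le_top s) (φ : Module.Dual Γ(Z, U) Γ(V, U)) :
    pairing f s he φ = ∑ j, f.app U (φ (v j)) * c j := by
  have hv (j) : v j = ∑ i, (he.basis U le_rfl).repr (v j) i • e i := by
    conv_lhs => rw [← he.basis_repr_smul le_rfl (v j)]
    simp only [res_self]
  have h1 := eq_sectionCoord f s he (a := fun i => ∑ j, c j * f.app U ((he.basis U le_rfl).repr (v j) i)) (by
    rw [← h]
    simp only [Finset.sum_smul]
    rw [Finset.sum_comm]
    refine Finset.sum_congr rfl fun j _ => ?_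
    conv_rhs => rw [hv j]
    rw [pullSection_sum, Finset.smul_sum]
    simp only [pullSection_smul, smul_smul])
  rw [pairing_apply, ← h1]
  simp only [Finset.mul_sum]
  rw [Finset.sum_comm]
  refine Finset.sum_congr rfl fun j _ => ?_
  conv_rhs => rw [hv j]
  rw [map_sum, map_sum, Finset.sum_mul]
  refine Finset.sum_congr rfl fun i _ => ?_
  rw [map_smul, smul_eq_mul, map_mul]
  ring

lemma pairing_eq_pairing {U : Z.Opens} {n m : ℕ} {e : Fin n → Γ(V, U)} (he : IsFrame V e)
    {e' : Fin m → Γ(V, U)} (he' : IsFrame V e') : pairing f s he = pairing f s he' := by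
  ext φ
  exact pairing_eq_sum f s he e' _ (sum_sectionCoord f s he') φ

lemma sectionCoord_res {U W : Z.Opens} (h : W ≤ U) {n : ℕ} {e : Fin n → Γ(V, U)}
    (he : IsFrame V e) :
    ∑ i, resO X (f.preimage_mono h) (sectionCoord f s he i) • pullSection f V (res V h (e i)) =
      res _ le_top s := by
  have h1 := congr(res _ (f.preimage_mono h) $(sum_sectionCoord f s he))
  rw [res_sum, res_res] at h1
  rw [← h1]
  refine Finset.sum_congr rfl fun i _ => ?_
  rw [res_smul, pullSection_res]

/-- The value of a function on `Tot(V)` at the section `s`. -/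
def evalSection (U : FramedOpens V) : FunctionRing V U.carrier →+* Γ(X, f ⁻¹ᵁ U.carrier) :=
  letI : Algebra Γ(Z, U.carrier) Γ(X, f ⁻¹ᵁ U.carrier) := (f.app U.carrier).hom.toAlgebra
  (SymmetricAlgebra.lift
    { toFun := pairing f s U.exists_frame.choose_spec.choose_spec
      map_add' := map_add _
      map_smul' := fun r φ => by
        rw [pairing_apply, pairing_apply, RingHom.id_apply, Algebra.smul_def, Finset.mul_sum]
        refine Finset.sum_congr rfl fun i _ => ?_
        rw [LinearMap.smul_apply, smul_eq_mul, map_mul, mul_assoc]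
        rfl } : FunctionRing V U.carrier →ₐ[Γ(Z, U.carrier)] _).toRingHom

lemma evalSection_algebraMap (U : FramedOpens V) (r : Γ(Z, U.carrier)) :
    evalSection f s U (algebraMap _ _ r) = f.app U.carrier r := by
  let : Algebra Γ(Z, U.carrier) Γ(X, f ⁻¹ᵁ U.carrier) := (f.app U.carrier).hom.toAlgebra
  exact AlgHom.commutes (R := Γ(Z, U.carrier)) _ r

lemma evalSection_ι (U : FramedOpens V) {n : ℕ} {e : Fin n → Γ(V, U.carrier)} (he : IsFrame V e)
    (φ : Module.Dual Γ(Z, U.carrier) Γ(V, U.carrier)) :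
    evalSection f s U (SymmetricAlgebra.ι _ _ φ) = pairing f s he φ := by
  let : Algebra Γ(Z, U.carrier) Γ(X, f ⁻¹ᵁ U.carrier) := (f.app U.carrier).hom.toAlgebra
  rw [pairing_eq_pairing f s he U.exists_frame.choose_spec.choose_spec]
  exact SymmetricAlgebra.lift_ι_apply _ _

lemma evalSection_functionRes {W U : FramedOpens V} (h : W ≤ U) :
    (evalSection f s W).comp (functionRes h) =
      (X.presheaf.map (homOfLE (f.preimage_mono (FramedOpens.carrier_le h))).op).hom.comp
        (evalSection f s U) := by
  refine functionRing_hom_ext (fun r => ?_) fun φ => ?_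
  · rw [RingHom.comp_apply, RingHom.comp_apply, functionRes_algebraMap, evalSection_algebraMap,
      evalSection_algebraMap]
    exact congr($(f.naturality (homOfLE (FramedOpens.carrier_le h)).op) r)
  · obtain ⟨n, e, he⟩ := U.exists_frame
    rw [RingHom.comp_apply, RingHom.comp_apply, functionRes_ι, evalSection_ι f s U he,
      evalSection_ι f s W (he.restrict (FramedOpens.carrier_le h)),
      pairing_eq_sum f s _ _ _ (sectionCoord_res f s (FramedOpens.carrier_le h) he),
      pairing_apply, map_sum]
    refine Finset.sum_congr rfl fun i _ => ?_
    rw [dualRes_apply, map_mul]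
    congr 1
    exact congr($(f.naturality (homOfLE (FramedOpens.carrier_le h)).op) (φ (e i)))

/-- The part over `U` of the morphism `X ⟶ Tot(V)` given by the section `s`. -/
def sectionMapOn (U : FramedOpens V) :
    (f ⁻¹ᵁ U.carrier).toScheme ⟶ Spec (.of (FunctionRing V U.carrier)) :=
  (f ⁻¹ᵁ U.carrier).toSpecΓ ≫ Spec.map (CommRingCat.ofHom (evalSection f s U))

variable {f} in
lemma functionRes_totalSpaceChart (hV : IsVectorBundle V) {W U : FramedOpens V} (h : W ≤ U) :
    Spec.map (CommRingCat.ofHom (functionRes h)) ≫ totalSpaceChart V hV U = totalSpaceChart V hV W :=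
  colimit.w (totalSpaceGluing V hV).functor (homOfLE h : (W : (framedCover V hV).I₀) ⟶ U)

lemma homOfLE_sectionMapOn {W U : FramedOpens V} (h : W ≤ U) :
    X.homOfLE (f.preimage_mono (FramedOpens.carrier_le h)) ≫ sectionMapOn f s U =
      sectionMapOn f s W ≫ Spec.map (CommRingCat.ofHom (functionRes h)) := by
  rw [sectionMapOn, sectionMapOn, ← Scheme.Opens.toSpecΓ_SpecMap_presheaf_map_assoc,
    Category.assoc, ← Spec.map_comp, ← Spec.map_comp, ← CommRingCat.ofHom_comp,
    evalSection_functionRes]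
  rfl

lemma homOfLE_sectionMapOn_totalSpaceChart (hV : IsVectorBundle V) {W U : FramedOpens V}
    (h : W ≤ U) :
    X.homOfLE (f.preimage_mono (FramedOpens.carrier_le h)) ≫ sectionMapOn f s U ≫
      totalSpaceChart V hV U = sectionMapOn f s W ≫ totalSpaceChart V hV W := by
  rw [← Category.assoc, homOfLE_sectionMapOn f s h, Category.assoc, functionRes_totalSpaceChart]

/-- The morphism `X ⟶ Tot(V)` over `Z` given by the section `s` of `f^* V`. -/
def sectionMap (hV : IsVectorBundle V) : X ⟶ totalSpace V hV :=
  (preimageCover f hV).glueMorphismsOfLocallyDirected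
    (fun U => sectionMapOn f s U ≫ totalSpaceChart V hV U) fun {W U} h => by
      exact homOfLE_sectionMapOn_totalSpaceChart f s hV (leOfHom h)

lemma ι_sectionMap (hV : IsVectorBundle V) (U : FramedOpens V) :
    (f ⁻¹ᵁ U.carrier).ι ≫ sectionMap f s hV = sectionMapOn f s U ≫ totalSpaceChart V hV U :=
  (preimageCover f hV).map_glueMorphismsOfLocallyDirected
    (fun U => sectionMapOn f s U ≫ totalSpaceChart V hV U)
    (fun h => homOfLE_sectionMapOn_totalSpaceChart f s hV (leOfHom h)) U

lemma isPullback_totalSpaceChart (hV : IsVectorBundle V) (U : FramedOpens V) :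
    IsPullback (Spec.map (CommRingCat.ofHom (algebraMap Γ(Z, U.carrier) (FunctionRing V U.carrier))))
      (totalSpaceChart V hV U) U.isAffineOpen.fromSpec (totalSpaceProj V hV) :=
  (totalSpaceGluing V hV).isPullback_natTrans_ι_toBase U

lemma ι_sectionMap_totalSpaceProj (hV : IsVectorBundle V) (U : FramedOpens V) :
    (f ⁻¹ᵁ U.carrier).ι ≫ sectionMap f s hV ≫ totalSpaceProj V hV = (f ⁻¹ᵁ U.carrier).ι ≫ f := by
  rw [← Category.assoc, ι_sectionMap, Category.assoc, ← (isPullback_totalSpaceChart hV U).w,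
    sectionMapOn, Category.assoc, ← Spec.map_comp_assoc]
  have : CommRingCat.ofHom (algebraMap Γ(Z, U.carrier) (FunctionRing V U.carrier)) ≫
      CommRingCat.ofHom (evalSection f s U) = f.app U.carrier := by
    ext r
    exact evalSection_algebraMap f s U r
  rw [this]
  simp

lemma sectionMap_totalSpaceProj (hV : IsVectorBundle V) :
    sectionMap f s hV ≫ totalSpaceProj V hV = f :=
  (preimageCover f hV).hom_ext _ _ fun U => ι_sectionMap_totalSpaceProj f s hV U

instance (hV : IsVectorBundle V) (U : FramedOpens V) : IsOpenImmersion (totalSpaceChart V hV U) :=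
  MorphismProperty.of_isPullback (P := @IsOpenImmersion)
    (isPullback_totalSpaceChart hV U) U.isAffineOpen.isOpenImmersion_fromSpec

/-- Pasting of squares: the chart is cartesian over the inclusion of U in Z, and the outer square is
cartesian because the section map lies over Z. It lets the kernel of the section map be computed
chart by chart. -/
lemma isPullback_sectionMap (hV : IsVectorBundle V) (U : FramedOpens V) :
    IsPullback (sectionMapOn f s U) (f ⁻¹ᵁ U.carrier).ι (totalSpaceChart V hV U)
      (sectionMap f s hV) := by
  refine (IsPullback.of_bot ?_ (ι_sectionMap f s hV U)
    (isPullback_totalSpaceChart hV U).flip).flip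
  rw [sectionMap_totalSpaceProj]
  refine (isPullback_morphismRestrict f U.carrier).flip.of_iso (Iso.refl _) (Iso.refl _)
    U.isAffineOpen.isoSpec (Iso.refl _) ?_ ?_ ?_ ?_
  · simp
  · rw [← cancel_mono U.isAffineOpen.fromSpec]
    simp only [Iso.refl_hom, Category.id_comp, Category.assoc, IsAffineOpen.isoSpec_hom_fromSpec,
      morphismRestrict_ι]
    rw [(isPullback_totalSpaceChart hV U).w, ← reassoc_of% ι_sectionMap,
      ι_sectionMap_totalSpaceProj]
  · simp
  · simp

end SectionMap

/-! ### Torsion-free quasi-coherent sheaves have no sections supported on a proper closed subset -/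

section TorsionFree

open PrimeSpectrum in
lemma isLocalizedModule_res {R : CommRingCat.{u}} (M : (Spec R).Modules) [M.IsQuasicoherent] (r : R) :
    IsLocalizedModule (.powers r)
      ((modulesSpecToSheaf.obj M).obj.map (basicOpen r).leTop.op).hom :=
  (isIso_fromTildeΓ_iff_isLocalizing M).mp inferInstance r

lemma subsingleton_of_isLocalizedModule {R E F : Type*} [CommRing R] [AddCommGroup E] [Module R E]
    [AddCommGroup F] [Module R F] (S : Submonoid R) (φ : E →ₗ[R] F) [IsLocalizedModule S φ]
    (h : Subsingleton E) : Subsingleton F := by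
  have h0 (a : F) : a = 0 := by
    obtain ⟨⟨m, s⟩, hm⟩ := IsLocalizedModule.surj S φ a
    refine ((Module.End.isUnit_iff _).mp (IsLocalizedModule.map_units φ s)).injective ?_
    refine hm.trans ?_
    rw [h.elim m 0, map_zero, map_zero]
  exact ⟨fun a b => (h0 a).trans (h0 b).symm⟩

/-- A basic open of the spectrum of a ring. -/
abbrev specBasicOpen {R : CommRingCat.{u}} (r : R) : (Spec R).Opens := PrimeSpectrum.basicOpen r

lemma subsingleton_of_subsingleton_top {R : CommRingCat.{u}} (M : (Spec R).Modules)
    [M.IsQuasicoherent] (h : Subsingleton Γ(M, ⊤)) (r : R) : Subsingleton Γ(M, specBasicOpen r) :=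
  @subsingleton_of_isLocalizedModule R _ _ _ _ _ _ _ (.powers r) _ (isLocalizedModule_res M r) h

lemma exists_pow_smul_eq_zero {R : CommRingCat.{u}} (M : (Spec R).Modules)
    [M.IsQuasicoherent] (r : R) (m : Γ(M, ⊤)) (h : res M (le_top (a := specBasicOpen r)) m = 0) :
    ∃ k : ℕ, r ^ k • m = 0 := by
  have := isLocalizedModule_res M r
  obtain ⟨⟨_, k, rfl⟩, hk⟩ := (IsLocalizedModule.eq_zero_iff (.powers r)
    ((modulesSpecToSheaf.obj M).obj.map (PrimeSpectrum.basicOpen r).leTop.op).hom).mp h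
  exact ⟨k, hk⟩

lemma IsTorsionFreeSheaf.restrict {X Y : Scheme.{u}} (j : X ⟶ Y) [IsOpenImmersion j] {M : Y.Modules}
    (hM : IsTorsionFreeSheaf M) : IsTorsionFreeSheaf (M.restrict j) := by
  intro U r m h
  have h1 := congr((M.restrictAppIso j U).hom $h)
  rw [Scheme.Modules.smul_restrictAppIso_hom_apply, map_zero] at h1
  rcases hM _ _ _ h1 with h2 | h2
  · left
    exact (map_eq_zero_iff _ (ConcreteCategory.bijective_of_isIso (j.appIso U).inv).injective).mp h2
  · right
    exact (map_eq_zero_iff _ (ConcreteCategory.bijective_of_isIso (M.restrictAppIso j U).hom).injective).mp h2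

/-- The open contains some D(r) with r ≠ 0, and a section that vanishes on D(r) is killed by a power
of r. -/
lemma IsTorsionFreeSheaf.res_injective_top {R : CommRingCat.{u}} {M : (Spec R).Modules}
    [M.IsQuasicoherent] (hM : IsTorsionFreeSheaf M) [IsDomain R] {W : (Spec R).Opens}
    (hW : (W : Set (Spec R)).Nonempty) (m : Γ(M, ⊤)) (h : res M (le_top (a := W)) m = 0) : m = 0 := by
  obtain ⟨x, hx⟩ := hW
  obtain ⟨_, ⟨_, ⟨r, rfl⟩, rfl⟩, hxr, hr⟩ :=
    PrimeSpectrum.isBasis_basic_opens.exists_subset_of_mem_open hx W.2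
  have hle : specBasicOpen r ≤ W := hr
  obtain ⟨k, hk⟩ := exists_pow_smul_eq_zero M r m
    ((res_res M le_top hle m).symm.trans ((congrArg _ h).trans (map_zero _)))
  rw [Scheme.Modules.smul_Spec_def] at hk
  refine (hM _ _ _ hk).resolve_left fun h0 => ?_
  have h1 := congr((Scheme.ΓSpecIso R).hom $h0)
  have h2 : (Spec R).presheaf.map (Opens.leTop (⊤ : (Spec R).Opens)).op = 𝟙 _ :=
    (Spec R).presheaf.map_id _
  rw [h2, map_zero] at h1
  replace h1 : r ^ k = 0 := by simpa using h1
  have h3 : r ∉ x.asIdeal := hxr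
  exact h3 (eq_zero_of_pow_eq_zero h1 ▸ x.asIdeal.zero_mem)

/-- If M had no nonzero sections over U, it would have none over the basic opens of U. By
irreducibility such a basic open can be found inside any nonempty affine W', and `res_injective_top`
then kills all sections over W'. So M would be zero. -/
lemma IsTorsionFreeSheaf.nontrivial {X : Scheme.{u}} [IsIntegral X] {M : X.Modules}
    [M.IsQuasicoherent] (hM : IsTorsionFreeSheaf M) (h0 : ¬ IsZero M) {U : X.Opens}
    (hU : IsAffineOpen U) [Nonempty U] : Nontrivial Γ(M, U) := by
  by_contra hn
  rw [not_nontrivial_iff_subsingleton] at hn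
  refine h0 ((IsZero.iff_id_eq_zero M).mpr ?_)
  ext W m
  refine eq_of_locally_eq (M := M) m 0 fun x hx => ?_
  obtain ⟨_, ⟨W', hW', rfl⟩, hxW, hWW⟩ := X.isBasis_affineOpens.exists_subset_of_mem_open hx W.2
  have hle : W' ≤ W := hWW
  replace hW' : IsAffineOpen W' := hW'
  refine ⟨W', hle, hxW, ?_⟩
  generalize hm' : res M hle m = m'
  refine Eq.trans ?_ (map_zero _).symm
  clear hm'
  obtain ⟨y, hyU, hyW⟩ := nonempty_preirreducible_inter U.2 W'.2 (by simpa using ‹Nonempty U›) ⟨x, hxW⟩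
  obtain ⟨y, rfl⟩ : y ∈ Set.range hU.fromSpec := by rwa [hU.range_fromSpec]
  obtain ⟨_, ⟨_, ⟨r, rfl⟩, rfl⟩, hyr, hr⟩ :=
    PrimeSpectrum.isBasis_basic_opens.exists_subset_of_mem_open
      (show y ∈ hU.fromSpec ⁻¹ᵁ W' from hyW) (hU.fromSpec ⁻¹ᵁ W').2
  have hs := subsingleton_of_subsingleton_top (M.restrict hU.fromSpec) (by
    change Subsingleton Γ(M, hU.fromSpec ''ᵁ ⊤)
    rwa [Scheme.Hom.image_top_eq_opensRange, hU.opensRange_fromSpec]) r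
  change Subsingleton Γ(M, hU.fromSpec ''ᵁ specBasicOpen r) at hs
  have hD : hU.fromSpec ''ᵁ specBasicOpen r ≤ W' := by
    rintro _ ⟨z, hz, rfl⟩
    exact hr hz
  have hyD : hU.fromSpec y ∈ hU.fromSpec ''ᵁ specBasicOpen r := ⟨y, hyr, rfl⟩
  generalize hU.fromSpec ''ᵁ specBasicOpen r = D at *
  have hW'' : hW'.fromSpec ''ᵁ ⊤ = W' := by
    rw [Scheme.Hom.image_top_eq_opensRange, hW'.opensRange_fromSpec]
  have : Nonempty W' := ⟨x, hxW⟩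
  have h2 := (hM.restrict hW'.fromSpec).res_injective_top (W := hW'.fromSpec ⁻¹ᵁ D)
    (by
      obtain ⟨z, hz⟩ : hU.fromSpec y ∈ Set.range hW'.fromSpec := by rwa [hW'.range_fromSpec]
      exact ⟨z, by simpa [hz] using hyD⟩) (res M hW''.le m') (by
      have hs' : Subsingleton Γ(M, hW'.fromSpec ''ᵁ hW'.fromSpec ⁻¹ᵁ D) := by
        rwa [Scheme.Hom.image_preimage_eq_opensRange_inf, hW'.opensRange_fromSpec,
          inf_eq_right.mpr hD]
      exact hs'.elim _ _)
  rw [← res_self M m', ← res_res M hW''.le hW''.ge]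
  exact (congrArg _ h2).trans (map_zero _)

end TorsionFree

/-! ### The spectral ideal over a framed affine open -/

section SpectralIdeal

variable {Z : Scheme.{u}} {V : Z.Modules}

/-- The map from polynomials in the coordinates of a frame to functions on the total space. -/
def frameEval {U : Z.Opens} {n : ℕ} {e : Fin n → Γ(V, U)} (he : IsFrame V e) :
    MvPolynomial (Fin n) Γ(Z, U) →ₐ[Γ(Z, U)] FunctionRing V U :=
  MvPolynomial.aeval fun i => SymmetricAlgebra.ι Γ(Z, U) (Module.Dual Γ(Z, U) Γ(V, U))
    ((he.basis U le_rfl).coord i)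

lemma frameEval_X {U : Z.Opens} {n : ℕ} {e : Fin n → Γ(V, U)} (he : IsFrame V e) (i : Fin n) :
    frameEval he (.X i) = SymmetricAlgebra.ι _ _ ((he.basis U le_rfl).coord i) :=
  MvPolynomial.aeval_X _ _

lemma frameEval_surjective {U : Z.Opens} {n : ℕ} {e : Fin n → Γ(V, U)} (he : IsFrame V e) :
    Function.Surjective (frameEval he) := by
  intro x
  rw [← AlgHom.mem_range]
  induction x using SymmetricAlgebra.induction with
  | algebraMap r => exact algebraMap_mem _ r
  | ι φ =>
    obtain ⟨c, rfl⟩ := (he.basis U le_rfl).dualBasis.equivFun.symm.surjective φ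
    rw [Module.Basis.equivFun_symm_apply, map_sum]
    refine sum_mem fun i _ => ?_
    rw [map_smul, congrFun (he.basis U le_rfl).coe_dualBasis i]
    exact Subalgebra.smul_mem _ ((AlgHom.mem_range _).mpr ⟨.X i, frameEval_X he i⟩) _
  | mul a b ha hb => exact mul_mem ha hb
  | add a b ha hb => exact add_mem ha hb

lemma spectralIdeal_eq_map {E : Z.Modules} {U : Z.Opens} {n : ℕ} {e : Fin n → Γ(V, U)}
    (he : IsFrame V e) (A : Fin n → Module.End Γ(Z, U) Γ(E, U)) :
    spectralIdeal he A = (charIdeal A).map (frameEval he) := by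
  rw [spectralIdeal, charIdeal, Ideal.map_span]
  congr 1
  ext g
  constructor
  · rintro ⟨c, d, h, rfl⟩
    exact ⟨c, ⟨d, h⟩, rfl⟩
  · rintro ⟨c, ⟨d, h⟩, rfl⟩
    exact ⟨c, d, h, rfl⟩

variable {X : Scheme.{u}} (f : X ⟶ Z) (s : Γ((Scheme.Modules.pullback f).obj V, ⊤))

lemma pairing_coord {U : Z.Opens} {n : ℕ} {e : Fin n → Γ(V, U)} (he : IsFrame V e) (i : Fin n) :
    pairing f s he ((he.basis U le_rfl).coord i) = sectionCoord f s he i := by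
  have h (j) : e j = he.basis U le_rfl j := by
    rw [he.basis_apply]
    exact (res_self V (e j)).symm
  rw [pairing_apply, Finset.sum_eq_single i]
  · rw [h i]
    simp
  · intro j _ hj
    rw [h j]
    simp [hj]
  · simp

/-- Both sides are ring homomorphisms, so constants and variables suffice. This is the bridge from
functions on the total space to the polynomial algebra of the pencil. -/
lemma evalSection_frameEval (U : FramedOpens V) {n : ℕ} {e : Fin n → Γ(V, U.carrier)}
    (he : IsFrame V e) (c : MvPolynomial (Fin n) Γ(Z, U.carrier)) :
    evalSection f s U (frameEval he c) =
      MvPolynomial.eval₂ (f.app U.carrier).hom (sectionCoord f s he) c := by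
  have : (evalSection f s U).comp (frameEval he : _ →+* FunctionRing V U.carrier) =
      MvPolynomial.eval₂Hom (f.app U.carrier).hom (sectionCoord f s he) := by
    refine MvPolynomial.ringHom_ext (fun r => ?_) fun i => ?_
    · rw [RingHom.comp_apply, MvPolynomial.coe_eval₂Hom, MvPolynomial.eval₂_C]
      refine Eq.trans ?_ (evalSection_algebraMap f s U r)
      exact congrArg _ ((frameEval he).commutes r)
    · rw [RingHom.comp_apply, MvPolynomial.coe_eval₂Hom, MvPolynomial.eval₂_X]
      exact (congrArg _ (frameEval_X he i)).trans
        ((evalSection_ι f s U he _).trans (pairing_coord f s he i))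
  exact congr($this c)

instance (N : X.Modules) (U : Z.Opens) :
    Module Γ(X, f ⁻¹ᵁ U) Γ((Scheme.Modules.pushforward f).obj N, U) :=
  inferInstanceAs (Module Γ(X, f ⁻¹ᵁ U) Γ(N, f ⁻¹ᵁ U))

/-- The geometric hypotheses are translated for the pencil: f finite makes B finite over R, f
surjective onto an integral scheme makes R embed in B, and torsion-freeness with M ≠ 0 makes E
torsion-free and nonzero over B. -/
lemma charIdeal_mulEnd [IsIntegral X] [IsIntegral Z] [IsFinite f] [Surjective f]
    {N : X.Modules} (hN : IsCoherentSheaf N) (htf : IsTorsionFreeSheaf N) (h0 : ¬ IsZero N)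
    {U : Z.Opens} (hU : IsAffineOpen U) [Nonempty U] [IsIntegrallyClosed Γ(Z, U)]
    [CharZero Γ(Z, U)] {n : ℕ} (c : Fin n → Γ(X, f ⁻¹ᵁ U)) :
    charIdeal (fun i => mulEnd f N (c i)) ≤
        RingHom.ker (MvPolynomial.eval₂Hom (f.app U).hom c) ∧
      RingHom.ker (MvPolynomial.eval₂Hom (f.app U).hom c) ≤
        (charIdeal fun i => mulEnd f N (c i)).radical := by
  have : N.IsQuasicoherent := hN.1
  have : Nonempty (f ⁻¹ᵁ U) := by
    obtain ⟨z, hz⟩ := ‹Nonempty U›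
    obtain ⟨x, rfl⟩ := f.surjective z
    exact ⟨x, hz⟩
  have hfU : IsAffineOpen (f ⁻¹ᵁ U) := hU.preimage f
  have : IsSchemeTheoreticallyDominant f := .of_isDominant f
  let _ : Algebra Γ(Z, U) Γ(X, f ⁻¹ᵁ U) := (f.app U).hom.toAlgebra
  have : FaithfulSMul Γ(Z, U) Γ(X, f ⁻¹ᵁ U) :=
    (faithfulSMul_iff_algebraMap_injective _ _).mpr (f.app_injective U)
  have : Module.Finite Γ(Z, U) Γ(X, f ⁻¹ᵁ U) := IsFinite.finite_app f U hU
  have : IsScalarTower Γ(Z, U) Γ(X, f ⁻¹ᵁ U) Γ((Scheme.Modules.pushforward f).obj N, U) :=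
    .of_algebraMap_smul fun _ _ => rfl
  have : Module.Finite Γ(X, f ⁻¹ᵁ U) Γ((Scheme.Modules.pushforward f).obj N, U) := hN.2 _ hfU
  have : Module.Finite Γ(Z, U) Γ((Scheme.Modules.pushforward f).obj N, U) :=
    .trans Γ(X, f ⁻¹ᵁ U) _
  have : Nontrivial Γ((Scheme.Modules.pushforward f).obj N, U) := htf.nontrivial h0 hfU
  exact ⟨charIdeal_le_ker (B := Γ(X, f ⁻¹ᵁ U))
      (E := Γ((Scheme.Modules.pushforward f).obj N, U)) (htf (f ⁻¹ᵁ U)) _ c fun _ _ => rfl,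
    ker_le_radical_charIdeal (B := Γ(X, f ⁻¹ᵁ U))
      (E := Γ((Scheme.Modules.pushforward f).obj N, U)) (htf (f ⁻¹ᵁ U)) _ c fun _ _ => rfl⟩

/-- All affine opens of `Z` have integrally closed coordinate rings of characteristic zero. -/
def IsNormalOfCharZero (Z : Scheme.{u}) : Prop :=
  ∀ U : Z.Opens, IsAffineOpen U → Nonempty U → IsIntegrallyClosed Γ(Z, U) ∧ CharZero Γ(Z, U)

lemma spectralIdeal_mulEnd [IsIntegral X] [IsIntegral Z] (hZ : IsNormalOfCharZero Z)
    [IsFinite f] [Surjective f]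
    {N : X.Modules} (hN : IsCoherentSheaf N) (htf : IsTorsionFreeSheaf N) (h0 : ¬ IsZero N)
    (U : FramedOpens V) {n : ℕ} {e : Fin n → Γ(V, U.carrier)} (he : IsFrame V e) :
    spectralIdeal he (fun i => mulEnd f N (sectionCoord f s he i)) ≤
        RingHom.ker (evalSection f s U) ∧
      RingHom.ker (evalSection f s U) ≤
        (spectralIdeal he fun i => mulEnd f N (sectionCoord f s he i)).radical := by
  rcases isEmpty_or_nonempty U.carrier with hU | hU
  -- Over the empty open the ring is zero, not a domain, so the algebra of the pencil does not
  -- apply; but then all ideals coincide.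
  · have : Subsingleton Γ(Z, U.carrier) := by
      have : U.carrier = ⊥ := Opens.ext (Set.isEmpty_coe_sort.mp hU)
      rw [this]
      infer_instance
    have : Subsingleton (FunctionRing V U.carrier) :=
      Module.subsingleton Γ(Z, U.carrier) _
    exact ⟨fun x _ => by rw [Subsingleton.elim x 0]; exact zero_mem _,
      fun x _ => by rw [Subsingleton.elim x 0]; exact zero_mem _⟩
  · obtain ⟨h1, h2⟩ := hZ U.carrier U.isAffineOpen hU
    obtain ⟨h3, h4⟩ := charIdeal_mulEnd f hN htf h0 U.isAffineOpen (sectionCoord f s he)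
    rw [spectralIdeal_eq_map]
    refine ⟨Ideal.map_le_iff_le_comap.mpr fun c hc => ?_, fun x hx => ?_⟩
    · exact (evalSection_frameEval f s U he c).trans (h3 hc)
    · obtain ⟨c, rfl⟩ := frameEval_surjective he x
      obtain ⟨k, hk⟩ := h4 ((evalSection_frameEval f s U he c).symm.trans hx)
      refine ⟨k, ?_⟩
      rw [← map_pow]
      exact Ideal.mem_map_of_mem _ hk

end SpectralIdeal

/-! ### Comparison of the spectral ideal sheaf with the kernel of the section map -/

section SpectralCover

variable {Z : Scheme.{u}} {V : Z.Modules} (hV : IsVectorBundle V)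

lemma totalSpaceProj_preimage (U : FramedOpens V) :
    totalSpaceProj V hV ⁻¹ᵁ U.carrier = (totalSpaceChart V hV U).opensRange := by
  ext x
  constructor
  · intro hx
    obtain ⟨y, hy⟩ : totalSpaceProj V hV x ∈ Set.range U.isAffineOpen.fromSpec := by
      rw [U.isAffineOpen.range_fromSpec]
      exact hx
    obtain ⟨z, -, hz⟩ := Scheme.exists_preimage_of_isPullback (isPullback_totalSpaceChart hV U) y x hy
    exact ⟨z, hz⟩
  · rintro ⟨z, rfl⟩
    have h : totalSpaceProj V hV (totalSpaceChart V hV U z) ∈ Set.range U.isAffineOpen.fromSpec :=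
      ⟨_, congr($((isPullback_totalSpaceChart hV U).w) z)⟩
    rw [U.isAffineOpen.range_fromSpec] at h
    exact h

instance : IsAffineHom (totalSpaceProj V hV) := by
  refine isAffineHom_of_forall_exists_isAffineOpen _ fun z => ?_
  obtain ⟨U, hz, -⟩ := exists_framedOpens hV (z := z) (U := ⊤) trivial
  refine ⟨U.carrier, hz, U.isAffineOpen, ?_⟩
  rw [totalSpaceProj_preimage]
  exact isAffineOpen_opensRange _

lemma comap_ker_of_isPullback {X Y U W : Scheme.{u}} {f : X ⟶ Y} {f' : U ⟶ W} {iU : U ⟶ X}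
    {iW : W ⟶ Y} [IsOpenImmersion iW] [QuasiCompact f] (H : IsPullback f' iU iW f) :
    f.ker.comap iW = f'.ker := by
  ext T : 2
  rw [Scheme.IdealSheafData.ideal_comap_of_isOpenImmersion,
    Scheme.ker_ideal_of_isPullback_of_isOpenImmersion _ _ _ _ H]

variable {X : Scheme.{u}} (f : X ⟶ Z) (s : Γ((Scheme.Modules.pullback f).obj V, ⊤))

lemma map_inv_eq_comap_hom {R S : CommRingCat.{u}} (e : R ≅ S) (I : Ideal S) :
    I.map e.inv.hom = I.comap e.hom.hom :=
  Ideal.map_symm e.commRingCatIsoToRingEquiv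

lemma pow_le_of_comap {A B : Type*} [CommRing A] [CommRing B] {φ : A →+* B}
    (hφ : Function.Surjective φ) {K I : Ideal A} {L J : Ideal B} (hL : L.comap φ = K)
    (hJ : I ≤ J.comap φ) {k : ℕ} (h : K ^ k ≤ I) : L ^ k ≤ J := by
  rw [← Ideal.map_comap_of_surjective φ hφ L, ← Ideal.map_pow, Ideal.map_le_iff_le_comap, hL]
  exact h.trans hJ

/-- An inequality of ideals on an affine chart is carried to the image of the chart by the
isomorphism of rings of sections, which in particular is surjective. -/
lemma ideal_pow_le_of_comap {S T : Scheme.{u}} [IsAffine S] (j : S ⟶ T) [IsOpenImmersion j]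
    {L J : T.IdealSheafData} {K I : Ideal Γ(S, ⊤)}
    (hL : L.comap j = Scheme.IdealSheafData.ofIdealTop K)
    (hJ : Scheme.IdealSheafData.ofIdealTop I ≤ J.comap j) {k : ℕ} (h : K ^ k ≤ I) :
    (L ^ k).ideal ⟨j ''ᵁ ⊤, (isAffineOpen_top S).image_of_isOpenImmersion j⟩ ≤
      J.ideal ⟨j ''ᵁ ⊤, (isAffineOpen_top S).image_of_isOpenImmersion j⟩ := by
  have h1 := hJ ⟨⊤, isAffineOpen_top S⟩
  have h2 := congr($(hL).ideal ⟨⊤, isAffineOpen_top S⟩)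
  rw [Scheme.IdealSheafData.ideal_comap_of_isOpenImmersion] at h1 h2
  rw [Scheme.IdealSheafData.ideal_pow]
  refine pow_le_of_comap (ConcreteCategory.bijective_of_isIso (j.appIso ⊤).inv).surjective h2 h1 ?_
  rw [Scheme.IdealSheafData.ofIdealTop_ideal, Scheme.IdealSheafData.ofIdealTop_ideal,
    ← Ideal.map_pow]
  exact Ideal.map_mono h

lemma sectionMapOn_appTop (U : FramedOpens V) :
    (sectionMapOn f s U).appTop = (Scheme.ΓSpecIso (.of (FunctionRing V U.carrier))).hom ≫
      CommRingCat.ofHom (evalSection f s U) ≫ (f ⁻¹ᵁ U.carrier).topIso.inv := by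
  rw [sectionMapOn, Scheme.Hom.comp_appTop, Scheme.Opens.toSpecΓ_appTop,
    Scheme.ΓSpecIso_naturality_assoc]

lemma ker_comp_of_isIso {A B C D : CommRingCat.{u}} (a : A ⟶ B) (b : B ⟶ C) (c : C ⟶ D)
    [IsIso c] : RingHom.ker (a ≫ b ≫ c).hom = (RingHom.ker b.hom).comap a.hom := by
  ext x
  exact map_eq_zero_iff _ (ConcreteCategory.bijective_of_isIso c).injective

lemma ker_sectionMapOn (U : FramedOpens V) :
    (sectionMapOn f s U).ker = Scheme.IdealSheafData.ofIdealTop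
      ((RingHom.ker (evalSection f s U)).map
        (Scheme.ΓSpecIso (.of (FunctionRing V U.carrier))).inv.hom) := by
  rw [Scheme.ker_of_isAffine, map_inv_eq_comap_hom, sectionMapOn_appTop, ker_comp_of_isIso]
  rfl

instance [IsFinite f] : IsFinite (sectionMap f s hV) := by
  have : IsFinite (sectionMap f s hV ≫ totalSpaceProj V hV) := by
    rwa [sectionMap_totalSpaceProj]
  exact IsFinite.of_comp _ (totalSpaceProj V hV)

instance [IsLocallyNoetherian Z] (U : FramedOpens V) :
    IsNoetherianRing (FunctionRing V U.carrier) := by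
  have := IsLocallyNoetherian.component_noetherian ⟨U.carrier, U.isAffineOpen⟩
  obtain ⟨n, e, he⟩ := U.exists_frame
  exact isNoetherianRing_of_surjective _ _ (frameEval he).toRingHom
    (frameEval_surjective he)

lemma comap_ker_sectionMap [IsFinite f] (U : FramedOpens V) :
    (sectionMap f s hV).ker.comap (totalSpaceChart V hV U) = Scheme.IdealSheafData.ofIdealTop
      ((RingHom.ker (evalSection f s U)).map
        (Scheme.ΓSpecIso (.of (FunctionRing V U.carrier))).inv.hom) := by
  rw [comap_ker_of_isPullback (isPullback_sectionMap f s hV U), ker_sectionMapOn]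

variable [IsIntegral X] [IsIntegral Z] [IsFinite f] [Surjective f] {N : X.Modules}
  {Φ : (Scheme.Modules.pushforward f).obj N ⟶ tensor ((Scheme.Modules.pushforward f).obj N) V}

/-- The spectral ideal sheaf is an infimum, so the kernel only has to satisfy the defining condition
on every chart, where it is the kernel of evaluation at s. -/
lemma spectralIdealSheaf_le_ker (hZ : IsNormalOfCharZero Z) (hN : IsCoherentSheaf N)
    (htf : IsTorsionFreeSheaf N) (h0 : ¬ IsZero N) (hΦ : IsPushforwardHiggs f N V s Φ) :
    spectralIdealSheaf hV Φ ≤ (sectionMap f s hV).ker := by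
  refine sInf_le fun U n e he A hA => ?_
  rw [comap_ker_sectionMap, hΦ.coordinates_eq he hA]
  refine Scheme.IdealSheafData.le_of_isAffine ?_
  simp only [Scheme.IdealSheafData.ofIdealTop_ideal]
  exact Ideal.map_mono (Ideal.map_mono (spectralIdeal_mulEnd f s hZ hN htf h0 U he).1)

/-- On a noetherian chart, inclusion in the radical means that some power is included. Compactness
of Z leaves finitely many charts. -/
lemma exists_ker_pow_le_spectralIdealSheaf [IsLocallyNoetherian Z] [CompactSpace Z]
    (hZ : IsNormalOfCharZero Z) (hN : IsCoherentSheaf N) (htf : IsTorsionFreeSheaf N)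
    (h0 : ¬ IsZero N) (hΦ : IsPushforwardHiggs f N V s Φ) :
    ∃ k : ℕ, (sectionMap f s hV).ker ^ k ≤ spectralIdealSheaf hV Φ := by
  have hU (z : Z) := exists_framedOpens hV (z := z) (U := ⊤) trivial
  choose U hzU _ using hU
  obtain ⟨t, ht⟩ := isCompact_univ.elim_finite_subcover (fun z => (U z).carrier.1)
    (fun z => (U z).carrier.2) fun z _ => Set.mem_iUnion.mpr ⟨z, hzU z⟩
  have hk (z : Z) : ∃ k : ℕ, RingHom.ker (evalSection f s (U z)) ^ k ≤ 
      spectralIdeal (U z).exists_frame.choose_spec.choose_spec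
        (fun i => mulEnd f N (sectionCoord f s (U z).exists_frame.choose_spec.choose_spec i)) :=
    Ideal.exists_pow_le_of_le_radical_of_fg
      (spectralIdeal_mulEnd f s hZ hN htf h0 (U z) _).2 (IsNoetherian.noetherian _)
  choose k hk using hk
  -- The largest of the finitely many exponents works on all the charts at once.
  refine ⟨t.sup k, le_sInf fun J hJ => ?_⟩
  refine Scheme.IdealSheafData.le_of_iSup_eq_top (ι := t)
    (fun z => ⟨totalSpaceChart V hV (U z.1) ''ᵁ ⊤,
      (isAffineOpen_top _).image_of_isOpenImmersion _⟩) ?_ fun z => ?_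
  · rw [← top_le_iff]
    intro x _
    obtain ⟨z, hz, hx⟩ := Set.mem_iUnion₂.mp (ht (Set.mem_univ (totalSpaceProj V hV x)))
    refine Opens.mem_iSup.mpr ⟨⟨z, hz⟩, ?_⟩
    rw [← SetLike.mem_coe]
    change x ∈ totalSpaceChart V hV (U z) ''ᵁ ⊤
    rw [Scheme.Hom.image_top_eq_opensRange, ← totalSpaceProj_preimage]
    exact hx
  · refine ideal_pow_le_of_comap _ (comap_ker_sectionMap hV f s (U z.1)) (hJ (U z.1) _ _
      (U z.1).exists_frame.choose_spec.choose_spec _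
      (hΦ.isCoordinates (U z.1).exists_frame.choose_spec.choose_spec)) ?_
    rw [← Ideal.map_pow]
    exact Ideal.map_mono ((Ideal.pow_le_pow_right (Finset.le_sup z.2)).trans (hk z.1))

end SpectralCover

/-! ### Integral birational morphisms to normal schemes -/

section Birational

variable {X : Scheme.{u}} [IsIntegral X]

variable (X) in
/-- The inclusion of the generic point of an integral scheme. -/
abbrev genericInclusion : Spec (X.residueField (genericPoint X)) ⟶ X :=
  X.fromSpecResidueField (genericPoint X)

instance : IsIso (X.residue (genericPoint X)) := by
  refine (ConcreteCategory.isIso_iff_bijective _).mpr ⟨?_, X.residue_surjective _⟩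
  exact RingHom.injective (R := X.functionField) (X.residue (genericPoint X)).hom

/-- The inclusion factors through the spectrum of the local ring at the generic point, which is
already the function field, so that only isomorphisms follow the germ map. -/
lemma exists_genericInclusion_app {U : X.Opens} [hU : Nonempty U] :
    ∃ ρ : X.functionField ⟶ Γ(Spec (X.residueField (genericPoint X)), genericInclusion X ⁻¹ᵁ U),
      IsIso ρ ∧ (genericInclusion X).app U = X.germToFunctionField U ≫ ρ := by
  have hη : genericPoint X ∈ U :=
    ((genericPoint_spec X).mem_open_set_iff U.isOpen).mpr (by simpa using hU)
  have htop : X.fromSpecStalk (genericPoint X) ⁻¹ᵁ U = ⊤ := by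
    rw [← top_le_iff]
    intro x _
    have : x = IsLocalRing.closedPoint _ := Subsingleton.elim (α := PrimeSpectrum X.functionField) _ _
    rw [this]
    change X.fromSpecStalk (genericPoint X) _ ∈ U
    rwa [Scheme.fromSpecStalk_closedPoint]
  refine ⟨(Scheme.ΓSpecIso X.functionField).inv ≫
    (Spec X.functionField).presheaf.map (homOfLE le_top).op ≫
      (Spec.map (X.residue (genericPoint X))).app (X.fromSpecStalk (genericPoint X) ⁻¹ᵁ U), ?_, ?_⟩
  · have : IsIso (homOfLE (le_top (a := X.fromSpecStalk (genericPoint X) ⁻¹ᵁ U))) :=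
      ⟨homOfLE htop.ge, rfl, rfl⟩
    have : IsIso ((Spec.map (X.residue (genericPoint X))).app
      (X.fromSpecStalk (genericPoint X) ⁻¹ᵁ U)) := inferInstance
    exact @IsIso.comp_isIso _ _ _ _ _ _ _ inferInstance
      (@IsIso.comp_isIso _ _ _ _ _ _ _ inferInstance this)
  · refine (Scheme.Hom.comp_app (Spec.map (X.residue (genericPoint X)))
      (X.fromSpecStalk (genericPoint X)) U).trans ?_
    rw [Scheme.fromSpecStalk_app hη]
    simp only [Category.assoc]
    rfl

/-- The morphism is a variable g with an equation, so that the lemma applies to a composite without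
transporting sections between equal opens. -/
lemma genericInclusion_app_injective {U : X.Opens} [hU : Nonempty U]
    {g : Spec (X.residueField (genericPoint X)) ⟶ X}
    (hg : g = genericInclusion X) : Function.Injective (g.app U) := by
  subst hg
  obtain ⟨ρ, _, hρ⟩ := exists_genericInclusion_app (X := X) (U := U)
  rw [hρ]
  exact (ConcreteCategory.bijective_of_isIso ρ).injective.comp (X.germToFunctionField_injective U)

lemma exists_genericInclusion_app_eq {U : X.Opens} [hU : Nonempty U] (hUa : IsAffineOpen U)
    [IsIntegrallyClosed Γ(X, U)] {g : Spec (X.residueField (genericPoint X)) ⟶ X}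
    (hg : g = genericInclusion X) (y : Γ(Spec (X.residueField (genericPoint X)), g ⁻¹ᵁ U))
    (hy : (g.app U).hom.IsIntegralElem y) : ∃ a, g.app U a = y := by
  subst hg
  obtain ⟨ρ, _, hρ⟩ := exists_genericInclusion_app (X := X) (U := U)
  have := functionField_isFractionRing_of_isAffineOpen X U hUa
  have hb := ConcreteCategory.bijective_of_isIso ρ
  obtain ⟨k, rfl⟩ := hb.surjective y
  rw [hρ] at hy ⊢
  obtain ⟨P, hP, hPk⟩ := hy
  have hk : IsIntegral Γ(X, U) k := by
    refine ⟨P, hP, hb.injective ?_⟩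
    rw [map_zero]
    refine Eq.trans ?_ hPk
    exact Polynomial.hom_eval₂ P _ ρ.hom k
  obtain ⟨a, rfl⟩ := IsIntegrallyClosed.isIntegral_iff.mp hk
  exact ⟨a, rfl⟩

lemma isIso_map_eqToHom_op (T : Scheme.{u}) {A B : T.Opens} (h : A = B) :
    IsIso (T.presheaf.map (eqToHom h).op) := by
  subst h
  infer_instance

/-- An integral birational morphism to a normal scheme is an isomorphism. -/
lemma isIso_of_isIntegralHom {T : Scheme.{u}} (d : T ⟶ X) [IsIntegralHom d]
    (hX : ∀ U : X.Opens, IsAffineOpen U → Nonempty U → IsIntegrallyClosed Γ(X, U))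
    (e : Spec (X.residueField (genericPoint X)) ⟶ T) [IsSchemeTheoreticallyDominant e]
    [QuasiCompact e] (he : e ≫ d = genericInclusion X) : IsIso d := by
  have h := @HasAffineProperty.iff_of_iSup_eq_top _ _
    instHasAffinePropertyIsomorphismsSchemeAndIsAffineIsIsoCommRingCatAppTop.{u} _ _ d _
    (fun U : X.affineOpens => U) (iSup_affineOpens_eq_top X)
  suffices H : ∀ U : X.affineOpens, IsIso (d.app U.1) by
    refine h.mpr fun U => ⟨U.2.preimage d, ?_⟩
    rw [morphismRestrict_appTop]
    have := H ⟨U.1.ι ''ᵁ ⊤, by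
      rw [Scheme.Hom.image_top_eq_opensRange, Scheme.Opens.opensRange_ι]
      exact U.2⟩
    refine @IsIso.comp_isIso _ _ _ _ _ _ _ this ?_
    exact isIso_map_eqToHom_op _ _
  intro U
  refine (ConcreteCategory.isIso_iff_bijective _).mpr ?_
  rcases isEmpty_or_nonempty U.1 with hU | hU
  · have hbot : U.1 = ⊥ := Opens.ext (Set.isEmpty_coe_sort.mp hU)
    have h1 : Subsingleton Γ(X, U.1) := by
      rw [hbot]
      infer_instance
    have h2 : Subsingleton Γ(T, d ⁻¹ᵁ U.1) := (d.app U.1).hom.codomain_trivial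
    exact ⟨fun a b _ => Subsingleton.elim a b, fun a => ⟨0, Subsingleton.elim _ _⟩⟩
  have := hX U.1 U.2 hU
  have key (a : Γ(X, U.1)) : (e ≫ d).app U.1 a = e.app (d ⁻¹ᵁ U.1) (d.app U.1 a) := by
    rw [Scheme.Hom.comp_app]
    rfl
  refine ⟨fun a b hab => genericInclusion_app_injective he (U := U.1) ?_, fun y => ?_⟩
  · rw [key, key, hab]
  -- A function y over T is integral over Γ(X, U), so its value at the generic point lies in Γ(X, U)
  -- by normality. Dominance of e makes y equal to the pullback of that element.
  · obtain ⟨P, hP, hPy⟩ := IsIntegralHom.isIntegral_app d U.1 U.2 y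
    obtain ⟨a, ha⟩ := exists_genericInclusion_app_eq U.2 he (e.app (d ⁻¹ᵁ U.1) y) ⟨P, hP, by
      have := congr(e.app (d ⁻¹ᵁ U.1) $hPy)
      rw [map_zero] at this
      refine Eq.trans ?_ this
      rw [Scheme.Hom.comp_app]
      exact (Polynomial.hom_eval₂ P _ (e.app (d ⁻¹ᵁ U.1)).hom y).symm⟩
    exact ⟨a, e.app_injective _ ((key a).symm.trans ha)⟩

end Birational

/-! ### Values of functions on the total space along the section -/

section Evaluation

variable {X Z : Scheme.{u}} (f : X ⟶ Z) {V : Z.Modules} (hV : IsVectorBundle V)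
  (s : Γ((Scheme.Modules.pullback f).obj V, ⊤))

lemma preimage_le_sectionMap_preimage (U : Z.Opens) :
    f ⁻¹ᵁ U ≤ sectionMap f s hV ⁻¹ᵁ totalSpaceProj V hV ⁻¹ᵁ U := by
  rw [← Scheme.Hom.comp_preimage, sectionMap_totalSpaceProj]

lemma exists_apply_eq_of_comp_eq {A B C D E : CommRingCat.{u}} (x : A ⟶ B) (i : B ≅ C) (y : A ⟶ D)
    [IsIso y] {z : D ⟶ C} (j : D ≅ E) (ev : E ⟶ B) (h₁ : x ≫ i.hom = y ≫ z)
    (h₂ : z = j.hom ≫ ev ≫ i.hom) (g : E) : ∃ a, x a = ev g := by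
  have h : (j.inv ≫ inv y) ≫ x = ev := by
    rw [← cancel_mono i.hom]
    simp [h₁, h₂]
  exact ⟨(j.inv ≫ inv y) g, congr($h g)⟩

lemma appLE_top_comp_appTop {W T Y : Scheme.{u}} (a : W ⟶ T) (b : T ⟶ Y) (U : Y.Opens)
    (h : ⊤ ≤ b ⁻¹ᵁ U) :
    b.appLE U ⊤ h ≫ a.appTop =
      (a ≫ b).appLE U ⊤ (le_top.trans (Scheme.Hom.preimage_mono a h)) := by
  rw [← Scheme.Hom.appLE_comp_appLE a b U ⊤ ⊤ h le_top]
  exact congr(_ ≫ $((Scheme.Hom.appLE_eq_app (f := a) (U := ⊤)).symm))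

/-- Functions on the part of `Tot(V)` over `U` pull back along the section to their values. -/
lemma exists_sectionMap_appLE_eq (U : FramedOpens V) (g : FunctionRing V U.carrier) :
    ∃ g' : Γ(totalSpace V hV, totalSpaceProj V hV ⁻¹ᵁ U.carrier),
      (sectionMap f s hV).appLE _ (f ⁻¹ᵁ U.carrier)
        (preimage_le_sectionMap_preimage f hV s U.carrier) g' = evalSection f s U g := by
  have hle : (⊤ : (Spec (.of (FunctionRing V U.carrier))).Opens) ≤
      totalSpaceChart V hV U ⁻¹ᵁ totalSpaceProj V hV ⁻¹ᵁ U.carrier := by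
    rw [totalSpaceProj_preimage, Scheme.Hom.preimage_opensRange]
  -- The range of the chart is exactly the part of Tot(V) over U, so every element of Sym(V(U)^∨) is
  -- a function on that part.
  have h1 : IsIso ((totalSpaceChart V hV U).appLE (totalSpaceProj V hV ⁻¹ᵁ U.carrier) ⊤ hle) := by
    have hW : totalSpaceProj V hV ⁻¹ᵁ U.carrier = totalSpaceChart V hV U ''ᵁ ⊤ := by
      rw [totalSpaceProj_preimage, Scheme.Hom.image_top_eq_opensRange]
    generalize totalSpaceProj V hV ⁻¹ᵁ U.carrier = W at hW hle
    subst hW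
    rw [← Scheme.Hom.appIso_hom']
    infer_instance
  have h2 : (⊤ : (f ⁻¹ᵁ U.carrier).toScheme.Opens) ≤ (f ⁻¹ᵁ U.carrier).ι ⁻¹ᵁ (f ⁻¹ᵁ U.carrier) := by
    rw [Scheme.Opens.ι_preimage_self]
  have h3 : (f ⁻¹ᵁ U.carrier).ι.appLE (f ⁻¹ᵁ U.carrier) ⊤ h2 = (f ⁻¹ᵁ U.carrier).topIso.inv := by
    rw [Scheme.Opens.ι_appLE]
    rfl
  refine exists_apply_eq_of_comp_eq _ (f ⁻¹ᵁ U.carrier).topIso.symm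
    ((totalSpaceChart V hV U).appLE _ ⊤ hle) (Scheme.ΓSpecIso _) (CommRingCat.ofHom (evalSection f s U))
    ?_ (sectionMapOn_appTop f s U) g
  rw [Iso.symm_hom, ← h3, Scheme.Hom.appLE_comp_appLE]
  refine Eq.trans ?_ (appLE_top_comp_appTop _ _ _ hle).symm
  simp only [ι_sectionMap]

end Evaluation

/-! ### Normalization in a residue field -/

section ResidueNormalization


/-- An integral morphism from a normal integral scheme factors through the normalization of the
target in the residue field of the image of the generic point. -/
lemma exists_fac_normalization {X C : Scheme.{u}} [IsIntegral X] (t : X ⟶ C) [IsIntegralHom t]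
    (hX : ∀ U : X.Opens, IsAffineOpen U → Nonempty U → IsIntegrallyClosed Γ(X, U)) :
    ∃ p : X ⟶ (C.fromSpecResidueField (t (genericPoint X))).normalization,
      p ≫ (C.fromSpecResidueField (t (genericPoint X))).fromNormalization = t ∧
        IsDominant p := by
  let h : Spec (X.residueField (genericPoint X)) ⟶ C := genericInclusion X ≫ t
  let k := Spec.map (t.residueFieldMap (genericPoint X))
  let j := C.fromSpecResidueField (t (genericPoint X))
  have hk : h = k ≫ j := (Scheme.Hom.SpecMap_residueFieldMap_fromSpecResidueField t _).symm
  have : QuasiCompact h := inferInstance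
  have : QuasiSeparated h := inferInstance
  have : IsSchemeTheoreticallyDominant h.toNormalization := ⟨h.ker_toNormalization⟩
  -- X is the normalization of C in the residue field of its own generic point: the comparison is
  -- integral and birational, and X is normal. The map p is the inverse followed by the map to the
  -- normalization in the residue field of the image point.
  have hd : IsIso (h.normalizationDesc (genericInclusion X) t rfl) :=
    isIso_of_isIntegralHom _ hX h.toNormalization (h.toNormalization_normalizationDesc _ _ rfl)
  have hkj : h = (k ≫ j.toNormalization) ≫ j.fromNormalization := by
    rw [Category.assoc, Scheme.Hom.toNormalization_fromNormalization, hk]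
  refine ⟨inv (h.normalizationDesc (genericInclusion X) t rfl) ≫
    h.normalizationDesc (k ≫ j.toNormalization) j.fromNormalization hkj, ?_, ?_⟩
  · rw [Category.assoc, IsIso.inv_comp_eq, Scheme.Hom.normalizationDesc_comp,
      Scheme.Hom.normalizationDesc_comp]
  · have h1 : genericInclusion X ≫ inv (h.normalizationDesc (genericInclusion X) t rfl) ≫
        h.normalizationDesc (k ≫ j.toNormalization) j.fromNormalization hkj =
          k ≫ j.toNormalization := by
      have h2 : genericInclusion X ≫ inv (h.normalizationDesc (genericInclusion X) t rfl) =
          h.toNormalization := by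
        rw [IsIso.comp_inv_eq, Scheme.Hom.toNormalization_normalizationDesc]
      rw [reassoc_of% h2, Scheme.Hom.toNormalization_normalizationDesc]
    -- Both spectra are single points. So p, restricted to the generic point of X, is a surjection
    -- followed by a dominant map.
    have : Surjective k := ⟨fun x => ⟨default, Subsingleton.elim _ _⟩⟩
    have : IsDominant (k ≫ j.toNormalization) := inferInstance
    rw [← h1] at this
    exact IsDominant.of_comp (genericInclusion X) _

lemma app_injective_of_isDominant {X Y : Scheme.{u}} [IsReduced Y] (p : X ⟶ Y) [IsDominant p]
    [QuasiCompact p] (W : Y.Opens) : Function.Injective (p.app W) :=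
  have := IsSchemeTheoreticallyDominant.of_isDominant p
  p.app_injective W

lemma IsNormalScheme.of_affine {Y : Scheme.{u}} [IsIntegral Y]
    (h : ∀ y : Y, ∃ U : Y.Opens, y ∈ U ∧ IsAffineOpen U ∧ IsIntegrallyClosed Γ(Y, U)) :
    IsNormalScheme Y := by
  intro y
  obtain ⟨U, hyU, hU, hi⟩ := h y
  have : Nonempty U := ⟨⟨y, hyU⟩⟩
  refine ⟨inferInstance, ?_⟩
  let := (Y.presheaf.germ U y hyU).hom.toAlgebra
  have := hU.isLocalization_stalk ⟨y, hyU⟩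
  exact isIntegrallyClosed_of_isLocalization _ (hU.primeIdealOf ⟨y, hyU⟩).asIdeal.primeCompl
    (Ideal.primeCompl_le_nonZeroDivisors _)

/-- Over an affine open of C the normalization is the spectrum of an integral closure in a field. -/
lemma isNormalScheme_normalization {C : Scheme.{u}} {K : Type u} [Field K] (j : Spec (.of K) ⟶ C)
    [QuasiCompact j] [QuasiSeparated j] : IsNormalScheme j.normalization := by
  refine .of_affine fun y => ?_
  obtain ⟨_, ⟨U, hU, rfl⟩, hyU, -⟩ := C.isBasis_affineOpens.exists_subset_of_mem_open
    (Set.mem_univ (j.fromNormalization y)) isOpen_univ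
  refine ⟨j.fromNormalization ⁻¹ᵁ U, hyU, hU.preimage _, ?_⟩
  -- The single point of Spec K has dense image in the normalization, so it meets the nonempty open
  -- above U, and the ring of sections over the preimage of U is all of K.
  have htop : j ⁻¹ᵁ U = ⊤ := by
    obtain ⟨x, hx⟩ := j.toNormalization.denseRange.exists_mem_open
      (j.fromNormalization ⁻¹ᵁ U).isOpen ⟨y, hyU⟩
    have hx' : x ∈ j ⁻¹ᵁ U := by
      rw [← j.toNormalization_fromNormalization]
      exact hx
    exact top_le_iff.mp fun z _ => Subsingleton.elim (α := PrimeSpectrum K) x z ▸ hx'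
  let := (j.app U).hom.toAlgebra
  have hF : IsField Γ(Spec (.of K), j ⁻¹ᵁ U) := by
    rw [htop]
    exact (Scheme.ΓSpecIso (.of K)).commRingCatIsoToRingEquiv.toMulEquiv.isField
      (Field.toIsField K)
  let := hF.toField
  have : IsIntegrallyClosed (integralClosure Γ(C, U) Γ(Spec (.of K), j ⁻¹ᵁ U)) :=
    IsIntegrallyClosed.of_isIntegrallyClosed_of_isIntegrallyClosedIn _ Γ(Spec (.of K), j ⁻¹ᵁ U)
  exact IsIntegrallyClosed.of_equiv (j.normalizationObjIso hU).commRingCatIsoToRingEquiv.symm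

end ResidueNormalization

/-! ### Smooth varieties are normal -/

section SmoothNormal

lemma IsField.isIntegrallyClosed {L : Type*} [CommRing L] (h : IsField L) : IsIntegrallyClosed L :=
  let := h.toField
  inferInstance

open scoped TensorProduct in
-- The generic fibre S ⊗ K is a domain and finite over the field K, hence a field. Integral closure
-- commutes with smooth base change, so the closure of S in S ⊗ K comes from that of P in K, which
-- is P.
lemma isIntegrallyClosed_of_etale (P S : Type u) [CommRing P] [CommRing S] [IsDomain P]
    [IsIntegrallyClosed P] [IsDomain S] [Algebra P S] [Algebra.Etale P S] : IsIntegrallyClosed S := by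
  let K := FractionRing P
  have hinj : Function.Injective (algebraMap P S) := FaithfulSMul.algebraMap_injective P S
  have hloc : IsLocalization (Algebra.algebraMapSubmonoid S (nonZeroDivisors P)) (S ⊗[P] K) :=
    inferInstance
  have hle : Algebra.algebraMapSubmonoid S (nonZeroDivisors P) ≤ nonZeroDivisors S :=
    map_le_nonZeroDivisors_of_injective _ hinj le_rfl
  have : IsDomain (S ⊗[P] K) := IsLocalization.isDomain_of_le_nonZeroDivisors _ hle
  have hfin : Module.Finite K (K ⊗[P] S) := Algebra.FormallyUnramified.finite_of_free K _
  have hF : IsField (S ⊗[P] K) := by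
    refine MulEquiv.isField ?_ (Algebra.TensorProduct.comm P S K).toMulEquiv
    have : IsDomain (K ⊗[P] S) := (Algebra.TensorProduct.comm P S K).symm.toMulEquiv.isDomain _
    exact isField_of_isIntegral_of_isField' (R := K) (Field.toIsField K)
  have := IsField.isIntegrallyClosed hF
  have hinj' : Function.Injective (algebraMap S (S ⊗[P] K)) := IsLocalization.injective _ hle
  have : FaithfulSMul S (S ⊗[P] K) := (faithfulSMul_iff_algebraMap_injective _ _).mpr hinj'
  have : IsIntegrallyClosedIn S (S ⊗[P] K) := by
    refine isIntegrallyClosedIn_iff.mpr ⟨hinj', fun {x} hx => ?_⟩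
    obtain ⟨y, hy⟩ := (TensorProduct.toIntegralClosure_bijective_of_smooth (R := P) (S := S)
      (B := K)).surjective ⟨x, hx⟩
    obtain rfl : TensorProduct.toIntegralClosure P S K y = x := congr_arg Subtype.val hy
    clear hx hy
    induction y with
    | zero => exact ⟨0, by simp⟩
    | add a b ha hb =>
      obtain ⟨a', ha⟩ := ha
      obtain ⟨b', hb⟩ := hb
      exact ⟨a' + b', by simp [ha, hb]⟩
    | tmul s b =>
      obtain ⟨r, hr⟩ := IsIntegrallyClosed.isIntegral_iff.mp b.2
      refine ⟨r • s, ?_⟩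
      have hr' : (b : K) = algebraMap P K r := hr.symm
      change _ = s ⊗ₜ[P] (b : K)
      rw [hr', Algebra.algebraMap_eq_smul_one r, TensorProduct.tmul_smul, TensorProduct.smul_tmul']
      rfl
  exact .of_isIntegrallyClosed_of_isIntegrallyClosedIn S (S ⊗[P] K)

/-- Normality is checked at maximal ideals, and near each of them S is étale over a polynomial ring
over k, which is normal. -/
lemma isIntegrallyClosed_of_smooth (k S : Type u) [Field k] [CommRing S] [IsDomain S] [Algebra k S]
    [Algebra.Smooth k S] : IsIntegrallyClosed S := by
  refine IsIntegrallyClosed.of_localization_maximal fun m _ hm => ?_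
  obtain ⟨f, hf, n, _, _, _⟩ :=
    Algebra.IsSmoothAt.exists_isStandardEtale_mvPolynomial (R := k) (p := m)
  have hf0 : f ≠ 0 := fun h => hf (h ▸ m.zero_mem)
  have hle : Submonoid.powers f ≤ nonZeroDivisors S := powers_le_nonZeroDivisors_of_noZeroDivisors hf0
  have : IsDomain (Localization.Away f) := IsLocalization.isDomain_localization hle
  have := isIntegrallyClosed_of_etale (MvPolynomial (Fin n) k) (Localization.Away f)
  have hm' : Submonoid.powers f ≤ m.primeCompl := Submonoid.powers_le.mpr hf
  let := IsLocalization.localizationAlgebraOfSubmonoidLe (Localization.Away f)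
    (Localization.AtPrime m) _ _ hm'
  have := IsLocalization.localization_isScalarTower_of_submonoid_le (Localization.Away f)
    (Localization.AtPrime m) _ _ hm'
  have := IsLocalization.isLocalization_of_submonoid_le (Localization.Away f)
    (Localization.AtPrime m) _ _ hm'
  refine isIntegrallyClosed_of_isLocalization (R := Localization.Away f) _
    (m.primeCompl.map (algebraMap S (Localization.Away f))) ?_
  exact map_le_nonZeroDivisors_of_injective _ (IsLocalization.injective _ hle)
    (Ideal.primeCompl_le_nonZeroDivisors _)

lemma isNormalOfCharZero_of_smooth {X : Scheme.{0}} [IsIntegral X] (f : X ⟶ Spec (.of ℂ))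
    [Smooth f] : IsNormalOfCharZero X := by
  intro U hU _
  have h := f.smooth_appLE (isAffineOpen_top _) hU le_top
  let g : ℂ →+* Γ(X, U) := (f.appLE ⊤ U le_top).hom.comp (Scheme.ΓSpecIso (.of ℂ)).inv.hom
  let : Algebra ℂ Γ(X, U) := g.toAlgebra
  have : Algebra.Smooth ℂ Γ(X, U) := by
    exact RingHom.smooth_algebraMap.mp (RingHom.Smooth.propertyIsLocal.respectsIso.2 _
      (Scheme.ΓSpecIso (.of ℂ)).symm.commRingCatIsoToRingEquiv h)
  exact ⟨isIntegrallyClosed_of_smooth ℂ _, charZero_of_injective_algebraMap g.injective⟩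

end SmoothNormal

/-! ### The normalized spectral cover and descent to it -/

section SpectralNormalization

/-- A finite morphism whose kernel has the same radical as `J` lifts to a dominant morphism to the
closed subscheme of `J`. -/
lemma exists_fac_subscheme {X T : Scheme.{u}} (J : T.IdealSheafData) (g : X ⟶ T) [IsFinite g]
    (hle : J ≤ g.ker) (hpow : ∃ k, g.ker ^ k ≤ J) :
    ∃ t : X ⟶ J.subscheme, t ≫ J.subschemeι = g ∧ IsFinite t ∧ IsDominant t := by
  obtain ⟨k, hk⟩ := hpow
  have hι : J.subschemeι.ker ≤ g.ker := by
    rwa [Scheme.IdealSheafData.ker_subschemeι]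
  let t : X ⟶ J.subscheme := IsClosedImmersion.lift J.subschemeι g hι
  have ht : t ≫ J.subschemeι = g := IsClosedImmersion.lift_fac _ _ hι
  have hfin : IsFinite (t ≫ J.subschemeι) := by rw [ht]; infer_instance
  refine ⟨t, ht, .of_comp t J.subschemeι, ⟨fun c => ?_⟩⟩
  -- A power of the kernel lies in J, so the support of J lies in the support of the kernel, which
  -- is the closure of the image of g.
  have hc : J.subschemeι c ∈ closure (Set.range g) := by
    rw [← Scheme.Hom.support_ker]
    have h1 : J.subschemeι c ∈ J.support := by
      rw [← SetLike.mem_coe, ← Scheme.IdealSheafData.range_subschemeι]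
      exact ⟨c, rfl⟩
    have h2 := Scheme.IdealSheafData.support_antitone hk h1
    -- For exponent zero J is the unit ideal and the subscheme is empty; only positive powers keep
    -- the support.
    rcases k with _ | k
    · rw [pow_zero, Scheme.IdealSheafData.one_eq_top, Scheme.IdealSheafData.support_top] at h2
      exact h2.elim
    · rwa [Scheme.IdealSheafData.support_pow_succ] at h2
  have hr : Set.range g = J.subschemeι '' Set.range t := by
    rw [← ht, ← Set.range_comp]
    rfl
  rw [hr] at hc
  rwa [J.subschemeι.isClosedEmbedding.isInducing.closure_eq_preimage_closure_image]

/-- If `p ≫ q` is finite over a locally noetherian scheme, `q` is affine and `p` is dominant in the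
strong sense, then `q` is finite. -/
lemma isFinite_of_app_injective {X Y Z : Scheme.{u}} [IsLocallyNoetherian Z] (p : X ⟶ Y) (q : Y ⟶ Z)
    [IsFinite (p ≫ q)] [IsAffineHom q] (hp : ∀ W, Function.Injective (p.app W)) : IsFinite q := by
  refine { finite_app := fun U hU => ?_ }
  have := IsLocallyNoetherian.component_noetherian ⟨U, hU⟩
  have hf := (p ≫ q).finite_app U hU
  let := (q.app U).hom.toAlgebra
  let := ((p ≫ q).app U).hom.toAlgebra
  let φ : Γ(Y, q ⁻¹ᵁ U) →ₐ[Γ(Z, U)] Γ(X, (p ≫ q) ⁻¹ᵁ U) :=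
    { (p.app (q ⁻¹ᵁ U)).hom with
      commutes' := fun r => by
        change (p.app (q ⁻¹ᵁ U)) (q.app U r) = (p ≫ q).app U r
        rw [Scheme.Hom.comp_app]
        rfl }
  have : Module.Finite Γ(Z, U) Γ(X, (p ≫ q) ⁻¹ᵁ U) := hf
  have : IsNoetherian Γ(Z, U) Γ(X, (p ≫ q) ⁻¹ᵁ U) := inferInstance
  exact Module.Finite.of_injective φ.toLinearMap (hp _)

/-- A section of `π^* V` whose coordinates come from `Y` descends to `Y`, and so does the Higgs field
that it induces. -/
lemma exists_descent {X Y Z : Scheme.{u}} {p : X ⟶ Y} {q : Y ⟶ Z} {π : X ⟶ Z} (h : p ≫ q = π)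
    {M : X.Modules} {V : Z.Modules} (hV : IsVectorBundle V)
    (hp : ∀ W, Function.Injective (p.app W)) (s : Γ((Scheme.Modules.pullback π).obj V, ⊤))
    (hs : ∀ (U : FramedOpens V) (n : ℕ) (e : Fin n → Γ(V, U.carrier)) (he : IsFrame V e) (i : Fin n),
      ∃ b : Γ(Y, q ⁻¹ᵁ U.carrier),
        p.appLE (q ⁻¹ᵁ U.carrier) (π ⁻¹ᵁ U.carrier) (by rw [← h]; rfl) b = sectionCoord π s he i)
    {Φ : (Scheme.Modules.pushforward π).obj M ⟶ tensor ((Scheme.Modules.pushforward π).obj M) V}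
    (hΦ : IsPushforwardHiggs π M V s Φ) :
    ∃ τ : Γ((Scheme.Modules.pullback q).obj V, ⊤), pullSectionComp h V τ = s ∧
      ∃ Ψ : (Scheme.Modules.pushforward q).obj ((Scheme.Modules.pushforward p).obj M) ⟶
          tensor ((Scheme.Modules.pushforward q).obj ((Scheme.Modules.pushforward p).obj M)) V,
        IsPushforwardHiggs q ((Scheme.Modules.pushforward p).obj M) V τ Ψ ∧
        conjHiggs (pushforwardFactor h M) V Ψ = Φ := by
  subst h
  obtain ⟨τ, rfl⟩ := exists_pullSectionComp_eq p q hV hp s fun z => by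
    obtain ⟨U, hz, -⟩ := exists_framedOpens hV (z := z) (U := ⊤) trivial
    obtain ⟨n, e, he⟩ := U.exists_frame
    refine ⟨U.carrier, n, e, he, hz, fun i => ?_⟩
    obtain ⟨b, hb⟩ := hs U n e he i
    exact ⟨b, by rw [← hb, Scheme.Hom.app_eq_appLE]; rfl⟩
  obtain ⟨Ψ, hΨ, -⟩ := existsUnique_isPushforwardHiggs q ((Scheme.Modules.pushforward p).obj M) hV τ
  exact ⟨τ, rfl, Ψ, hΨ, conjHiggs_eq p q hV hΦ hΨ⟩

lemma isNormalScheme_normalization_residueField {C : Scheme.{u}} (x : C) :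
    IsNormalScheme (C.fromSpecResidueField x).normalization :=
  @isNormalScheme_normalization C (C.residueField x) inferInstance (C.fromSpecResidueField x)
    (inferInstanceAs (QuasiCompact (C.fromSpecResidueField x)))
    (inferInstanceAs (QuasiSeparated (C.fromSpecResidueField x)))

/-- The normalization of the spectral cover of the Higgs field induced by a section, through which
the covering and the section factor. -/
theorem exists_spectralCover_normalization {X Z : Scheme.{u}} [IsIntegral X] [IsIntegral Z]
    [IsLocallyNoetherian Z] [CompactSpace Z] (π : X ⟶ Z) [IsFinite π] [Surjective π]
    (hX : IsNormalOfCharZero X) (hZ : IsNormalOfCharZero Z) {M : X.Modules} (hM : IsCoherentSheaf M)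
    (htf : IsTorsionFreeSheaf M) (h0 : ¬ IsZero M) {V : Z.Modules} (hV : IsVectorBundle V)
    (s : Γ((Scheme.Modules.pullback π).obj V, ⊤))
    {Φ : (Scheme.Modules.pushforward π).obj M ⟶ tensor ((Scheme.Modules.pushforward π).obj M) V}
    (hΦ : IsPushforwardHiggs π M V s Φ) :
    ∃ (Y : Scheme.{u}) (p : X ⟶ Y) (q : Y ⟶ Z) (h : p ≫ q = π),
      IsIntegral Y ∧ IsNormalScheme Y ∧ IsFinite p ∧ IsFinite q ∧
      (∃ τ : Γ((Scheme.Modules.pullback q).obj V, ⊤), pullSectionComp h V τ = s ∧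
        ∃ Ψ : (Scheme.Modules.pushforward q).obj ((Scheme.Modules.pushforward p).obj M) ⟶
            tensor ((Scheme.Modules.pushforward q).obj ((Scheme.Modules.pushforward p).obj M)) V,
          IsPushforwardHiggs q ((Scheme.Modules.pushforward p).obj M) V τ Ψ ∧
          conjHiggs (pushforwardFactor h M) V Ψ = Φ) ∧
      ∃ ν : Y ⟶ spectralCover hV Φ, IsNormalization ν ∧ ν ≫ spectralCoverProj hV Φ = q := by
  obtain ⟨t, ht, _, _⟩ := exists_fac_subscheme (spectralIdealSheaf hV Φ) (sectionMap π s hV)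
    (spectralIdealSheaf_le_ker hV π s hZ hM htf h0 hΦ)
    (exists_ker_pow_le_spectralIdealSheaf hV π s hZ hM htf h0 hΦ)
  obtain ⟨p, hp, _⟩ := exists_fac_normalization t fun U hU hU' => (hX U hU hU').1
  let j := (spectralIdealSheaf hV Φ).subscheme.fromSpecResidueField (t (genericPoint X))
  let ν : j.normalization ⟶ (spectralIdealSheaf hV Φ).subscheme := j.fromNormalization
  let q := ν ≫ (spectralIdealSheaf hV Φ).subschemeι ≫ totalSpaceProj V hV
  have hpι : p ≫ ν ≫ (spectralIdealSheaf hV Φ).subschemeι = sectionMap π s hV := by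
    rw [← Category.assoc, hp, ht]
  have hpq : p ≫ q = π := by
    refine Eq.trans ?_ (sectionMap_totalSpaceProj π s hV)
    rw [← hpι]
    simp only [q, Category.assoc]
  have hq : IsAffineHom q := inferInstance
  have hpqf : IsFinite (p ≫ q) := by rw [hpq]; infer_instance
  have hpt : IsFinite (p ≫ ν) := by rw [hp]; infer_instance
  have : IsFinite p := .of_comp p ν
  have hinj (W : j.normalization.Opens) := app_injective_of_isDominant p W
  refine ⟨j.normalization, p, q, hpq, inferInstance, isNormalScheme_normalization_residueField _, inferInstance,
    isFinite_of_app_injective p q hinj, exists_descent hpq hV hinj s ?_ hΦ, ν,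
    ⟨t (genericPoint X), ?_, Iso.refl _, Category.id_comp _⟩, rfl⟩
  -- The i-th coordinate of s is the pullback of the i-th linear coordinate on Tot(V) along the
  -- section map, which factors through p; its pullback to Y is the required function.
  · intro U n e he i
    obtain ⟨g, hg⟩ := exists_sectionMap_appLE_eq π hV s U
      (SymmetricAlgebra.ι _ _ ((he.basis _ le_rfl).coord i))
    have hle : q ⁻¹ᵁ U.carrier ≤ (ν ≫ (spectralIdealSheaf hV Φ).subschemeι) ⁻¹ᵁ
      totalSpaceProj V hV ⁻¹ᵁ U.carrier := le_rfl
    refine ⟨(ν ≫ (spectralIdealSheaf hV Φ).subschemeι).appLE _ _ hle g, ?_⟩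
    rw [evalSection_ι _ _ _ he, pairing_coord] at hg
    rw [← hg, ← ConcreteCategory.comp_apply, Scheme.Hom.appLE_comp_appLE]
    simp only [hpι]
  -- Dominance of t sends the generic point of X to a generic point of the spectral cover, which is
  -- thereby irreducible.
  · have h1 := (genericPoint_spec X).image t.continuous
    rwa [Set.image_univ, t.denseRange.closure_range] at h1

end SpectralNormalization

/-! ### Morphisms to `Proj` from homogeneous coordinates in a function field -/

section ProjEmbedding

open HomogeneousLocalization

variable {σ : Type*} {A : Type u} [CommRing A] [SetLike σ A] [AddSubgroupClass σ A] (𝒜 : ℕ → σ)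
  [GradedRing 𝒜] {K : Type u} [Field K] (Θ : A →+* K)

/-- The evaluation `a / t ^ n ↦ Θ a / Θ t ^ n`. -/
def awayEval {t : A} (h0 : Θ t ≠ 0) : Away 𝒜 t →+* K :=
  (Localization.awayLift Θ t h0.isUnit).comp (algebraMap (Away 𝒜 t) (Localization.Away t))

lemma awayEval_mk {t : A} (h0 : Θ t ≠ 0) {d : ℕ} (ht : t ∈ 𝒜 d) (n : ℕ) (a : A)
    (ha : a ∈ 𝒜 (n • d)) : awayEval 𝒜 Θ h0 (Away.mk 𝒜 ht n a ha) = Θ a / Θ t ^ n := by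
  have hl (b : A) : Localization.awayLift Θ t h0.isUnit (algebraMap A _ b) = Θ b :=
    IsLocalization.Away.lift_eq t h0.isUnit b
  rw [eq_div_iff (pow_ne_zero _ h0), awayEval, RingHom.comp_apply,
    HomogeneousLocalization.algebraMap_apply, Away.val_mk, ← map_pow Θ, ← hl (t ^ n), ← map_mul,
    Localization.mk_eq_mk', ← hl a]
  refine congrArg _ ?_
  exact IsLocalization.mk'_spec _ a (⟨t ^ n, _⟩ : Submonoid.powers t)

lemma awayEval_comp_awayMap {t s x : A} (ht0 : Θ t ≠ 0) (hx0 : Θ x ≠ 0) {d e : ℕ} (ht : t ∈ 𝒜 d)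
    (hs : s ∈ 𝒜 e) (hx : x = t * s) :
    (awayEval 𝒜 Θ hx0).comp (awayMap 𝒜 hs hx) = awayEval 𝒜 Θ ht0 := by
  ext a
  obtain ⟨n, a, ha, rfl⟩ := Away.mk_surjective 𝒜 ht a
  rw [RingHom.comp_apply, awayMap_mk, awayEval_mk, awayEval_mk]
  have : Θ s ≠ 0 := fun h => hx0 (by rw [hx, map_mul, h, mul_zero])
  subst hx
  simp only [map_mul, map_pow]
  field_simp
  ring

/-- Both sides factor through D₊(ts): the K-point with homogeneous coordinates given by Θ does not
depend on the chart. -/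
lemma SpecMap_awayEval_awayι {t s : A} (ht0 : Θ t ≠ 0) (hs0 : Θ s ≠ 0) {d e : ℕ} (ht : t ∈ 𝒜 d)
    (hs : s ∈ 𝒜 e) (hd : 0 < d) (he : 0 < e) :
    Spec.map (CommRingCat.ofHom (awayEval 𝒜 Θ ht0)) ≫ Proj.awayι 𝒜 t ht hd =
      Spec.map (CommRingCat.ofHom (awayEval 𝒜 Θ hs0)) ≫ Proj.awayι 𝒜 s hs he := by
  have hx0 : Θ (t * s) ≠ 0 := by
    rw [map_mul]
    exact mul_ne_zero ht0 hs0
  rw [← awayEval_comp_awayMap 𝒜 Θ ht0 hx0 ht hs rfl, ← awayEval_comp_awayMap 𝒜 Θ hs0 hx0 hs ht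
    (mul_comm t s), CommRingCat.ofHom_comp, CommRingCat.ofHom_comp, Spec.map_comp, Spec.map_comp,
    Category.assoc, Category.assoc, Proj.SpecMap_awayMap_awayι, Proj.SpecMap_awayMap_awayι]
  rfl

lemma isDominant_of_comp_isOpenImmersion {W X Y : Scheme.{u}} (w : W ⟶ X) (o : X ⟶ Y)
    [IsOpenImmersion o] [IsDominant (w ≫ o)] : IsDominant w := by
  refine ⟨?_⟩
  have h := (w ≫ o).denseRange.preimage o.isOpenEmbedding.isOpenMap
  have hr : Set.range (w ≫ o) = o '' Set.range w := by
    rw [← Set.range_comp]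
    rfl
  rwa [hr, Set.preimage_image_eq _ o.isOpenEmbedding.injective] at h

/-- The open cover by the spectra of the sections over given affine opens. -/
def affineOpensCover {Y : Scheme.{u}} {ι : Type} {U : ι → Y.Opens} (hU : ∀ i, IsAffineOpen (U i))
    (hcov : ∀ y : Y, ∃ i, y ∈ U i) : Y.OpenCover where
  I₀ := ι
  X i := Spec Γ(Y, U i)
  f i := (hU i).fromSpec
  mem₀ := by
    rw [Scheme.presieve₀_mem_precoverage_iff]
    refine ⟨fun y => ?_, inferInstance⟩
    obtain ⟨i, hi⟩ := hcov y
    refine ⟨i, ?_⟩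
    rw [IsAffineOpen.range_fromSpec]
    exact hi

lemma exists_glue_affineOpens {Y P : Scheme.{u}} {ι : Type} {U : ι → Y.Opens}
    (hU : ∀ i, IsAffineOpen (U i)) (hcov : ∀ y : Y, ∃ i, y ∈ U i) (ψ : ∀ i, Spec Γ(Y, U i) ⟶ P)
    (h : ∀ i j, pullback.fst (hU i).fromSpec (hU j).fromSpec ≫ ψ i =
      pullback.snd (hU i).fromSpec (hU j).fromSpec ≫ ψ j) :
    ∃ φ : Y ⟶ P, ∀ i, (hU i).fromSpec ≫ φ = ψ i :=
  ⟨(affineOpensCover hU hcov).glueMorphisms ψ h,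
    fun i => (affineOpensCover hU hcov).ι_glueMorphisms ψ h i⟩

variable {Y : Scheme.{u}} [IsIntegral Y]

lemma SpecMap_germToFunctionField_fromSpec {U : Y.Opens} [hne : Nonempty U] (hU : IsAffineOpen U) :
    Spec.map (Y.germToFunctionField U) ≫ hU.fromSpec = Y.fromSpecStalk (genericPoint Y) :=
  hU.fromSpecStalk_eq_fromSpecStalk _

instance : IsDominant (Y.fromSpecStalk (genericPoint Y)) := by
  refine ⟨?_⟩
  have h := (genericPoint_spec Y)
  refine Dense.mono ?_ (dense_iff_closure_eq.mpr h)
  rintro _ rfl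
  exact ⟨IsLocalRing.closedPoint _, Scheme.fromSpecStalk_closedPoint⟩

variable {𝒜} {ι : Type} {U : ι → Y.Opens} [hne : ∀ i, Nonempty (U i)]

/-- On an overlap the two chart morphisms agree at the generic point. It is dense, the overlap is
reduced and `Proj` is separated, so they agree and glue. -/
lemma exists_fromSpec_comp_eq
    (hU : ∀ i, IsAffineOpen (U i)) (hcov : ∀ y : Y, ∃ i, y ∈ U i) (Θ : A →+* Y.functionField)
    {t : ι → A} (ht : ∀ i, t i ∈ 𝒜 1) (ht0 : ∀ i, Θ (t i) ≠ 0)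
    {g : ∀ i, Away 𝒜 (t i) →+* Γ(Y, U i)}
    (hg : ∀ i a, Y.germToFunctionField (U i) (g i a) = awayEval 𝒜 Θ (ht0 i) a) :
    ∃ φ : Y ⟶ Proj 𝒜, ∀ i, (hU i).fromSpec ≫ φ =
      Spec.map (CommRingCat.ofHom (g i)) ≫ Proj.awayι 𝒜 (t i) (ht i) one_pos := by
  let ψ (i : ι) : Spec Γ(Y, U i) ⟶ Proj 𝒜 :=
    Spec.map (CommRingCat.ofHom (g i)) ≫ Proj.awayι 𝒜 (t i) (ht i) one_pos
  have hψ (i : ι) : Spec.map (Y.germToFunctionField (U i)) ≫ ψ i =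
      Spec.map (CommRingCat.ofHom (awayEval 𝒜 Θ (ht0 i))) ≫
        Proj.awayι 𝒜 (t i) (ht i) one_pos := by
    have : CommRingCat.ofHom (g i) ≫ Y.germToFunctionField (U i) =
        CommRingCat.ofHom (awayEval 𝒜 Θ (ht0 i)) := by
      ext a
      exact hg i a
    rw [← this, Spec.map_comp, Category.assoc]
  have hη (i : ι) : Spec.map (Y.germToFunctionField (U i)) ≫ (hU i).fromSpec =
      Y.fromSpecStalk (genericPoint Y) := SpecMap_germToFunctionField_fromSpec (hU i)
  refine exists_glue_affineOpens hU hcov ψ fun i j => ?_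
  obtain ⟨w, hw₁, hw₂⟩ : ∃ w : Spec Y.functionField ⟶ pullback (hU i).fromSpec (hU j).fromSpec,
      w ≫ pullback.fst _ _ = Spec.map (Y.germToFunctionField (U i)) ∧
        w ≫ pullback.snd _ _ = Spec.map (Y.germToFunctionField (U j)) :=
    ⟨pullback.lift _ _ ((hη i).trans (hη j).symm), pullback.lift_fst _ _ _,
      pullback.lift_snd _ _ _⟩
  have : IsDominant (w ≫ pullback.fst _ _ ≫ (hU i).fromSpec) := by
    rw [reassoc_of% hw₁, hη]
    infer_instance
  have := isDominant_of_comp_isOpenImmersion w (pullback.fst _ _ ≫ (hU i).fromSpec)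
  have : IsReduced (pullback (hU i).fromSpec (hU j).fromSpec) :=
    isReduced_of_isOpenImmersion (pullback.fst _ _ ≫ (hU i).fromSpec)
  refine ext_of_isDominant w ?_
  rw [reassoc_of% hw₁, reassoc_of% hw₂, hψ, hψ]
  exact SpecMap_awayEval_awayι 𝒜 Θ _ _ _ _ _ _

/-- Surjectivity of the g i gives closed immersions on the charts, hence surjectivity on stalks. By
`hle` only points of U j map to D₊(t j), so two points with the same image share a chart, where the
map is injective. Closedness of the map supplies the rest. -/
lemma isClosedImmersion_of_isClosedMap {Y : Scheme.{u}} {ι : Type} {U : ι → Y.Opens}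
    (hU : ∀ i, IsAffineOpen (U i)) (hcov : ∀ y : Y, ∃ i, y ∈ U i)
    {t : ι → A} (ht : ∀ i, t i ∈ 𝒜 1)
    {g : ∀ i, Away 𝒜 (t i) →+* Γ(Y, U i)} (hg : ∀ i, Function.Surjective (g i))
    (hle : ∀ i j, Y.basicOpen (g i (Away.isLocalizationElem (ht i) (ht j))) ≤ U j)
    {φ : Y ⟶ Proj 𝒜} (hφ : ∀ i, (hU i).fromSpec ≫ φ =
      Spec.map (CommRingCat.ofHom (g i)) ≫ Proj.awayι 𝒜 (t i) (ht i) one_pos)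
    (hclosed : IsClosedMap φ) : IsClosedImmersion φ := by
  have hcl (i : ι) : IsClosedImmersion (Spec.map (CommRingCat.ofHom (g i))) :=
    IsClosedImmersion.spec_of_surjective _ (hg i)
  have hsurj : SurjectiveOnStalks φ := by
    have H (i : ι) : SurjectiveOnStalks ((hU i).fromSpec ≫ φ) := by
      rw [hφ]
      have := hcl i
      infer_instance
    exact (IsZariskiLocalAtSource.iff_of_openCover (P := @SurjectiveOnStalks)
      (affineOpensCover hU hcov)).mpr H
  have hval (i : ι) (y : Spec Γ(Y, U i)) : φ ((hU i).fromSpec y) =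
      Proj.awayι 𝒜 (t i) (ht i) one_pos (Spec.map (CommRingCat.ofHom (g i)) y) :=
    congr($(hφ i) y)
  have hex (i : ι) {y : Y} (hy : y ∈ U i) : ∃ z, (hU i).fromSpec z = y := by
    have : y ∈ Set.range (hU i).fromSpec := by
      rw [IsAffineOpen.range_fromSpec]
      exact hy
    exact this
  have hmem (j : ι) {y : Y} (hy : φ y ∈ Proj.basicOpen 𝒜 (t j)) : y ∈ U j := by
    obtain ⟨i, hi⟩ := hcov y
    obtain ⟨z, rfl⟩ := hex i hi
    refine hle i j ?_
    have h1 : Spec.map (CommRingCat.ofHom (g i)) z ∈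
        Proj.awayι 𝒜 (t i) (ht i) one_pos ⁻¹ᵁ Proj.basicOpen 𝒜 (t j) := by
      rw [hval] at hy
      exact hy
    rw [Proj.awayι_preimage_basicOpen 𝒜 (ht i) one_pos (ht j)] at h1
    change z ∈ (hU i).fromSpec ⁻¹ᵁ Y.basicOpen _
    rw [(hU i).fromSpec_preimage_basicOpen]
    · exact h1
    · exact one_pos
  have hinj : Function.Injective φ := by
    intro y y' h
    obtain ⟨i, hi⟩ := hcov y
    have hy : φ y ∈ Proj.basicOpen 𝒜 (t i) := by
      obtain ⟨z, rfl⟩ := hex i hi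
      rw [hval, ← Proj.opensRange_awayι 𝒜 (t i) (ht i) one_pos]
      exact ⟨_, rfl⟩
    obtain ⟨z, rfl⟩ := hex i hi
    obtain ⟨z', rfl⟩ := hex i (hmem i (h ▸ hy))
    rw [hval, hval] at h
    exact congrArg _ ((hcl i).isClosedEmbedding.injective
      ((Proj.awayι 𝒜 (t i) (ht i) one_pos).isOpenEmbedding.injective h))
  rw [IsClosedImmersion.eq_inf]
  exact ⟨.of_continuous_injective_isClosedMap φ.continuous hinj hclosed, hsurj⟩

lemma aeval_eq_pow_mul_of_isHomogeneous {R S : Type*} [CommRing R] [CommRing S] [Algebra R S]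
    {ι : Type*} {p : MvPolynomial ι R} {n : ℕ} (hp : p.IsHomogeneous n) (r : S) (c : ι → S) :
    MvPolynomial.aeval (fun i => r * c i) p = r ^ n * MvPolynomial.aeval c p := by
  rw [MvPolynomial.aeval_def, MvPolynomial.aeval_def, MvPolynomial.eval₂_eq, MvPolynomial.eval₂_eq,
    Finset.mul_sum]
  refine Finset.sum_congr rfl fun d hd => ?_
  have h1 : d.degree = n := by
    rw [Finsupp.degree_eq_weight_one]
    exact hp (MvPolynomial.mem_support_iff.mp hd)
  simp only [mul_pow]
  rw [Finset.prod_mul_distrib, Finset.prod_pow_eq_pow_sum, ← h1, Finsupp.degree_apply]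
  ring

/-- A form of degree n divided by the n-th power of X l is a polynomial in the ratios X k / X l. -/
lemma range_awayEval_aeval {K : Type} [Field K] [Algebra ℂ K] {m : ℕ} (c : Fin (m + 1) → K)
    {l : Fin (m + 1)} (h0 : (MvPolynomial.aeval (R := ℂ) c).toRingHom (MvPolynomial.X l) ≠ 0) :
    (awayEval (MvPolynomial.homogeneousSubmodule (Fin (m + 1)) ℂ) _ h0).range =
      (Algebra.adjoin ℂ (Set.range fun k => c k / c l)).toSubring := by
  have hX (k : Fin (m + 1)) :
      MvPolynomial.X k ∈ MvPolynomial.homogeneousSubmodule (Fin (m + 1)) ℂ 1 :=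
    MvPolynomial.isHomogeneous_X ℂ k
  have hcl (k : Fin (m + 1)) : (MvPolynomial.aeval (R := ℂ) c).toRingHom (MvPolynomial.X k) = c k :=
    MvPolynomial.aeval_X c k
  have hl : c l ≠ 0 := hcl l ▸ h0
  refine le_antisymm ?_ ?_
  · rintro _ ⟨a, rfl⟩
    obtain ⟨n, p, hp, rfl⟩ := Away.mk_surjective _ (hX l) a
    rw [awayEval_mk, hcl]
    have h1 : (MvPolynomial.aeval (R := ℂ) c).toRingHom p / c l ^ n =
        MvPolynomial.aeval (fun k => c k / c l) p := by
      have hp' : p.IsHomogeneous n := by simpa using hp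
      rw [div_eq_iff (pow_ne_zero _ hl), mul_comm, ← aeval_eq_pow_mul_of_isHomogeneous hp']
      change MvPolynomial.aeval c p = _
      congr 2
      ext k
      field_simp
    rw [h1, Algebra.adjoin_range_eq_range_aeval]
    exact ⟨p, rfl⟩
  · let S : Subalgebra ℂ K :=
      { (awayEval (MvPolynomial.homogeneousSubmodule (Fin (m + 1)) ℂ) _ h0).range with
        algebraMap_mem' := fun r => ⟨Away.mk _ (hX l) 0 (MvPolynomial.C r)
          (by simp), by
            rw [awayEval_mk]
            simp⟩ }
    suffices Algebra.adjoin ℂ (Set.range fun k => c k / c l) ≤ S from this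
    refine Algebra.adjoin_le ?_
    rintro _ ⟨k, rfl⟩
    refine ⟨Away.mk _ (hX l) 1 (MvPolynomial.X k) (by simpa using hX k), ?_⟩
    rw [awayEval_mk, hcl, hcl, pow_one]

end ProjEmbedding

/-! ### Closed embeddings of proper complex varieties by coordinates -/

section ComplexProjectiveSpace

open HomogeneousLocalization

instance (m : ℕ) : Algebra.FiniteType (MvPolynomial.homogeneousSubmodule (Fin (m + 1)) ℂ 0)
    (MvPolynomial (Fin (m + 1)) ℂ) :=
  have : IsScalarTower ℂ (MvPolynomial.homogeneousSubmodule (Fin (m + 1)) ℂ 0)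
      (MvPolynomial (Fin (m + 1)) ℂ) := ⟨fun a b c => smul_assoc a b.1 c⟩
  .of_restrictScalars_finiteType ℂ _ _

/-- `Proj` is proper over the spectrum of its degree-zero part. That part consists of the constants,
so the remaining map to Spec ℂ is a closed immersion. -/
instance (m : ℕ) : IsProper (complexProjectiveSpaceStr m) := by
  have : IsClosedImmersion (Spec.map (CommRingCat.ofHom
      (algebraMap ℂ (MvPolynomial.homogeneousSubmodule (Fin (m + 1)) ℂ 0)))) := by
    refine IsClosedImmersion.spec_of_surjective _ fun p => ?_
    have hp : p.1.IsHomogeneous 0 := p.2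
    refine ⟨p.1.coeff 0, Subtype.ext ?_⟩
    exact (MvPolynomial.totalDegree_eq_zero_iff_eq_C.mp (Nat.le_zero.mp hp.totalDegree_le)).symm
  have h : IsProper (Proj.toSpecZero (MvPolynomial.homogeneousSubmodule (Fin (m + 1)) ℂ)) :=
    inferInstance
  exact MorphismProperty.comp_mem @IsProper _ _ h inferInstance

lemma awayEval_fromZeroRingHom {σ : Type*} {A : Type u} [CommRing A] [SetLike σ A]
    [AddSubgroupClass σ A] (𝒜 : ℕ → σ) [GradedRing 𝒜] {K : Type u} [Field K] (Θ : A →+* K) {t : A}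
    (h0 : Θ t ≠ 0) (a : 𝒜 0) :
    awayEval 𝒜 Θ h0 (fromZeroRingHom 𝒜 (.powers t) a) = Θ a :=
  IsLocalization.Away.lift_eq (S := Localization.Away t) t h0.isUnit (a : A)

variable {Y : Scheme.{0}} (s : Y ⟶ Spec (.of ℂ))

/-- The structure homomorphism of the ring of sections of a complex scheme. -/
def scalarHom (U : Y.Opens) : ℂ →+* Γ(Y, U) :=
  (s.appLE ⊤ U le_top).hom.comp (Scheme.ΓSpecIso (.of ℂ)).inv.hom

lemma map_scalarHom {U W : Y.Opens} (h : W ≤ U) (r : ℂ) :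
    Y.presheaf.map (homOfLE h).op (scalarHom s U r) = scalarHom s W r := by
  simp only [scalarHom, RingHom.comp_apply]
  exact congr($(Scheme.Hom.appLE_map s (le_top : U ≤ s ⁻¹ᵁ ⊤) (homOfLE h).op) _)

lemma fromSpec_comp {U : Y.Opens} (hU : IsAffineOpen U) :
    hU.fromSpec ≫ s = Spec.map (CommRingCat.ofHom (scalarHom s U)) := by
  rw [← (isAffineOpen_top (Spec (.of ℂ))).SpecMap_appLE_fromSpec s hU le_top,
    IsAffineOpen.fromSpec_top, Scheme.isoSpec_Spec_inv, ← Spec.map_comp]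
  rfl

variable [IsIntegral Y]

/-- The function field of a complex variety as a complex algebra. -/
@[reducible]
def functionFieldAlgebra : Algebra ℂ Y.functionField :=
  ((Y.presheaf.germ ⊤ (genericPoint Y) trivial).hom.comp (scalarHom s ⊤)).toAlgebra

lemma germToFunctionField_scalarHom (U : Y.Opens) [Nonempty U] (r : ℂ) :
    Y.germToFunctionField U (scalarHom s U r) = (functionFieldAlgebra s).algebraMap r := by
  rw [← map_scalarHom s (le_top : U ≤ ⊤)]
  exact Y.presheaf.germ_res_apply _ _ _ _

/-- A proper complex variety embeds into projective space by homogeneous coordinates in the function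
field, if the ratios of the coordinates generate the rings of the affine opens of a cover. -/
theorem exists_isClosedImmersion_of_coordinates [IsProper s] {ι : Type} {U : ι → Y.Opens}
    [hne : ∀ i, Nonempty (U i)] (hU : ∀ i, IsAffineOpen (U i)) (hcov : ∀ y : Y, ∃ i, y ∈ U i)
    {m : ℕ} (c : Fin (m + 1) → Y.functionField) (l : ι → Fin (m + 1)) (hl : ∀ i, c (l i) ≠ 0)
    (hrange : letI := functionFieldAlgebra s
      ∀ i, (Algebra.adjoin ℂ (Set.range fun k => c k / c (l i))).toSubring =
        (Y.germToFunctionField (U i)).hom.range)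
    (hle : ∀ i j (b : Γ(Y, U i)), Y.germToFunctionField (U i) b = c (l j) / c (l i) →
      Y.basicOpen b ≤ U j) :
    ∃ φ : Y ⟶ complexProjectiveSpace m, IsClosedImmersion φ ∧
      φ ≫ complexProjectiveSpaceStr m = s := by
  let := functionFieldAlgebra s
  let 𝒜 := MvPolynomial.homogeneousSubmodule (Fin (m + 1)) ℂ
  let Θ : MvPolynomial (Fin (m + 1)) ℂ →+* Y.functionField := (MvPolynomial.aeval (R := ℂ) c).toRingHom
  let t (i : ι) : MvPolynomial (Fin (m + 1)) ℂ := MvPolynomial.X (l i)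
  have ht (i : ι) : t i ∈ 𝒜 1 := MvPolynomial.isHomogeneous_X ℂ (l i)
  have hΘ (i : ι) : Θ (t i) = c (l i) := MvPolynomial.aeval_X c (l i)
  have ht0 (i : ι) : Θ (t i) ≠ 0 := hΘ i ▸ hl i
  have hr (i : ι) : (awayEval 𝒜 Θ (ht0 i)).range = (Y.germToFunctionField (U i)).hom.range :=
    (range_awayEval_aeval c (ht0 i)).trans (hrange i)
  have hinj (i : ι) : Function.Injective (Y.germToFunctionField (U i)).hom :=
    Y.germToFunctionField_injective (U i)
  let e (i : ι) := RingEquiv.ofBijective (Y.germToFunctionField (U i)).hom.rangeRestrict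
    ⟨fun a b h => hinj i (congr_arg Subtype.val h), RingHom.rangeRestrict_surjective _⟩
  -- Both rings have the same image in the function field, and Γ(Y, U i) injects into it, so the
  -- evaluation of fractions lifts to Γ(Y, U i).
  let g (i : ι) : Away 𝒜 (t i) →+* Γ(Y, U i) := (e i).symm.toRingHom.comp
    ((awayEval 𝒜 Θ (ht0 i)).codRestrict _ fun a => hr i ▸ ⟨a, rfl⟩)
  have hg (i : ι) (a) : Y.germToFunctionField (U i) (g i a) = awayEval 𝒜 Θ (ht0 i) a :=
    congr_arg Subtype.val ((e i).apply_symm_apply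
      (((awayEval 𝒜 Θ (ht0 i)).codRestrict _ fun a => hr i ▸ ⟨a, rfl⟩) a))
  have hsurj (i : ι) : Function.Surjective (g i) := fun b => by
    obtain ⟨a, ha⟩ := (hr i).ge ⟨b, rfl⟩
    exact ⟨a, hinj i ((hg i a).trans ha)⟩
  obtain ⟨φ, hφ⟩ := exists_fromSpec_comp_eq hU hcov Θ ht ht0 hg
  have hs : φ ≫ complexProjectiveSpaceStr m = s := by
    have H (i : ι) : (hU i).fromSpec ≫ φ ≫ complexProjectiveSpaceStr m = (hU i).fromSpec ≫ s := by
      rw [fromSpec_comp s]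
      change (hU i).fromSpec ≫ φ ≫ Proj.toSpecZero 𝒜 ≫
        Spec.map (CommRingCat.ofHom (algebraMap ℂ (𝒜 0))) = _
      rw [← Category.assoc, hφ, Category.assoc, Proj.awayι_toSpecZero_assoc, ← Spec.map_comp,
        ← Spec.map_comp]
      congr 1
      ext r
      refine hinj i ((hg i _).trans (Eq.trans ?_ (germToFunctionField_scalarHom s (U i) r).symm))
      refine (awayEval_fromZeroRingHom 𝒜 Θ (ht0 i) _).trans ?_
      exact MvPolynomial.aeval_C c r
    exact (affineOpensCover hU hcov).hom_ext _ _ H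
  refine ⟨φ, ?_, hs⟩
  let φ' : Y ⟶ complexProjectiveSpace m := φ
  -- Projective space is separated over ℂ, so properness of Y makes φ proper, in particular closed.
  have : IsProper (φ' ≫ complexProjectiveSpaceStr m) := by
    change IsProper (φ ≫ complexProjectiveSpaceStr m)
    rwa [hs]
  have hprop : IsProper φ' := .of_comp φ' (complexProjectiveSpaceStr m)
  refine isClosedImmersion_of_isClosedMap hU hcov ht hsurj (fun i j => hle i j _ ?_) hφ φ'.isClosedMap
  rw [hg, awayEval_mk, pow_one, pow_one, hΘ, hΘ]

end ComplexProjectiveSpace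

/-! ### Choice of the homogeneous coordinates -/

section Coordinates

variable {Y : Scheme.{0}} [IsIntegral Y]

lemma exists_finset_adjoin_eq_range (s : Y ⟶ Spec (.of ℂ)) [LocallyOfFiniteType s] {U : Y.Opens}
    [Nonempty U] (hU : IsAffineOpen U) :
    letI := functionFieldAlgebra s
    ∃ B : Finset Y.functionField, (Algebra.adjoin ℂ (B : Set Y.functionField)).toSubring =
      (Y.germToFunctionField U).hom.range := by
  let := functionFieldAlgebra s
  let : Algebra ℂ Γ(Y, U) := (scalarHom s U).toAlgebra
  have hft : Algebra.FiniteType ℂ Γ(Y, U) := by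
    have h1 := LocallyOfFiniteType.finiteType_appLE (f := s) (isAffineOpen_top _) hU le_top
    have h2 : (scalarHom s U).FiniteType := h1.comp (RingHom.FiniteType.of_surjective _
      (Scheme.ΓSpecIso (.of ℂ)).symm.commRingCatIsoToRingEquiv.surjective)
    exact h2
  let φ : Γ(Y, U) →ₐ[ℂ] Y.functionField :=
    { (Y.germToFunctionField U).hom with
      commutes' := germToFunctionField_scalarHom s U }
  obtain ⟨B, hB⟩ := hft.out.map φ
  refine ⟨B, ?_⟩
  rw [hB, Algebra.map_top]
  rfl

/-- A section over `U i` extends to `U j` after multiplication by a power of a function that defines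
`U i ⊓ U j` in `U j`. -/
lemma eventually_mul_pow_mem_range {U W : Y.Opens} [Nonempty U] [Nonempty W] (hW : IsAffineOpen W)
    {x v : Y.functionField} (hx : x ∈ (Y.germToFunctionField U).hom.range) {b : Γ(Y, W)}
    (hb : Y.germToFunctionField W b = v) (hbU : Y.basicOpen b ≤ U) (hb0 : v ≠ 0) :
    ∀ᶠ n : ℕ in Filter.atTop, x * v ^ n ∈ (Y.germToFunctionField W).hom.range := by
  obtain ⟨a, rfl⟩ := hx
  subst hb
  have := hW.isLocalization_basicOpen b
  have hmem : genericPoint Y ∈ Y.basicOpen b := by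
    refine ((genericPoint_spec Y).mem_open_set_iff (Y.basicOpen b).2).mpr ?_
    rw [Set.univ_inter, Set.nonempty_iff_ne_empty]
    intro h
    have h0 : b = 0 := (basicOpen_eq_bot_iff b).mp (Opens.ext h)
    exact hb0 (by rw [h0, map_zero])
  obtain ⟨N, a', ha'⟩ := IsLocalization.Away.surj b (Y.presheaf.map (homOfLE hbU).op a)
  have key : (Y.germToFunctionField U).hom a * (Y.germToFunctionField W b) ^ N =
      (Y.germToFunctionField W) a' := by
    have h1 := congr(Y.presheaf.germ _ (genericPoint Y) hmem $ha')
    have h2 (x : Γ(Y, W)) : Y.presheaf.germ _ (genericPoint Y) hmem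
        (algebraMap Γ(Y, W) Γ(Y, Y.basicOpen b) x) = Y.germToFunctionField W x :=
      Y.presheaf.germ_res_apply (homOfLE (Y.basicOpen_le b)) _ hmem x
    rw [map_mul, map_pow, h2, h2] at h1
    rw [← h1, Y.presheaf.germ_res_apply (homOfLE hbU) _ hmem a]
  -- Beyond the least exponent that clears the pole, extra factors b stay regular. The eventual form
  -- lets finitely many such conditions hold together.
  filter_upwards [Filter.eventually_ge_atTop N] with n hn
  refine ⟨a' * b ^ (n - N), ?_⟩
  obtain ⟨k, rfl⟩ := Nat.exists_eq_add_of_le hn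
  rw [map_mul, map_pow, Nat.add_sub_cancel_left, pow_add, ← mul_assoc]
  exact congr($key.symm * _)

/-- An integral complex scheme that is proper and has an affine cover defined by the members of a
finite family of rational functions embeds into projective space. -/
theorem exists_isClosedImmersion_of_cover (s : Y ⟶ Spec (.of ℂ)) [IsProper s] {ι : Type} [Finite ι]
    {U : ι → Y.Opens} [hne : ∀ i, Nonempty (U i)] (hU : ∀ i, IsAffineOpen (U i))
    (hcov : ∀ y : Y, ∃ i, y ∈ U i) (v : ι → Y.functionField) (hv : ∀ i, v i ≠ 0)
    (hb : ∀ i j, ∃ b : Γ(Y, U j), Y.germToFunctionField (U j) b = v i / v j ∧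
      Y.basicOpen b ≤ U i) :
    ∃ (m : ℕ) (φ : Y ⟶ complexProjectiveSpace m), IsClosedImmersion φ ∧
      φ ≫ complexProjectiveSpaceStr m = s := by
  classical
  let := functionFieldAlgebra s
  let R (i : ι) := (Y.germToFunctionField (U i)).hom.range
  choose B hB using fun i => exists_finset_adjoin_eq_range s (hU i)
  -- One exponent clears the denominators of all generators on all charts. The element 1 is included
  -- so that v i ^ d itself becomes a coordinate, and d > 0 is needed for b ^ d to have the same
  -- basic open as b.
  obtain ⟨d, hd0, hd⟩ : ∃ d : ℕ, 0 < d ∧ ∀ i j, ∀ x ∈ insert 1 (B i), x * (v i / v j) ^ d ∈ R j := by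
    have h : ∀ᶠ d : ℕ in Filter.atTop, ∀ i j, ∀ x ∈ insert 1 (B i), x * (v i / v j) ^ d ∈ R j := by
      refine Filter.eventually_all.mpr fun i => Filter.eventually_all.mpr fun j =>
        (Filter.eventually_all_finset _).mpr fun x hx => ?_
      obtain ⟨b, hb1, hb2⟩ := hb i j
      refine eventually_mul_pow_mem_range (U := U i) (hU j) ?_ hb1 hb2 (div_ne_zero (hv i) (hv j))
      rcases Finset.mem_insert.mp hx with rfl | hx
      · exact one_mem _
      · rw [← hB i]
        exact Algebra.subset_adjoin hx
    exact ((Filter.eventually_gt_atTop 0).and h).exists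
  have := Fintype.ofFinite ι
  let C : Finset Y.functionField := Finset.univ.biUnion fun i => (insert 1 (B i)).image (· * v i ^ d)
  have hC {x} : x ∈ C ↔ ∃ i, ∃ y ∈ insert 1 (B i), y * v i ^ d = x := by
    simp only [C, Finset.mem_biUnion, Finset.mem_univ, true_and, Finset.mem_image]
  have hCv (i : ι) : v i ^ d ∈ C := hC.mpr ⟨i, 1, Finset.mem_insert_self _ _, one_mul _⟩
  obtain ⟨i₀, -⟩ := hcov (genericPoint Y)
  -- The cover has a member, so the family of coordinates is nonempty and its size has the form m +
  -- 1.
  obtain ⟨m, hm⟩ := Nat.exists_eq_succ_of_ne_zero (Finset.card_ne_zero_of_mem (hCv i₀))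
  let e := C.equivFinOfCardEq hm
  let c (k : Fin (m + 1)) : Y.functionField := (e.symm k : Y.functionField)
  have hc (x) (hx : x ∈ C) : c (e ⟨x, hx⟩) = x := by simp [c]
  have hvd (i : ι) : v i ^ d ≠ 0 := pow_ne_zero _ (hv i)
  refine ⟨m, exists_isClosedImmersion_of_coordinates s hU hcov c (fun i => e ⟨_, hCv i⟩)
    (fun i => by rw [hc]; exact hvd i) (fun j => ?_) (fun i j b hgb => ?_)⟩
  · simp only [hc]
    refine le_antisymm ?_ ?_
    · let S : Subalgebra ℂ Y.functionField :=
        { R j with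
          algebraMap_mem' := fun r => ⟨scalarHom s (U j) r, germToFunctionField_scalarHom s (U j) r⟩ }
      suffices Algebra.adjoin ℂ (Set.range fun k => c k / v j ^ d) ≤ S from this
      refine Algebra.adjoin_le ?_
      rintro _ ⟨k, rfl⟩
      obtain ⟨i, y, hy, hyk⟩ := hC.mp (e.symm k).2
      have h1 := hd i j y hy
      rw [div_pow, ← mul_div_assoc, hyk] at h1
      exact h1
    · rw [← hB j]
      change Algebra.adjoin ℂ _ ≤ Algebra.adjoin ℂ _
      refine Algebra.adjoin_le fun y hy => Algebra.subset_adjoin ?_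
      refine ⟨e ⟨y * v j ^ d, hC.mpr ⟨j, y, Finset.mem_insert_of_mem hy, rfl⟩⟩, ?_⟩
      simp only [hc]
      exact mul_div_cancel_right₀ y (hvd j)
  · obtain ⟨b', hb1, hb2⟩ := hb j i
    rw [hc, hc, ← div_pow, ← hb1, ← map_pow] at hgb
    obtain rfl := Y.germToFunctionField_injective (U i) hgb
    rw [Scheme.basicOpen_pow _ _ hd0]
    exact hb2

end Coordinates

/-! ### Ratios of linear forms and their pullback to a function field -/

section Ratio

open HomogeneousLocalization

variable {σ : Type*} {A : Type u} [CommRing A] [SetLike σ A] [AddSubgroupClass σ A]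
  (𝒜 : ℕ → σ) [GradedRing 𝒜]

/-- The function `u / t` on `D₊(t)`, for linear forms `t` and `u`. -/
def linearRatio {t u : A} (ht : t ∈ 𝒜 1) (hu : u ∈ 𝒜 1) : Γ(Proj 𝒜, Proj.basicOpen 𝒜 t) :=
  Proj.awayToSection 𝒜 t (Away.mk 𝒜 ht 1 u (by simpa using hu))

/-- The fraction `u / t` in the local ring of `Proj` at a point of `D₊(t)`. -/
def linearFraction {t u : A} (ht : t ∈ 𝒜 1) (hu : u ∈ 𝒜 1) (x : ProjectiveSpectrum 𝒜)
    (hx : x ∈ Proj.basicOpen 𝒜 t) : AtPrime 𝒜 x.asHomogeneousIdeal.toIdeal :=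
  HomogeneousLocalization.mk ⟨1, ⟨u, hu⟩, ⟨t, ht⟩, hx⟩

lemma stalkIso_germ_linearRatio {t u : A} (ht : t ∈ 𝒜 1) (hu : u ∈ 𝒜 1)
    (x : ProjectiveSpectrum 𝒜) (hx : x ∈ Proj.basicOpen 𝒜 t) :
    Proj.stalkIso' 𝒜 x ((Proj 𝒜).presheaf.germ (Proj.basicOpen 𝒜 t) x hx (linearRatio 𝒜 ht hu)) =
      linearFraction 𝒜 ht hu x hx := by
  refine (Proj.stalkIso'_germ 𝒜 _ x hx _).trans ?_
  refine HomogeneousLocalization.val_injective _ ?_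
  refine (ProjectiveSpectrum.Proj.awayToSection_apply 𝒜 t _ ⟨x, hx⟩).trans ?_
  rw [linearFraction, HomogeneousLocalization.val_mk, Away.val_mk, Localization.mk_eq_mk',
    IsLocalization.map_mk', Localization.mk_eq_mk']
  simp

lemma linearFraction_mul {t u v : A} (ht : t ∈ 𝒜 1) (hu : u ∈ 𝒜 1) (hv : v ∈ 𝒜 1)
    (x : ProjectiveSpectrum 𝒜) (hx : x ∈ Proj.basicOpen 𝒜 t) (hx' : x ∈ Proj.basicOpen 𝒜 u) :
    linearFraction 𝒜 ht hu x hx * linearFraction 𝒜 hu hv x hx' = linearFraction 𝒜 ht hv x hx := by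
  refine HomogeneousLocalization.val_injective _ ?_
  rw [HomogeneousLocalization.val_mul, linearFraction, linearFraction, linearFraction,
    HomogeneousLocalization.val_mk, HomogeneousLocalization.val_mk, HomogeneousLocalization.val_mk,
    Localization.mk_mul, Localization.mk_eq_mk_iff, Localization.r_iff_exists]
  exact ⟨1, by simp; ring⟩

lemma linearFraction_self {t : A} (ht : t ∈ 𝒜 1) (x : ProjectiveSpectrum 𝒜)
    (hx : x ∈ Proj.basicOpen 𝒜 t) : linearFraction 𝒜 ht ht x hx = 1 := by
  refine HomogeneousLocalization.val_injective _ ?_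
  rw [HomogeneousLocalization.val_one, linearFraction, HomogeneousLocalization.val_mk]
  exact Localization.mk_self (⟨t, hx⟩ : x.asHomogeneousIdeal.toIdeal.primeCompl)

/-- Where u / t is a unit of the local ring, the numerator u lies outside the prime. -/
lemma basicOpen_linearRatio_le {t u : A} (ht : t ∈ 𝒜 1) (hu : u ∈ 𝒜 1) :
    (Proj 𝒜).basicOpen (linearRatio 𝒜 ht hu) ≤ Proj.basicOpen 𝒜 u := by
  intro (x : ProjectiveSpectrum 𝒜) hx
  have hxt : x ∈ Proj.basicOpen 𝒜 t := (Proj 𝒜).basicOpen_le _ hx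
  have h := (((Proj 𝒜).mem_basicOpen _ x hxt).mp hx).map (Proj.stalkIso' 𝒜 x)
  have h' : IsUnit (linearFraction 𝒜 ht hu x hxt) := stalkIso_germ_linearRatio 𝒜 ht hu x hxt ▸ h
  rw [← HomogeneousLocalization.isUnit_iff_isUnit_val, linearFraction,
    HomogeneousLocalization.val_mk, Localization.mk_eq_mk',
    IsLocalization.AtPrime.isUnit_mk'_iff _ x.asHomogeneousIdeal.toIdeal] at h'
  exact h'

variable {Y : Scheme.{u}} [IsIntegral Y] (f : Y ⟶ Proj 𝒜)

/-- Pullback of fractions in the local ring at the image of the generic point. -/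
def fractionPullback :
    AtPrime 𝒜 (show ProjectiveSpectrum 𝒜 from f (genericPoint Y)).asHomogeneousIdeal.toIdeal →+*
      Y.functionField :=
  (f.stalkMap (genericPoint Y)).hom.comp (Proj.stalkIso' 𝒜 (f (genericPoint Y))).symm.toRingHom

lemma germToFunctionField_app_linearRatio {t u : A} (ht : t ∈ 𝒜 1) (hu : u ∈ 𝒜 1)
    [Nonempty (f ⁻¹ᵁ Proj.basicOpen 𝒜 t)] (h : f (genericPoint Y) ∈ Proj.basicOpen 𝒜 t) :
    Y.germToFunctionField (f ⁻¹ᵁ Proj.basicOpen 𝒜 t) (f.app _ (linearRatio 𝒜 ht hu)) =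
      fractionPullback 𝒜 f (linearFraction 𝒜 ht hu _ h) := by
  rw [← stalkIso_germ_linearRatio]
  refine (f.germ_stalkMap_apply _ _ h _).symm.trans ?_
  have := (Proj.stalkIso' 𝒜 (f (genericPoint Y))).symm_apply_apply
    ((Proj 𝒜).presheaf.germ (Proj.basicOpen 𝒜 t) _ h (linearRatio 𝒜 ht hu))
  exact congr_arg (f.stalkMap (genericPoint Y)) this.symm

end Ratio

/-- A variety that is affine over projective space and proper is projective. -/
theorem exists_isClosedImmersion_of_isAffineHom {Y : Scheme.{0}} [IsIntegral Y] {n : ℕ}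
    (f : Y ⟶ complexProjectiveSpace n) [IsAffineHom f] (s : Y ⟶ Spec (.of ℂ)) [IsProper s] :
    ∃ (m : ℕ) (φ : Y ⟶ complexProjectiveSpace m), IsClosedImmersion φ ∧
      φ ≫ complexProjectiveSpaceStr m = s := by
  let 𝒜 := MvPolynomial.homogeneousSubmodule (Fin (n + 1)) ℂ
  let f' : Y ⟶ Proj 𝒜 := f
  have : IsAffineHom f' := ‹IsAffineHom f›
  let t (i : Fin (n + 1)) : MvPolynomial (Fin (n + 1)) ℂ := MvPolynomial.X i
  have ht (i) : t i ∈ 𝒜 1 := MvPolynomial.isHomogeneous_X ℂ i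
  let U (i : Fin (n + 1)) : Y.Opens := f' ⁻¹ᵁ Proj.basicOpen 𝒜 (t i)
  -- Coordinates that vanish identically on Y are discarded: their charts are empty, and a germ at
  -- the generic point needs a nonempty open.
  let ι := {i : Fin (n + 1) // Nonempty (U i)}
  have hne (i : ι) : Nonempty (U i) := i.2
  have hcov (y : Y) : ∃ i : ι, y ∈ U i := by
    have h1 : ⨆ i, Proj.basicOpen 𝒜 (t i) = ⊤ := by
      refine Proj.iSup_basicOpen_eq_top' 𝒜 t (fun i => ⟨1, ht i⟩) ?_
      refine top_le_iff.mp fun p _ => ?_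
      induction p using MvPolynomial.induction_on with
      | C a => exact Subalgebra.algebraMap_mem _ (⟨.C a, MvPolynomial.isHomogeneous_C _ a⟩ : 𝒜 0)
      | add p q hp hq => exact add_mem (hp trivial) (hq trivial)
      | mul_X p i hp => exact mul_mem (hp trivial) (Algebra.subset_adjoin ⟨i, rfl⟩)
    obtain ⟨i, hi⟩ := Opens.mem_iSup.mp (h1.ge (Opens.mem_top (f' y)))
    exact ⟨⟨i, ⟨y, hi⟩⟩, hi⟩
  have hη (i : ι) : f' (genericPoint Y) ∈ Proj.basicOpen 𝒜 (t i) :=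
    ((genericPoint_spec Y).mem_open_set_iff (U i).2).mpr
      (by obtain ⟨y⟩ := hne i; exact ⟨y.1, trivial, y.2⟩)
  obtain ⟨i₀, -⟩ := hcov (genericPoint Y)
  -- The rational function x i / x i₀ on Y; it is nonzero because x i₀ / x i pulls back to its
  -- inverse.
  let v (i : ι) : Y.functionField :=
    fractionPullback 𝒜 f' (linearFraction 𝒜 (ht i₀) (ht i) _ (hη i₀))
  have hv (i : ι) : v i ≠ 0 := by
    refine IsUnit.ne_zero (IsUnit.of_mul_eq_one
      (fractionPullback 𝒜 f' (linearFraction 𝒜 (ht i) (ht i₀) _ (hη i))) ?_)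
    rw [← map_mul, linearFraction_mul, linearFraction_self, map_one]
  refine exists_isClosedImmersion_of_cover s (U := fun i : ι => U i)
    (fun i => (Proj.isAffineOpen_basicOpen 𝒜 (t i) (ht i) one_pos).preimage f') hcov v hv
    fun i j => ⟨f'.app _ (linearRatio 𝒜 (ht j) (ht i)), ?_, ?_⟩
  · rw [germToFunctionField_app_linearRatio 𝒜 f' _ _ (hη j), eq_div_iff (hv j), mul_comm, ← map_mul,
      linearFraction_mul]
  · rw [← Scheme.preimage_basicOpen]
    exact f'.preimage_mono (basicOpen_linearRatio_le 𝒜 _ _)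

end

end HiggsCover

/-! ### The theorem -/

theorem mainTheorem1 {X Z : Scheme.{0}} (sX : X ⟶ Spec (.of ℂ)) (sZ : Z ⟶ Spec (.of ℂ))
    (hX : HiggsCover.IsProjectiveVariety sX) (hXsm : Smooth sX)
    (hZ : HiggsCover.IsProjectiveVariety sZ) (hZsm : Smooth sZ)
    (π : X ⟶ Z) (hπ : π ≫ sZ = sX) (hπfin : IsFinite π) (hπsurj : Surjective π)
    (M : X.Modules) (hMcoh : HiggsCover.IsCoherentSheaf M)
    (hMtf : HiggsCover.IsTorsionFreeSheaf M) (hM0 : ¬ IsZero M)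
    (V : Z.Modules) (hV : HiggsCover.IsVectorBundle V)
    (σ : Γ((Scheme.Modules.pullback π).obj V, ⊤)) :
    (∃! Φ : (Scheme.Modules.pushforward π).obj M ⟶
        HiggsCover.tensor ((Scheme.Modules.pushforward π).obj M) V,
      HiggsCover.IsPushforwardHiggs π M V σ Φ) ∧
    ∀ Φ : (Scheme.Modules.pushforward π).obj M ⟶
        HiggsCover.tensor ((Scheme.Modules.pushforward π).obj M) V,
      HiggsCover.IsPushforwardHiggs π M V σ Φ →
      HiggsCover.IsHiggsField Φ ∧
      ∃ (Y : Scheme.{0}) (p : X ⟶ Y) (q : Y ⟶ Z) (h : p ≫ q = π),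
        HiggsCover.IsProjectiveVariety (q ≫ sZ) ∧ HiggsCover.IsNormalScheme Y ∧
        IsFinite p ∧ IsFinite q ∧
        (∃ τ : Γ((Scheme.Modules.pullback q).obj V, ⊤),
          HiggsCover.pullSectionComp h V τ = σ ∧
          ∃ Ψ : (Scheme.Modules.pushforward q).obj ((Scheme.Modules.pushforward p).obj M) ⟶
              HiggsCover.tensor ((Scheme.Modules.pushforward q).obj
                ((Scheme.Modules.pushforward p).obj M)) V,
            HiggsCover.IsPushforwardHiggs q ((Scheme.Modules.pushforward p).obj M) V τ Ψ ∧
            HiggsCover.conjHiggs (HiggsCover.pushforwardFactor h M) V Ψ = Φ) ∧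
        ∃ ν : Y ⟶ HiggsCover.spectralCover hV Φ, HiggsCover.IsNormalization ν ∧
          ν ≫ HiggsCover.spectralCoverProj hV Φ = q := by
  have := hX.1
  have := hZ.1
  obtain ⟨n, i, hi, hiZ⟩ := hZ.2
  have : IsProper sZ := by
    rw [← hiZ]
    infer_instance
  have : IsLocallyNoetherian Z := LocallyOfFiniteType.isLocallyNoetherian sZ
  have : CompactSpace Z := QuasiCompact.compactSpace_of_compactSpace sZ
  refine ⟨HiggsCover.existsUnique_isPushforwardHiggs π M hV σ, fun Φ hΦ => ⟨hΦ.isHiggsField, ?_⟩⟩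
  obtain ⟨Y, p, q, h, hY, hYn, hp, hq, hτ, hν⟩ :=
    HiggsCover.exists_spectralCover_normalization π (HiggsCover.isNormalOfCharZero_of_smooth sX)
      (HiggsCover.isNormalOfCharZero_of_smooth sZ) hMcoh hMtf hM0 hV σ hΦ
  refine ⟨Y, p, q, h, ⟨hY, ?_⟩, hYn, hp, hq, hτ, hν⟩
  -- Since q is finite and i is a closed immersion, Y is affine over ℙⁿ, and it is proper over ℂ
  -- because Z is.
  exact HiggsCover.exists_isClosedImmersion_of_isAffineHom (q ≫ i) (q ≫ sZ)
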